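/- Let $\mathcal{H}$ be the twisted Heisenberg–Virasoro algebra, the complex Lie algebra with basis $L(n), I(n)$ ($n\in\mathbb{Z}$), $C_L, C_{LI}, C_I$ and brackets $$[L(n),L(m)]=(n-m)L(n+m)+\delta_{n,-m}\tfrac{n^3-n}{12}C_L,\qquad [L(n),I(m)]=-m\,I(n+m)-\delta_{n,-m}(n^2+n)C_{LI},$$ $$[I(n),I(m)]=n\,\delta_{n,-m}C_I,\qquad C_L, C_{LI}, C_I \text{ central}.$$ For $c_L,c_I,c_{L,I},h,h_I\in\mathbb{C}$ let $V(c_L,c_I,c_{L,I},h,h_I)$ be the Verma module, i.e. the quotient of $U(\mathcal{H})$ by the left ideal generated by $L(n), I(n)$ ($n>0$), $C_L-c_L$, $C_I-c_I$, $C_{LI}-c_{L,I}$, $L(0)-h$, $I(0)-h_I$, and let $L(c_L,c_I,c_{L,I},h,h_I)$ be its irreducible quotient by the sum of all proper submodules. For $\alpha,\beta,F\in\mathbb{C}$ let $V_{\alpha,\beta,F}=\bigoplus_{n\in\mathbb{Z}}\mathbb{C}v_n$ be the intermediate series module with $$L(k)v_n=-(n+\alpha+\beta+k\beta)v_{n+k},\qquad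 I(k)v_n=F v_{n+k},\qquad C_L v_n=C_{LI}v_n=C_I v_n=0 .$$ Theorem. Let $c_L,c_{L,I},h,h_I\in\mathbb{C}$ with $c_{L,I}\neq 0$, and suppose that $p=\frac{h_I}{c_{L,I}}-1$ is a positive integer. Let $\alpha,\beta,F\in\mathbb{C}$, and let $V'$ be either $V_{\alpha,\beta,F}$ itself or any non-trivial irreducible subquotient of $V_{\alpha,\beta,F}$ (here a module is trivial if $\mathcal{H}$ acts on it by zero). Then the $\mathcal{H}$-module $V'\otimes L(c_L,0,c_{L,I},h,h_I)$ is irreducible if and only if $F\neq (i-p)\,c_{L,I}$ for all $i=1,\dots,p$. -/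

import Mathlib

open scoped TensorProduct

noncomputable section

/-- Labels of the standard basis of the twisted Heisenberg-Virasoro algebra. -/
inductive HVirIdx : Type
  | L (n : ℤ)
  | I (n : ℤ)
  | CL
  | CLI
  | CI

/-- The underlying complex vector space of the twisted Heisenberg-Virasoro algebra,
with basis `L(n), I(n)` (`n ∈ ℤ`), `C_L`, `C_{LI}`, `C_I`. -/
def HVir : Type := HVirIdx →₀ ℂ

namespace HVir

instance : AddCommGroup HVir := inferInstanceAs (AddCommGroup (HVirIdx →₀ ℂ))
instance : Module ℂ HVir := inferInstanceAs (Module ℂ (HVirIdx →₀ ℂ))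

/-- The basis vector with a given label. -/
def e (i : HVirIdx) : HVir := (Finsupp.single i (1 : ℂ) : HVirIdx →₀ ℂ)

/-- The bracket of two basis vectors. -/
def basisBracket : HVirIdx → HVirIdx → HVir
  | .L n, .L m => ((n : ℂ) - m) • e (.L (n + m))
      + (if n = -m then ((n : ℂ) ^ 3 - n) / 12 else 0) • e .CL
  | .L n, .I m => (-(m : ℂ)) • e (.I (n + m))
      - (if n = -m then (n : ℂ) ^ 2 + n else 0) • e .CLI
  | .I n, .L m => (n : ℂ) • e (.I (n + m))
      + (if m = -n then (m : ℂ) ^ 2 + m else 0) • e .CLI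
  | .I n, .I m => (if n = -m then (n : ℂ) else 0) • e .CI
  | _, _ => 0

/-- The bilinear extension of `basisBracket`. -/
def bracketHom : HVir →ₗ[ℂ] HVir →ₗ[ℂ] HVir :=
  (Finsupp.linearCombination ℂ fun i : HVirIdx =>
    (Finsupp.linearCombination ℂ (basisBracket i) : (HVirIdx →₀ ℂ) →ₗ[ℂ] HVir) :
      (HVirIdx →₀ ℂ) →ₗ[ℂ] ((HVirIdx →₀ ℂ) →ₗ[ℂ] HVir))

instance : Bracket HVir HVir := ⟨fun x y => bracketHom x y⟩

theorem bracket_def (x y : HVir) : ⁅x, y⁆ = bracketHom x y := rfl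

theorem bracketHom_e (i j : HVirIdx) : bracketHom (e i) (e j) = basisBracket i j := by
  unfold bracketHom e
  erw [Finsupp.linearCombination_single, one_smul, Finsupp.linearCombination_single, one_smul]

theorem hom_ext {M : Type*} [AddCommGroup M] [Module ℂ M] {f g : HVir →ₗ[ℂ] M}
    (h : ∀ i, f (e i) = g (e i)) : f = g :=
  Finsupp.lhom_ext' (φ := (f : (HVirIdx →₀ ℂ) →ₗ[ℂ] M)) (ψ := (g : (HVirIdx →₀ ℂ) →ₗ[ℂ] M))
    fun i => LinearMap.ext_ring (h i)

theorem basisBracket_skew (i j : HVirIdx) : basisBracket i j = -basisBracket j i := by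
  cases i <;> cases j <;> simp only [basisBracket, neg_zero]
  case L.L n m =>
    rw [add_comm m n]
    by_cases h : n = -m
    · subst h; simp only [neg_neg, if_true]; push_cast; module
    · have h' : m ≠ -n := by omega
      simp only [h, h', if_false]; module
  case L.I n m => rw [add_comm m n]; module
  case I.L n m => rw [add_comm m n]; module
  case I.I n m =>
    by_cases h : n = -m
    · subst h; simp only [neg_neg, if_true]; push_cast; module
    · have h' : m ≠ -n := by omega
      simp only [h, h', if_false]; module

theorem induct {P : HVir → Prop} (x : HVir) (h0 : P 0) (hadd : ∀ x y, P x → P y → P (x + y))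
    (hsmul : ∀ (c : ℂ) i, P (c • e i)) : P x :=
  Finsupp.induction_linear (motive := P) x h0 hadd fun i c => by
    have h : c • e i = (Finsupp.single i c : HVirIdx →₀ ℂ) := by
      unfold e
      exact (Finsupp.smul_single c i 1).trans (by rw [smul_eq_mul, mul_one])
    rw [← h]
    exact hsmul c i

theorem bracketHom_skew (x y : HVir) : bracketHom x y = -bracketHom y x := by
  have h : bracketHom = -bracketHom.flip := by
    refine hom_ext fun i => hom_ext fun j => ?_
    rw [LinearMap.neg_apply, LinearMap.neg_apply, LinearMap.flip_apply,
      bracketHom_e, bracketHom_e]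
    exact basisBracket_skew i j
  exact congrArg (fun f : HVir →ₗ[ℂ] HVir →ₗ[ℂ] HVir => f x y) h

theorem basis_jacobi (i j k : HVirIdx) :
    bracketHom (e i) (basisBracket j k) =
      bracketHom (basisBracket i j) (e k) + bracketHom (e j) (basisBracket i k) := by
  cases i <;> cases j <;> cases k <;>
    simp only [basisBracket, map_add, map_sub, map_smul, map_zero, LinearMap.add_apply,
      LinearMap.sub_apply, LinearMap.smul_apply, LinearMap.zero_apply, bracketHom_e,
      smul_zero, add_zero, zero_add, sub_zero]
  case L.L.L a b c =>
    rw [show a + (b + c) = a + b + c by ring, show b + (a + c) = a + b + c by ring]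
    by_cases h : a + b + c = 0
    · obtain rfl : c = -a - b := by omega
      rw [if_pos (by ring), if_pos (by ring), if_pos (by ring)]
      push_cast; module
    · rw [if_neg (by omega), if_neg (by omega), if_neg (by omega)]
      push_cast; module
  case L.L.I a b c =>
    rw [show a + (b + c) = a + b + c by ring, show b + (a + c) = a + b + c by ring]
    by_cases h : a + b + c = 0
    · obtain rfl : c = -a - b := by omega
      rw [if_pos (by ring), if_pos (by ring), if_pos (by ring)]
      push_cast; module
    · rw [if_neg (by omega), if_neg (by omega), if_neg (by omega)]
      push_cast; module
  case L.I.L a b c =>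
    rw [show a + (b + c) = a + b + c by ring, show b + (a + c) = a + b + c by ring]
    by_cases h : a + b + c = 0
    · obtain rfl : c = -a - b := by omega
      rw [if_pos (by ring), if_pos (by ring), if_pos (by ring)]
      push_cast; module
    · rw [if_neg (by omega), if_neg (by omega), if_neg (by omega)]
      push_cast; module
  case I.L.L a b c =>
    rw [show a + (b + c) = a + b + c by ring, show b + (a + c) = a + b + c by ring]
    by_cases h : a + b + c = 0
    · obtain rfl : c = -a - b := by omega
      rw [if_pos (by ring), if_pos (by ring), if_pos (by ring)]
      push_cast; module
    · rw [if_neg (by omega), if_neg (by omega), if_neg (by omega)]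
      push_cast; module
  case L.I.I a b c =>
    by_cases h : a + b + c = 0
    · obtain rfl : c = -a - b := by omega
      rw [if_pos (by ring), if_pos (by ring)]
      push_cast; module
    · rw [if_neg (by omega), if_neg (by omega)]
      push_cast; module
  case I.L.I a b c =>
    by_cases h : a + b + c = 0
    · obtain rfl : c = -a - b := by omega
      rw [if_pos (by ring), if_pos (by ring)]
      push_cast; module
    · rw [if_neg (by omega), if_neg (by omega)]
      push_cast; module
  case I.I.L a b c =>
    by_cases h : a + b + c = 0
    · obtain rfl : c = -a - b := by omega
      rw [if_pos (by ring), if_pos (by ring)]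
      push_cast; module
    · rw [if_neg (by omega), if_neg (by omega)]
      push_cast; module

theorem bracketHom_jacobi (x y z : HVir) :
    bracketHom x (bracketHom y z) =
      bracketHom (bracketHom x y) z + bracketHom y (bracketHom x z) := by
  induction x using induct with
  | h0 => simp
  | hadd x x' hx hx' => simp only [map_add, LinearMap.add_apply, hx, hx']; abel
  | hsmul c i =>
    simp only [map_smul, LinearMap.smul_apply, ← smul_add]
    congr 1
    induction y using induct with
    | h0 => simp
    | hadd y y' hy hy' => simp only [map_add, LinearMap.add_apply, hy, hy']; abel
    | hsmul d j =>
      simp only [map_smul, LinearMap.smul_apply, ← smul_add]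
      congr 1
      induction z using induct with
      | h0 => simp
      | hadd z z' hz hz' => simp only [map_add, hz, hz']; abel
      | hsmul f k =>
        simp only [map_smul, bracketHom_e, ← smul_add]
        rw [basis_jacobi]

instance : LieRing HVir where
  add_lie x y z := by simp only [bracket_def, map_add, LinearMap.add_apply]
  lie_add x y z := by simp only [bracket_def, map_add]
  lie_self x := by
    have h := bracketHom_skew x x
    have h2 : (2 : ℂ) • bracketHom x x = 0 := by
      rw [two_smul]; nth_rewrite 1 [h]; exact neg_add_cancel _
    exact (smul_eq_zero.mp h2).resolve_left two_ne_zero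
  leibniz_lie x y z := bracketHom_jacobi x y z

instance : LieAlgebra ℂ HVir where
  lie_smul t x y := by simp only [bracket_def, map_smul]

end HVir

/-- The space `⨁_{n ∈ ℤ} ℂ v_n` underlying the intermediate series module with
parameters `α, β, F`. -/
def IntermediateSeries (_α _β _F : ℂ) : Type := ℤ →₀ ℂ

namespace IntermediateSeries

variable (α β F : ℂ)

instance : AddCommGroup (IntermediateSeries α β F) := inferInstanceAs (AddCommGroup (ℤ →₀ ℂ))
instance : Module ℂ (IntermediateSeries α β F) := inferInstanceAs (Module ℂ (ℤ →₀ ℂ))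

/-- The basis vector `v_n`. -/
def v (n : ℤ) : IntermediateSeries α β F := (Finsupp.single n (1 : ℂ) : ℤ →₀ ℂ)

/-- The action of a basis vector of the Lie algebra on `v_n`. -/
def basisAction : HVirIdx → ℤ → IntermediateSeries α β F
  | .L k, n => (-((n : ℂ) + α + β + k * β)) • v α β F (n + k)
  | .I k, n => F • v α β F (n + k)
  | _, _ => 0

/-- The bilinear extension of `basisAction`. -/
def actionHom :
    HVir →ₗ[ℂ] IntermediateSeries α β F →ₗ[ℂ] IntermediateSeries α β F :=
  (Finsupp.linearCombination ℂ fun i : HVirIdx =>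
    (Finsupp.linearCombination ℂ (basisAction α β F i) :
      (ℤ →₀ ℂ) →ₗ[ℂ] IntermediateSeries α β F) :
      (HVirIdx →₀ ℂ) →ₗ[ℂ] ((ℤ →₀ ℂ) →ₗ[ℂ] IntermediateSeries α β F))

instance : Bracket HVir (IntermediateSeries α β F) := ⟨fun x m => actionHom α β F x m⟩

theorem bracket_def (x : HVir) (m : IntermediateSeries α β F) :
    ⁅x, m⁆ = actionHom α β F x m := rfl

theorem actionHom_e_v (i : HVirIdx) (n : ℤ) :
    actionHom α β F (HVir.e i) (v α β F n) = basisAction α β F i n := by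
  unfold actionHom HVir.e v
  erw [Finsupp.linearCombination_single, one_smul, Finsupp.linearCombination_single, one_smul]

theorem hom_ext {M : Type*} [AddCommGroup M] [Module ℂ M]
    {f g : IntermediateSeries α β F →ₗ[ℂ] M}
    (h : ∀ n, f (v α β F n) = g (v α β F n)) : f = g :=
  Finsupp.lhom_ext' (φ := (f : (ℤ →₀ ℂ) →ₗ[ℂ] M)) (ψ := (g : (ℤ →₀ ℂ) →ₗ[ℂ] M))
    fun i => LinearMap.ext_ring (h i)

theorem basisAction_lie (i j : HVirIdx) (n : ℤ) :
    actionHom α β F (HVir.e i) (basisAction α β F j n) =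
      actionHom α β F (HVir.basisBracket i j) (v α β F n) +
        actionHom α β F (HVir.e j) (basisAction α β F i n) := by
  cases i <;> cases j <;>
    simp only [basisAction, HVir.basisBracket, map_add, map_sub, map_smul, map_zero,
      LinearMap.add_apply, LinearMap.sub_apply, LinearMap.smul_apply, LinearMap.zero_apply,
      actionHom_e_v, smul_zero, add_zero, zero_add, sub_zero]
  case L.L a b =>
    rw [show n + b + a = n + (a + b) by ring, show n + a + b = n + (a + b) by ring]
    push_cast; module
  case L.I a b =>
    rw [show n + b + a = n + (a + b) by ring, show n + a + b = n + (a + b) by ring]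
    push_cast; module
  case I.L a b =>
    rw [show n + b + a = n + (a + b) by ring, show n + a + b = n + (a + b) by ring]
    push_cast; module
  case I.I a b =>
    rw [show n + b + a = n + (a + b) by ring, show n + a + b = n + (a + b) by ring]

theorem actionHom_lie (x y : HVir) (m : IntermediateSeries α β F) :
    actionHom α β F x (actionHom α β F y m) =
      actionHom α β F ⁅x, y⁆ m + actionHom α β F y (actionHom α β F x m) := by
  simp only [HVir.bracket_def]
  induction x using HVir.induct with
  | h0 => simp
  | hadd x x' hx hx' => simp only [map_add, LinearMap.add_apply, hx, hx']; abel
  | hsmul c i =>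
    simp only [map_smul, LinearMap.smul_apply, ← smul_add]
    congr 1
    induction y using HVir.induct with
    | h0 => simp
    | hadd y y' hy hy' => simp only [map_add, LinearMap.add_apply, hy, hy']; abel
    | hsmul d j =>
      simp only [map_smul, LinearMap.smul_apply, ← smul_add]
      congr 1
      have h := hom_ext α β F
        (f := actionHom α β F (HVir.e i) ∘ₗ actionHom α β F (HVir.e j))
        (g := actionHom α β F (HVir.bracketHom (HVir.e i) (HVir.e j)) +
          actionHom α β F (HVir.e j) ∘ₗ actionHom α β F (HVir.e i)) fun n => by
            simp only [LinearMap.comp_apply, LinearMap.add_apply, actionHom_e_v,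
              HVir.bracketHom_e]
            exact basisAction_lie α β F i j n
      exact congrArg (fun f : _ →ₗ[ℂ] _ => f m) h

instance : LieRingModule HVir (IntermediateSeries α β F) where
  add_lie x y m := by simp only [bracket_def, map_add, LinearMap.add_apply]
  lie_add x m m' := by simp only [bracket_def, map_add]
  leibniz_lie x y m := actionHom_lie α β F x y m

instance : LieModule ℂ HVir (IntermediateSeries α β F) where
  smul_lie t x m := by simp only [bracket_def, map_smul, LinearMap.smul_apply]
  lie_smul t x m := by simp only [bracket_def, map_smul]

end IntermediateSeries

/-- The left ideal of `U(HVir)` generated by `L(n), I(n)` for `n > 0` and by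
`C_L - c_L`, `C_I - c_I`, `C_{LI} - c_{LI}`, `L(0) - h`, `I(0) - h_I`. -/
def vermaIdeal (cL cI cLI h hI : ℂ) : Ideal (UniversalEnvelopingAlgebra ℂ HVir) :=
  Ideal.span
    ({u | ∃ n : ℤ, 0 < n ∧ u = UniversalEnvelopingAlgebra.ι ℂ (HVir.e (.L n))} ∪
      {u | ∃ n : ℤ, 0 < n ∧ u = UniversalEnvelopingAlgebra.ι ℂ (HVir.e (.I n))} ∪
      {UniversalEnvelopingAlgebra.ι ℂ (HVir.e .CL) - algebraMap ℂ _ cL,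
        UniversalEnvelopingAlgebra.ι ℂ (HVir.e .CI) - algebraMap ℂ _ cI,
        UniversalEnvelopingAlgebra.ι ℂ (HVir.e .CLI) - algebraMap ℂ _ cLI,
        UniversalEnvelopingAlgebra.ι ℂ (HVir.e (.L 0)) - algebraMap ℂ _ h,
        UniversalEnvelopingAlgebra.ι ℂ (HVir.e (.I 0)) - algebraMap ℂ _ hI})

/-- The Verma module of highest weight `(c_L, c_I, c_{LI}, h, h_I)`. -/
def Verma (cL cI cLI h hI : ℂ) : Type :=
  UniversalEnvelopingAlgebra ℂ HVir ⧸ vermaIdeal cL cI cLI h hI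

namespace Verma

variable (cL cI cLI h hI : ℂ)

instance : AddCommGroup (Verma cL cI cLI h hI) :=
  inferInstanceAs (AddCommGroup (_ ⧸ vermaIdeal cL cI cLI h hI))
instance : Module (UniversalEnvelopingAlgebra ℂ HVir) (Verma cL cI cLI h hI) :=
  inferInstanceAs (Module _ (_ ⧸ vermaIdeal cL cI cLI h hI))
instance : Module ℂ (Verma cL cI cLI h hI) :=
  inferInstanceAs (Module ℂ (_ ⧸ vermaIdeal cL cI cLI h hI))
instance : IsScalarTower ℂ (UniversalEnvelopingAlgebra ℂ HVir) (Verma cL cI cLI h hI) :=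
  inferInstanceAs (IsScalarTower ℂ _ (_ ⧸ vermaIdeal cL cI cLI h hI))

instance : Bracket HVir (Verma cL cI cLI h hI) :=
  ⟨fun x m => UniversalEnvelopingAlgebra.ι ℂ x • m⟩

theorem bracket_def (x : HVir) (m : Verma cL cI cLI h hI) :
    ⁅x, m⁆ = UniversalEnvelopingAlgebra.ι ℂ x • m := rfl

instance : LieRingModule HVir (Verma cL cI cLI h hI) where
  add_lie x y m := by simp only [bracket_def, map_add, add_smul]
  lie_add x m m' := by simp only [bracket_def, smul_add]
  leibniz_lie x y m := by
    simp only [bracket_def, LieHom.map_lie, LieRing.of_associative_ring_bracket, sub_smul, mul_smul]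
    abel

instance : LieModule ℂ HVir (Verma cL cI cLI h hI) where
  smul_lie t x m := by simp only [bracket_def, map_smul, smul_assoc]
  lie_smul t x m := by
    simp only [bracket_def]
    rw [← algebraMap_smul (UniversalEnvelopingAlgebra ℂ HVir) t m,
      ← algebraMap_smul (UniversalEnvelopingAlgebra ℂ HVir) t, smul_smul, smul_smul,
      Algebra.commutes]

/-- The sum of all proper submodules, which is the largest proper submodule. -/
def maxSubmodule : LieSubmodule ℂ HVir (Verma cL cI cLI h hI) :=
  sSup {N | N ≠ ⊤}

end Verma

/-- The irreducible highest weight module of highest weight `(c_L, c_I, c_{LI}, h, h_I)`. -/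
abbrev IrreducibleHW (cL cI cLI h hI : ℂ) : Type :=
  Verma cL cI cLI h hI ⧸ Verma.maxSubmodule cL cI cLI h hI

end

/-! Write c for c_{L,I}, so that h_I = c(p+1), and x for a highest weight vector. Define S_n by Σ
S_n z^n = exp(-Σ I(-k) z^k/(ck)) applied to x. As C_I = 0, the modes I(-k) commute, and L(k) S_n =
(n-p) S_{n-k} for k ≥ 1 (`L_schurVec`). So S_p is singular, and it vanishes in the irreducible
module. When an I(-k) is moved to the other tensor factor it becomes -F times a shift, and the
exponential becomes (1-z)^(-F/c). Its p-th coefficient g_p = ∏_{j<p} (F+jc)/(c(j+1)) vanishes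
exactly for the exceptional F (`schurCoeff_eq_zero_iff`); it decides the theorem.

If g_p ≠ 0, then F ≠ 0, and every nonzero subquotient of V_{α,β,F} is a copy of it. A nonzero
submodule W of the tensor product contains v_n ⊗ w for one w ≠ 0 and all large n; the w with this
property form a submodule, so x is among them. Modulo W one has v_{N+d} ⊗ S_d ≡ g_d v_N ⊗ x as soon
as v_n ⊗ x ∈ W for all n > N. At d = p the left side is 0, so v_N ⊗ x ∈ W, and descending N gives
everything (`tmul_mem_of_forall_lt`, `isIrreducible_tensor`).

If g_p = 0, a linear functional on the tensor product is built that is killed by the negative modes,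
equals 1 on v_m ⊗ x and 0 on v_i ⊗ x for i > m. The vectors v_i ⊗ x with i > m then generate a
proper nonzero submodule (`not_isIrreducible_of_functional`). On the second factor the functional is
a map f to ℂ[X] on which I(-k) acts as -F X^k and L(-k) as X^k(X d/dX + A + kB). On the Verma module
f is obtained by evaluating polynomials in a tensor product of two Fock spaces
(`Verma.exists_functional`). It sends S_p to g_p X^p = 0, and descends because S_p generates the
maximal submodule.

That last fact (`maxSubmodule_le_hwSubmodule`) says that after setting S_p = 0 every singular vector
is a multiple of x. The positive I(k) act like derivatives in the L(-k), with pivots kc(p+k) ≠ 0, so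
a singular vector is a combination of words in the I(-k) applied to x. There the positive L(k) act
like derivatives in the I(-k), with pivots kc(p-k), and the one bad mode I(-p) is eliminated by S_p
= 0. -/

noncomputable section

/-- Polynomials in the creation modes of two bosonic fields; the field `false` is `I`, and the
field `true` is its conjugate `a`. -/
abbrev FockPoly : Type := MvPolynomial (Bool × {n : ℤ // 0 < n}) ℂ

/-! ### Modes of two conjugate bosons and the operators L(n) -/

namespace FockPoly

variable (z μ : Bool → ℂ)

/-- The variable of mode `-m`, the zero mode for `m = 0`, and zero for `m < 0`. -/
def var (b : Bool) (m : ℤ) : FockPoly :=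
  if h : 0 < m then MvPolynomial.X (b, ⟨m, h⟩) else if m = 0 then MvPolynomial.C (z b) else 0

theorem var_of_pos (b : Bool) {m : ℤ} (h : 0 < m) :
    var z b m = MvPolynomial.X (b, ⟨m, h⟩) := by
  simp [var, h]

theorem var_zero (b : Bool) : var z b 0 = MvPolynomial.C (z b) := by
  simp [var]

theorem var_of_neg (b : Bool) {m : ℤ} (h : m < 0) : var z b m = 0 := by
  simp [var, h.ne, h.not_gt]

/-- The mode `n` of the field `b`. -/
def mode (b : Bool) (n : ℤ) : Module.End ℂ FockPoly :=
  if h : 0 < n then (n : ℂ) • (MvPolynomial.pderiv (!b, ⟨n, h⟩) : Derivation ℂ FockPoly FockPoly)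
  else LinearMap.mulLeft ℂ (var z b (-n))

theorem mode_of_pos (b : Bool) {n : ℤ} (h : 0 < n) (w : FockPoly) :
    mode z b n w = (n : ℂ) • MvPolynomial.pderiv (!b, ⟨n, h⟩) w := by
  simp [mode, h]

theorem mode_of_nonpos (b : Bool) {n : ℤ} (h : n ≤ 0) (w : FockPoly) :
    mode z b n w = var z b (-n) * w := by
  simp [mode, h.not_gt]

theorem pderiv_var (b b' : Bool) {n : ℤ} (h : 0 < n) (k : ℤ) :
    MvPolynomial.pderiv (b', ⟨n, h⟩) (var z b k) = if b = b' ∧ k = n then 1 else 0 := by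
  rcases lt_trichotomy k 0 with hk | rfl | hk
  · rw [var_of_neg z b hk, map_zero, if_neg (by omega)]
  · rw [var_zero, MvPolynomial.pderiv_C, if_neg (by omega)]
  · rw [var_of_pos z b hk, MvPolynomial.pderiv_X, Pi.single_apply]
    simp

theorem pderiv_comm {σ : Type*} (i j : σ) (w : MvPolynomial σ ℂ) :
    MvPolynomial.pderiv i (MvPolynomial.pderiv j w) =
      MvPolynomial.pderiv j (MvPolynomial.pderiv i w) := by
  classical
  have h : ⁅MvPolynomial.pderiv (R := ℂ) i, MvPolynomial.pderiv (R := ℂ) j⁆ = 0 := by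
    refine MvPolynomial.derivation_ext fun k => ?_
    simp only [Derivation.commutator_apply, MvPolynomial.pderiv_X, Pi.single_apply]
    split_ifs <;> simp
  have h2 := congrArg (fun D => D w) h
  simpa [Derivation.commutator_apply, sub_eq_zero] using h2

theorem mode_mode (b b' : Bool) (n m : ℤ) (w : FockPoly) :
    mode z b n (mode z b' m w) =
      mode z b' m (mode z b n w) + if b' = !b ∧ n + m = 0 then (n : ℂ) • w else 0 := by
  rcases lt_or_ge 0 n with hn | hn <;> rcases lt_or_ge 0 m with hm | hm
  · rw [if_neg (by omega), mode_of_pos z b hn, mode_of_pos z b' hm, mode_of_pos z b hn,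
      mode_of_pos z b' hm]
    simp only [Derivation.map_smul, pderiv_comm (!b, _), add_zero]
    rw [smul_comm]
  · rw [mode_of_pos z b hn, mode_of_nonpos z b' hm, mode_of_nonpos z b' hm, mode_of_pos z b hn,
      Derivation.leibniz, pderiv_var]
    have : (b' = !b ∧ -m = n) ↔ (b' = !b ∧ n + m = 0) := by
      constructor <;> rintro ⟨h1, h2⟩ <;> exact ⟨h1, by omega⟩
    simp only [this]
    split_ifs
    · simp only [smul_eq_mul, smul_add, mul_one, mul_smul_comm]
    · simp only [smul_eq_mul, mul_zero, add_zero, mul_smul_comm]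
  · rw [mode_of_nonpos z b hn, mode_of_pos z b' hm, mode_of_pos z b' hm, mode_of_nonpos z b hn,
      Derivation.leibniz, pderiv_var]
    have : (b = !b' ∧ -n = m) ↔ (b' = !b ∧ n + m = 0) := by
      constructor <;> rintro ⟨h1, h2⟩ <;> refine ⟨by simp [h1], by omega⟩
    simp only [this]
    split_ifs with h
    · obtain rfl : m = -n := by omega
      simp only [smul_eq_mul, smul_add, mul_one, mul_smul_comm]
      push_cast
      module
    · simp only [smul_eq_mul, mul_zero, mul_smul_comm, add_zero]
  · rw [mode_of_nonpos z b hn, mode_of_nonpos z b' hm, mode_of_nonpos z b' hm,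
      mode_of_nonpos z b hn]
    have : (if b' = !b ∧ n + m = 0 then (n : ℂ) • w else 0) = 0 := by
      split_ifs with h
      · obtain rfl : n = 0 := by omega
        simp
      · rfl
    rw [this]
    ring

/-- The first order part of `L(n)`. -/
def der (n : ℤ) : Derivation ℂ FockPoly FockPoly :=
  MvPolynomial.mkDerivation ℂ fun v => ((v.2 : ℤ) : ℂ) • var z v.1 (v.2 - n)

theorem der_var (n : ℤ) (b : Bool) {k : ℤ} (hk : 0 ≤ k) :
    der z n (var z b k) = (k : ℂ) • var z b (k - n) := by
  rcases hk.eq_or_lt with rfl | hk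
  · rw [var_zero, MvPolynomial.derivation_C]
    simp
  · rw [var_of_pos z b hk, der, MvPolynomial.mkDerivation_X]

/-- The product of creation modes in `L(n)`. -/
def quad (n : ℤ) : FockPoly := ∑ k ∈ Finset.Icc 0 (-n), var z false k * var z true (-n - k)

/-- The product of annihilation modes in `L(n)`. -/
def annih (n : ℤ) : Module.End ℂ FockPoly :=
  ∑ i ∈ Finset.Ioo 0 n, mode z false i * mode z true (n - i)

theorem annih_mode (n m : ℤ) (b : Bool) (w : FockPoly) :
    annih z n (mode z b m w) = mode z b m (annih z n w) +
      if m < 0 ∧ 0 < n + m then (-(m : ℂ)) • mode z b (n + m) w else 0 := by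
  simp only [annih, LinearMap.sum_apply, Module.End.mul_apply, map_sum]
  -- Only the factor conjugate to field `b` fails to commute with `mode z b m`, so a correction
  -- occurs at the single index where the two modes cancel.
  have key : ∀ i : ℤ, mode z false i (mode z true (n - i) (mode z b m w)) =
      mode z b m (mode z false i (mode z true (n - i) w)) +
      ((if i = (if b then -m else n + m) then (-(m : ℂ)) • mode z b (n + m) w else 0)) := by
    intro i
    rw [mode_mode z true b, map_add, mode_mode z false b, add_assoc]
    congr 1
    cases b
    · simp only [Bool.not_false, Bool.false_eq_true, false_and, if_false, zero_add,
        Bool.not_true, true_and]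
      by_cases h : i = n + m
      · subst h
        rw [if_pos (by ring), if_pos rfl, map_smul]
        push_cast
        congr 1
        ring
      · rw [if_neg (by omega), if_neg h, map_zero]
    · simp only [Bool.not_true, Bool.not_false, Bool.true_eq_false, false_and, if_false, true_and,
        if_true, map_zero, add_zero]
      by_cases h : i = -m
      · subst h
        rw [if_pos (by ring), if_pos rfl]
        push_cast
        rw [sub_neg_eq_add]
      · rw [if_neg (by omega), if_neg h]
  rw [Finset.sum_congr rfl fun i _ => key i, Finset.sum_add_distrib, Finset.sum_ite_eq']
  congr 1
  refine if_congr ?_ rfl rfl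
  rw [Finset.mem_Ioo]
  cases b <;> simp only [Bool.false_eq_true, if_false, if_true] <;> omega

/-- A commutator of derivations is a derivation, so it is enough to compare on the variables. The
term missing for `n + m ≤ 0` is supplied by `pderiv_quad`. -/
theorem pderiv_der (n m : ℤ) (b : Bool) (hm : 0 < m) (w : FockPoly) :
    der z n (mode z b m w) = mode z b m (der z n w) -
      if 0 < n + m then (m : ℂ) • mode z b (n + m) w else 0 := by
  have h : ⁅der z n, (MvPolynomial.pderiv (!b, ⟨m, hm⟩) : Derivation ℂ FockPoly FockPoly)⁆ =
      if h : 0 < n + m then -((n + m : ℤ) : ℂ) •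
        (MvPolynomial.pderiv (!b, ⟨n + m, h⟩) : Derivation ℂ FockPoly FockPoly) else 0 := by
    refine MvPolynomial.derivation_ext fun v => ?_
    obtain ⟨b', k, hk⟩ := v
    rw [← var_of_pos z b' hk, Derivation.commutator_apply, der_var z n b' hk.le, pderiv_var,
      Derivation.map_smul, pderiv_var]
    have h0 : der z n (if b' = !b ∧ k = m then 1 else 0) = 0 := by split_ifs <;> simp
    rw [h0, zero_sub]
    by_cases h : 0 < n + m
    · rw [dif_pos h, Derivation.smul_apply, pderiv_var]
      have : (b' = !b ∧ k - n = m) ↔ (b' = !b ∧ k = n + m) := by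
        constructor <;> rintro ⟨h1, h2⟩ <;> exact ⟨h1, by omega⟩
      simp only [this]
      split_ifs with h2
      · rw [h2.2, neg_smul]
      · simp
    · rw [dif_neg h, if_neg (by omega)]
      simp
  have h2 := congrArg (fun D => D w) h
  simp only [Derivation.commutator_apply] at h2
  rw [mode_of_pos z b hm, mode_of_pos z b hm, Derivation.map_smul, sub_eq_iff_eq_add.mp h2]
  by_cases h : 0 < n + m
  · rw [dif_pos h, if_pos h, mode_of_pos z b h]
    simp only [Derivation.smul_apply]
    module
  · rw [dif_neg h, if_neg h]
    simp

theorem pderiv_quad (n m : ℤ) (b : Bool) (hm : 0 < m) :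
    MvPolynomial.pderiv (!b, ⟨m, hm⟩) (quad z n) = var z b (-n - m) := by
  simp only [quad, map_sum, Derivation.leibniz, pderiv_var, smul_eq_mul]
  have key : ∀ k ∈ Finset.Icc 0 (-n), (var z false k * (if true = !b ∧ -n - k = m then 1 else 0) +
      var z true (-n - k) * if false = !b ∧ k = m then 1 else 0) =
      if k = (if b then m else -n - m) then var z b (-n - m) else 0 := by
    intro k _
    cases b
    · simp only [Bool.not_false, true_and, Bool.false_eq_true, if_false, false_and, mul_zero,
        add_zero]
      by_cases h : k = -n - m
      · rw [if_pos (by omega), if_pos h, h, mul_one]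
      · rw [if_neg (by omega), if_neg h, mul_zero]
    · simp only [Bool.not_true, Bool.true_eq_false, false_and, if_false, mul_zero, zero_add,
        true_and, if_true]
      split_ifs with h
      · rw [h, mul_one]
      · rw [mul_zero]
  rw [Finset.sum_congr rfl key, Finset.sum_ite_eq']
  by_cases h : 0 ≤ -n - m
  · rw [if_pos]
    rw [Finset.mem_Icc]
    split_ifs <;> omega
  · rw [var_of_neg z b (by omega)]
    simp

/-- The Virasoro mode `L(n)`. -/
def vir (n : ℤ) : Module.End ℂ FockPoly :=
  (der z n : Derivation ℂ FockPoly FockPoly) + annih z n + LinearMap.mulLeft ℂ (quad z n) +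
    ((n : ℂ) + 1) • (μ true • mode z true n + μ false • mode z false n)

theorem vir_apply (n : ℤ) (w : FockPoly) : vir z μ n w = der z n w + annih z n w + quad z n * w +
    ((n : ℂ) + 1) • (μ true • mode z true n w + μ false • mode z false n w) := rfl

/-- The term in mode `n + m` has a single source in each case. For `m > 0` it is `der` when `n + m >
0` and `quad` otherwise; for `m ≤ 0` it is `annih` when `n + m > 0` and `der` otherwise. The scalar
anomaly comes from the background charge of the conjugate field. -/
theorem vir_mode (n m : ℤ) (b : Bool) (w : FockPoly) :
    vir z μ n (mode z b m w) = mode z b m (vir z μ n w) - (m : ℂ) • mode z b (n + m) w +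
      if n + m = 0 then (μ (!b) * ((n : ℂ) ^ 2 + n)) • w else 0 := by
  simp only [vir_apply, map_add, map_smul]
  have h1 : ((n : ℂ) + 1) • (μ true • mode z true n (mode z b m w) +
        μ false • mode z false n (mode z b m w)) =
      ((n : ℂ) + 1) • (μ true • mode z b m (mode z true n w) +
        μ false • mode z b m (mode z false n w)) +
      if n + m = 0 then (μ (!b) * ((n : ℂ) ^ 2 + n)) • w else 0 := by
    rw [mode_mode z true b, mode_mode z false b]
    by_cases h : n + m = 0
    · cases b <;> simp only [h, and_true, if_true, Bool.not_true, Bool.not_false,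
        Bool.false_eq_true, Bool.true_eq_false, if_false] <;> module
    · simp [h]
  have h2 : der z n (mode z b m w) + annih z n (mode z b m w) + quad z n * mode z b m w =
      mode z b m (der z n w) + mode z b m (annih z n w) + mode z b m (quad z n * w) -
        (m : ℂ) • mode z b (n + m) w := by
    rw [annih_mode]
    rcases lt_or_ge 0 m with hm | hm
    · rw [pderiv_der z n m b hm, if_neg (by omega : ¬ (m < 0 ∧ 0 < n + m)),
        mode_of_pos z b hm (quad z n * w), Derivation.leibniz, pderiv_quad, mode_of_pos z b hm w]
      split_ifs with h
      · rw [var_of_neg z b (by omega)]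
        simp only [smul_eq_mul, mul_zero, add_zero, mul_smul_comm]
        abel
      · rw [mode_of_nonpos z b (not_lt.mp h), show -(n + m) = -n - m by ring]
        simp only [smul_eq_mul, add_zero, sub_zero, mul_smul_comm, smul_add, mul_comm w]
        abel
    · rw [mode_of_nonpos z b hm w, Derivation.leibniz, der_var z n b (by omega),
        mode_of_nonpos z b hm, mode_of_nonpos z b hm, mode_of_nonpos z b hm]
      split_ifs with h
      · rw [var_of_neg z b (show -m - n < 0 by omega)]
        simp only [smul_eq_mul, MvPolynomial.smul_eq_C_mul, map_neg]
        ring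
      · have : (m : ℂ) • mode z b (n + m) w = (m : ℂ) • (var z b (-m - n) * w) := by
          rcases hm.eq_or_lt with rfl | hm
          · simp
          · rw [mode_of_nonpos z b (by omega), show -(n + m) = -m - n by ring]
        rw [this]
        simp only [smul_eq_mul, MvPolynomial.smul_eq_C_mul, Int.cast_neg, map_neg]
        ring
  rw [h1, ← add_assoc, h2]
  abel

end FockPoly
end

/-! ### The Virasoro relation on the Fock space -/

noncomputable section

namespace FockPoly

variable (z μ : Bool → ℂ)

/-- Schur's lemma for the Fock space: `T 1` is killed by all derivatives, hence constant, and the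
creation modes generate everything from `1`. It reduces the Virasoro relation to one constant term.
-/
theorem eq_constantCoeff_smul_of_commute (T : Module.End ℂ FockPoly)
    (hT : ∀ b n w, T (mode z b n w) = mode z b n (T w)) :
    ∀ w, T w = MvPolynomial.constantCoeff (T 1) • w := by
  have h1 : T 1 = MvPolynomial.C (MvPolynomial.constantCoeff (T 1)) := by
    ext s
    rw [MvPolynomial.coeff_C]
    split_ifs with hs
    · rw [← hs]; rfl
    · obtain ⟨⟨b, n, hn⟩, hv⟩ : ∃ v, s v ≠ 0 := by
        by_contra! h
        exact hs (Finsupp.ext fun v => (h v).symm)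
      have h := hT (!b) n 1
      rw [mode_of_pos z (!b) hn, mode_of_pos z (!b) hn, MvPolynomial.pderiv_one, smul_zero,
        map_zero, Bool.not_not, eq_comm, smul_eq_zero] at h
      have h := h.resolve_left (by exact_mod_cast hn.ne')
      have h2 := congrArg (MvPolynomial.coeff (s - Finsupp.single (b, ⟨n, hn⟩) 1)) h
      rw [MvPolynomial.coeff_pderiv, MvPolynomial.coeff_zero] at h2
      have h3 : s - Finsupp.single (b, ⟨n, hn⟩) 1 + Finsupp.single (b, ⟨n, hn⟩) 1 = s := by
        refine tsub_add_cancel_of_le ?_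
        rw [Finsupp.single_le_iff]
        omega
      rw [h3] at h2
      refine (mul_eq_zero.mp h2).resolve_right ?_
      exact Nat.cast_add_one_ne_zero _
  intro w
  induction w using MvPolynomial.induction_on with
  | C a =>
    rw [← mul_one (MvPolynomial.C a), ← MvPolynomial.smul_eq_C_mul, map_smul]
    nth_rewrite 1 [h1]
    rw [smul_comm, MvPolynomial.smul_eq_C_mul, MvPolynomial.smul_eq_C_mul,
      MvPolynomial.smul_eq_C_mul, mul_one]
  | add p q hp hq => rw [map_add, hp, hq, smul_add]
  | mul_X p v hp =>
    obtain ⟨b, n, hn⟩ := v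
    have h := hT b (-n) p
    rw [mode_of_nonpos z b (by omega), mode_of_nonpos z b (by omega), neg_neg,
      var_of_pos z b hn, hp] at h
    rw [mul_comm, h, mul_smul_comm]

/-- The lowest weight of the Fock space. -/
def lowestWeight : ℂ := z false * z true + μ true * z true + μ false * z false

theorem mode_one_of_pos (b : Bool) {n : ℤ} (hn : 0 < n) : mode z b n 1 = 0 := by
  rw [mode_of_pos z b hn, MvPolynomial.pderiv_one, smul_zero]

theorem mode_zero_apply (b : Bool) (w : FockPoly) : mode z b 0 w = z b • w := by
  rw [mode_of_nonpos z b le_rfl, neg_zero, var_zero, MvPolynomial.smul_eq_C_mul]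

theorem vir_one_of_pos {n : ℤ} (hn : 0 < n) : vir z μ n 1 = 0 := by
  rw [vir_apply, mode_one_of_pos z _ hn, mode_one_of_pos z _ hn, quad, Finset.Icc_eq_empty (by omega),
    annih, LinearMap.sum_apply, Finset.sum_eq_zero]
  · simp
  · intro i hi
    rw [Finset.mem_Ioo] at hi
    rw [Module.End.mul_apply, mode_one_of_pos z _ (by omega), map_zero]

theorem vir_zero_apply (w : FockPoly) : vir z μ 0 w = der z 0 w + lowestWeight z μ • w := by
  rw [vir_apply, mode_zero_apply, mode_zero_apply, quad, annih]
  simp only [neg_zero, Finset.Icc_self, Finset.sum_singleton, var_zero, sub_zero, Finset.Ioo_self,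
    Finset.sum_empty, LinearMap.zero_apply, ← map_mul, ← MvPolynomial.smul_eq_C_mul, Int.cast_zero,
    lowestWeight]
  module

theorem constantCoeff_der_zero (w : FockPoly) :
    MvPolynomial.constantCoeff (der z 0 w) = 0 := by
  induction w using MvPolynomial.induction_on with
  | C a => rw [MvPolynomial.derivation_C, map_zero]
  | add p q hp hq => rw [map_add, map_add, hp, hq, add_zero]
  | mul_X p v hp =>
    obtain ⟨b, n, hn⟩ := v
    rw [Derivation.leibniz, ← var_of_pos z b hn, der_var z 0 b hn.le, sub_zero, var_of_pos z b hn]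
    simp [hp]

theorem constantCoeff_vir_one {n : ℤ} (hn : n ≠ 0) :
    MvPolynomial.constantCoeff (vir z μ n 1) = 0 := by
  have hv : ∀ b (k : ℤ), k ≠ 0 → MvPolynomial.constantCoeff (var z b k) = 0 := by
    intro b k hk
    rcases hk.lt_or_gt with hk | hk
    · rw [var_of_neg z b hk, map_zero]
    · rw [var_of_pos z b hk, MvPolynomial.constantCoeff_X]
  rcases hn.lt_or_gt with hn | hn
  · rw [vir_apply, mode_of_nonpos z _ hn.le, mode_of_nonpos z _ hn.le]
    have h1 : annih z n = 0 := by rw [annih, Finset.Ioo_eq_empty (by omega), Finset.sum_empty]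
    rw [h1, Derivation.map_one_eq_zero]
    have h2 : MvPolynomial.constantCoeff (quad z n) = 0 := by
      rw [quad, map_sum]
      refine Finset.sum_eq_zero fun k _ => ?_
      rw [map_mul]
      by_cases hk : k = 0
      · rw [hv true _ (by omega), mul_zero]
      · rw [hv false _ hk, zero_mul]
    simp [h2, hv _ _ (show -n ≠ 0 by omega), MvPolynomial.smul_eq_C_mul]
  · rw [vir_one_of_pos z μ hn, map_zero]

/-- The difference of the two sides of the Virasoro relation. -/
def virDefect (n m : ℤ) : Module.End ℂ FockPoly :=
  vir z μ n * vir z μ m - vir z μ m * vir z μ n - ((n : ℂ) - m) • vir z μ (n + m) -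
    (if n = -m then ((n : ℂ) ^ 3 - n) / 12 * (2 - 24 * μ true * μ false) else 0) • 1

theorem virDefect_apply (n m : ℤ) (w : FockPoly) : virDefect z μ n m w =
    vir z μ n (vir z μ m w) - vir z μ m (vir z μ n w) - ((n : ℂ) - m) • vir z μ (n + m) w -
    (if n = -m then ((n : ℂ) ^ 3 - n) / 12 * (2 - 24 * μ true * μ false) else 0) • w := rfl

theorem virDefect_mode (n m : ℤ) (b : Bool) (k : ℤ) (w : FockPoly) :
    virDefect z μ n m (mode z b k w) = mode z b k (virDefect z μ n m w) := by
  set κ : ℤ → ℂ := fun n => if n + k = 0 then μ (!b) * ((n : ℂ) ^ 2 + n) else 0 with hκ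
  have h : ∀ n w, vir z μ n (mode z b k w) = mode z b k (vir z μ n w) -
      (k : ℂ) • mode z b (n + k) w + κ n • w := by
    intro n w
    rw [vir_mode]
    simp only [hκ, ite_smul, zero_smul]
  simp only [virDefect_apply, h, map_add, map_sub, map_smul, vir_mode]
  rw [show n + (m + k) = n + m + k by ring, show m + (n + k) = n + m + k by ring]
  simp only [hκ]
  by_cases h0 : n + m + k = 0
  · obtain rfl : k = -n - m := by omega
    rw [if_pos h0, if_pos h0, if_pos h0]
    push_cast
    module
  · rw [if_neg h0, if_neg h0, if_neg h0]
    push_cast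
    module

theorem virDefect_eq (n m : ℤ) (w : FockPoly) : virDefect z μ n m w =
    MvPolynomial.constantCoeff (virDefect z μ n m 1) • w :=
  eq_constantCoeff_smul_of_commute z _ (fun b k w => virDefect_mode z μ n m b k w) w

theorem vir_zero_one : vir z μ 0 1 = lowestWeight z μ • 1 := by
  rw [vir_zero_apply, Derivation.map_one_eq_zero, zero_add]

theorem vir_zero_vir (n : ℤ) (w : FockPoly) :
    vir z μ 0 (vir z μ n w) = vir z μ n (vir z μ 0 w) - (n : ℂ) • vir z μ n w := by
  have h := virDefect_eq z μ 0 n w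
  have h1 : MvPolynomial.constantCoeff (virDefect z μ 0 n 1) = 0 := by
    rw [virDefect_apply, vir_zero_one, map_smul, vir_zero_apply]
    by_cases hn : n = 0
    · subst hn
      simp [vir_zero_one]
    · simp [constantCoeff_vir_one z μ hn, constantCoeff_der_zero, MvPolynomial.smul_eq_C_mul]
  rw [h1, zero_smul, virDefect_apply, zero_add] at h
  have h2 : (if (0 : ℤ) = -n then (((0 : ℤ) : ℂ) ^ 3 - (0 : ℤ)) / 12 *
    (2 - 24 * μ true * μ false) else 0) = 0 := by simp
  rw [h2] at h
  rw [← sub_eq_zero, ← h]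
  push_cast
  module

theorem sum_Icc_mul_sub (n : ℕ) :
    ∑ k ∈ Finset.Icc (0 : ℤ) n, (k : ℂ) * ((n : ℂ) - k) = ((n : ℂ) ^ 3 - n) / 6 := by
  have h : ∑ k ∈ Finset.Icc (0 : ℤ) n, (k : ℂ) * ((n : ℂ) - k) =
      ∑ k ∈ Finset.range (n + 1), (k : ℂ) * ((n : ℂ) - k) := by
    refine (Finset.sum_nbij' (fun k : ℕ => (k : ℤ)) Int.toNat ?_ ?_ ?_ ?_ ?_).symm
    · intro k hk
      simp at hk ⊢
      omega
    · intro k hk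
      simp at hk ⊢
      omega
    · simp
    · intro k hk
      simp at hk ⊢
      omega
    · simp
  have h2 : ∀ (N : ℕ) (t : ℂ), ∑ k ∈ Finset.range (N + 1), (k : ℂ) * (t - k) =
      t * (N * (N + 1)) / 2 - N * (N + 1) * (2 * N + 1) / 6 := by
    intro N t
    induction N with
    | zero => simp
    | succ N ih => rw [Finset.sum_range_succ, ih]; push_cast; ring
  rw [h, h2]
  ring

/-- This vacuum computation fixes the central charge. The contractions inside `quad` give Σ k(n-k) =
(n³-n)/6, which is the 2 of two bosons; the background charges give the remaining -24 μμ'. -/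
theorem vir_vir_neg_one (n : ℕ) (hn : 0 < n) : vir z μ n (vir z μ (-n) 1) =
    (2 * n * lowestWeight z μ + ((n : ℂ) ^ 3 - n) / 12 * (2 - 24 * μ true * μ false)) • 1 := by
  have hn' : (0 : ℤ) < n := by exact_mod_cast hn
  have hlin : ∀ b, vir z μ n (mode z b (-n) 1) =
      ((n : ℂ) * z b + μ (!b) * ((n : ℂ) ^ 2 + n)) • (1 : FockPoly) := by
    intro b
    rw [vir_mode, vir_one_of_pos z μ hn', map_zero, add_neg_cancel, mode_zero_apply, if_pos rfl]
    push_cast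
    module
  have hq : vir z μ n (quad z (-n)) = (((n : ℂ) ^ 3 - n) / 6 + 2 * n * (z false * z true) +
      ((n : ℂ) ^ 2 + n) * (μ false * z false + μ true * z true)) • (1 : FockPoly) := by
    have hk : ∀ k ∈ Finset.Icc (0 : ℤ) n, vir z μ n (var z false k * var z true (n - k)) =
        ((k : ℂ) * ((n : ℂ) - k) +
          (if k = 0 then z false * (n * z true + μ false * ((n : ℂ) ^ 2 + n)) else 0) +
          (if k = n then n * z false * z true + μ true * ((n : ℂ) ^ 2 + n) * z true else 0)) •
            (1 : FockPoly) := by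
      intro k hk
      rw [Finset.mem_Icc] at hk
      have e : var z false k * var z true (n - k) = mode z false (-k) (mode z true (k - n) 1) := by
        rw [mode_of_nonpos z _ (by omega), mode_of_nonpos z _ (by omega), mul_one, neg_neg,
          neg_sub]
      rw [e, vir_mode, vir_mode, vir_one_of_pos z μ hn', map_zero,
        show (n : ℤ) + (k - n) = k by ring, mode_mode z false true,
        show (n : ℤ) + -k + (k - n) = 0 by ring]
      simp only [Bool.not_false, Bool.not_true, true_and, if_true]
      rcases hk.1.eq_or_lt with rfl | h0
      · have d1 : ¬ (n : ℤ) = 0 := by omega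
        have d2 : ¬ (0 : ℤ) = n := by omega
        simp only [neg_zero, add_zero, if_true, if_neg d1, if_neg d2, mode_one_of_pos z _ hn',
          mode_zero_apply, map_zero]
        push_cast
        module
      · have d1 : ¬ k = 0 := by omega
        simp only [if_neg d1, mode_one_of_pos z _ h0]
        rcases hk.2.eq_or_lt with rfl | h1
        · simp only [add_neg_cancel, if_true, sub_self, mode_zero_apply, smul_zero,
            add_zero, map_zero]
          push_cast
          module
        · have d2 : ¬ (n : ℤ) + -k = 0 := by omega
          have d3 : ¬ k = n := by omega
          simp only [if_neg d2, if_neg d3, mode_one_of_pos z false (show 0 < (n : ℤ) + -k by omega),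
            smul_zero, sub_zero, add_zero, map_zero]
          push_cast
          module
    rw [quad, map_sum, neg_neg]
    rw [Finset.sum_congr rfl hk, ← Finset.sum_smul, Finset.sum_add_distrib,
      Finset.sum_add_distrib, Finset.sum_ite_eq', Finset.sum_ite_eq', if_pos (by simp),
      if_pos (by simp), sum_Icc_mul_sub]
    congr 1
    ring
  have e : vir z μ (-n) 1 = quad z (-n) +
      (1 - (n : ℂ)) • (μ true • mode z true (-n) 1 + μ false • mode z false (-n) 1) := by
    rw [vir_apply, Derivation.map_one_eq_zero, annih, Finset.Ioo_eq_empty (by omega),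
      Finset.sum_empty, mul_one, LinearMap.zero_apply]
    push_cast
    module
  rw [e, map_add, hq, map_smul, map_add, map_smul, map_smul, hlin, hlin, lowestWeight]
  simp only [Bool.not_true, Bool.not_false]
  module

/-- The defect commutes with all modes, so it is a scalar. For `n + m ≠ 0` it also shifts the
L(0)-weight, which forces 0; for `n + m = 0` the scalar is read off on the vacuum. -/
theorem virDefect_eq_zero (n m : ℤ) : virDefect z μ n m = 0 := by
  have hanti : ∀ n m, virDefect z μ n m = -virDefect z μ m n := by
    intro n m
    rw [virDefect, virDefect, add_comm m n]
    by_cases h : n = -m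
    · subst h
      rw [if_pos rfl, if_pos (by ring)]
      push_cast
      module
    · rw [if_neg h, if_neg (by omega)]
      module
  have hpos : ∀ n : ℕ, 0 < n → virDefect z μ n (-n) = 0 := by
    intro n hn
    refine LinearMap.ext fun w => ?_
    rw [virDefect_eq, virDefect_apply, vir_vir_neg_one z μ n hn,
      vir_one_of_pos z μ (by exact_mod_cast hn), add_neg_cancel, vir_zero_one, if_pos (by ring)]
    have hε : ∀ (s : ℂ) (g : FockPoly), MvPolynomial.constantCoeff (s • g) =
        s * MvPolynomial.constantCoeff g := fun s g => by
      rw [MvPolynomial.smul_eq_C_mul, map_mul, MvPolynomial.constantCoeff_C]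
    simp only [map_zero, hε, map_sub, map_one, LinearMap.zero_apply]
    rw [smul_eq_zero]
    left
    push_cast
    ring
  by_cases h : n + m = 0
  · obtain rfl : m = -n := by omega
    rcases lt_trichotomy n 0 with hn | rfl | hn
    · have := hpos (-n).toNat (by omega)
      rw [Int.toNat_of_nonneg (by omega)] at this
      rw [hanti, ← neg_neg n, neg_neg (-n), this, neg_zero]
    · have := hanti 0 0
      rw [eq_neg_iff_add_eq_zero, ← two_smul ℂ] at this
      exact (smul_eq_zero.mp this).resolve_left two_ne_zero
    · have := hpos n.toNat (by omega)
      rwa [Int.toNat_of_nonneg (by omega)] at this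
  · refine LinearMap.ext fun w => ?_
    set s := MvPolynomial.constantCoeff (virDefect z μ n m 1) with hs
    have h1 : ∀ w, virDefect z μ n m w = s • w := virDefect_eq z μ n m
    have h2 : vir z μ 0 (virDefect z μ n m w) =
        virDefect z μ n m (vir z μ 0 w) - ((n : ℂ) + m) • virDefect z μ n m w := by
      simp only [virDefect_apply, map_sub, map_smul, vir_zero_vir]
      rw [if_neg (by omega)]
      push_cast
      module
    rw [h1, h1, map_smul, eq_comm, sub_eq_self] at h2
    have h3 : ((n : ℂ) + m) ≠ 0 := by exact_mod_cast h
    rw [h1]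
    exact (smul_eq_zero.mp h2).resolve_left h3

theorem vir_vir (n m : ℤ) (w : FockPoly) : vir z μ n (vir z μ m w) =
    vir z μ m (vir z μ n w) + ((n : ℂ) - m) • vir z μ (n + m) w +
    (if n = -m then ((n : ℂ) ^ 3 - n) / 12 * (2 - 24 * μ true * μ false) else 0) • w := by
  have h := congrArg (fun T => T w) (virDefect_eq_zero z μ n m)
  simp only [virDefect_apply, LinearMap.zero_apply] at h
  rw [← sub_eq_zero, ← h]
  abel

end FockPoly
end

/-! ### Fock spaces as modules over the twisted Heisenberg–Virasoro algebra -/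

noncomputable section

namespace HVir

theorem map_lie_of_basis {X : Type*} [AddCommGroup X] [Module ℂ X]
    (ρ : HVir →ₗ[ℂ] Module.End ℂ X)
    (hρ : ∀ i j, ρ (basisBracket i j) = ρ (e i) * ρ (e j) - ρ (e j) * ρ (e i)) (x y : HVir) :
    ρ ⁅x, y⁆ = ρ x * ρ y - ρ y * ρ x := by
  rw [bracket_def]
  induction x using induct with
  | h0 => simp
  | hadd x x' hx hx' => simp only [map_add, LinearMap.add_apply, hx, hx', add_mul, mul_add]; abel
  | hsmul c i =>
    simp only [map_smul, LinearMap.smul_apply, smul_mul_assoc, mul_smul_comm, ← smul_sub]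
    congr 1
    induction y using induct with
    | h0 => simp
    | hadd y y' hy hy' => simp only [map_add, hy, hy', add_mul, mul_add]; abel
    | hsmul d j =>
      simp only [map_smul, smul_mul_assoc, mul_smul_comm, ← smul_sub]
      rw [bracketHom_e, hρ]

/-- The linear map on the algebra with given values on the standard basis. -/
def linearOfBasis {X : Type*} [AddCommGroup X] [Module ℂ X] (g : HVirIdx → X) : HVir →ₗ[ℂ] X :=
  (Finsupp.linearCombination ℂ g : (HVirIdx →₀ ℂ) →ₗ[ℂ] X)

theorem linearOfBasis_e {X : Type*} [AddCommGroup X] [Module ℂ X] (g : HVirIdx → X)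
    (i : HVirIdx) : linearOfBasis g (e i) = g i := by
  unfold linearOfBasis e
  erw [Finsupp.linearCombination_single, one_smul]

end HVir

/-- The Fock space of a pair of conjugate bosonic fields, with zero modes `z`, background charges
`μ` and the field `I` rescaled by `t`. -/
def Fock (_t : ℂ) (_z _μ : Bool → ℂ) : Type := FockPoly

namespace Fock

variable (t : ℂ) (z μ : Bool → ℂ)

instance : AddCommGroup (Fock t z μ) := inferInstanceAs (AddCommGroup FockPoly)
instance : Module ℂ (Fock t z μ) := inferInstanceAs (Module ℂ FockPoly)

/-- The action of the standard basis. -/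
def basisAction : HVirIdx → Module.End ℂ FockPoly
  | .L n => FockPoly.vir z μ n
  | .I n => t • FockPoly.mode z false n
  | .CL => (2 - 24 * μ true * μ false) • 1
  | .CLI => (-(t * μ true)) • 1
  | .CI => 0

theorem basisAction_lie (i j : HVirIdx) :
    HVir.linearOfBasis (basisAction t z μ) (HVir.basisBracket i j) =
      basisAction t z μ i * basisAction t z μ j - basisAction t z μ j * basisAction t z μ i := by
  refine LinearMap.ext fun w => ?_
  cases i <;> cases j <;>
    simp only [basisAction, HVir.basisBracket, map_add, map_sub, map_smul, map_zero,
      HVir.linearOfBasis_e, LinearMap.add_apply, LinearMap.sub_apply, LinearMap.smul_apply,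
      LinearMap.zero_apply, Module.End.mul_apply, Module.End.one_apply, smul_zero, sub_self]
  case L.L n m =>
    rw [FockPoly.vir_vir]
    split_ifs <;> module
  case L.I n m =>
    rw [FockPoly.vir_mode]
    by_cases h : n = -m
    · rw [if_pos h, if_pos (by omega)]
      simp only [Bool.not_false]
      module
    · rw [if_neg h, if_neg (by omega)]
      module
  case I.L n m =>
    rw [FockPoly.vir_mode, add_comm m n]
    by_cases h : m = -n
    · rw [if_pos h, if_pos (by omega)]
      simp only [Bool.not_false]
      module
    · rw [if_neg h, if_neg (by omega)]
      module
  case I.I n m =>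
    rw [FockPoly.mode_mode]
    simp
  all_goals module

/-- The action of the algebra. -/
def action : HVir →ₗ[ℂ] Module.End ℂ FockPoly := HVir.linearOfBasis (basisAction t z μ)

theorem action_lie (x y : HVir) : action t z μ ⁅x, y⁆ =
    action t z μ x * action t z μ y - action t z μ y * action t z μ x :=
  HVir.map_lie_of_basis _ (fun i j => by
    rw [action, HVir.linearOfBasis_e, HVir.linearOfBasis_e, basisAction_lie]) x y

instance : Bracket HVir (Fock t z μ) := ⟨fun x w => action t z μ x w⟩

theorem bracket_def (x : HVir) (w : Fock t z μ) : ⁅x, w⁆ = action t z μ x w := rfl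

instance : LieRingModule HVir (Fock t z μ) where
  add_lie x y w := by
    simp only [bracket_def, map_add]
    rfl
  lie_add x w w' := map_add (action t z μ x) w w'
  leibniz_lie x y w := by
    simp only [bracket_def, action_lie]
    exact (sub_add_cancel _ _).symm

instance : LieModule ℂ HVir (Fock t z μ) where
  smul_lie s x w := by
    simp only [bracket_def, map_smul]
    rfl
  lie_smul s x w := map_smul (action t z μ x) s w

theorem lie_e (i : HVirIdx) (w : Fock t z μ) :
    ⁅HVir.e i, w⁆ = (basisAction t z μ i w : FockPoly) := by
  rw [bracket_def, action, HVir.linearOfBasis_e]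

/-- The lowest weight vector. -/
def one : Fock t z μ := (1 : FockPoly)

end Fock

/-! ### Evaluation of Fock space polynomials in ℂ[X] -/

namespace FockPoly

open Polynomial

variable (z μ s : Bool → ℂ)

/-- Evaluation of all variables at multiples of powers of an indeterminate. -/
def ev : FockPoly →ₐ[ℂ] ℂ[X] :=
  MvPolynomial.aeval fun v => C (-s v.1) * X ^ (v.2 : ℤ).toNat

theorem ev_var (b : Bool) {k : ℕ} (hk : 0 < k) : ev s (var z b k) = C (-s b) * X ^ k := by
  rw [var_of_pos z b (by exact_mod_cast hk), ev, MvPolynomial.aeval_X]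
  simp

theorem ev_var_zero (b : Bool) : ev s (var z b 0) = C (z b) := by
  rw [var_zero, ev, MvPolynomial.aeval_C]
  rfl

/-- The variable of mode m evaluates to a multiple of X^m, and `der z (-k)` replaces it by m times
the variable of mode m + k; this is the effect of X^k · X d/dX on X^m. -/
theorem ev_der (k : ℕ) (w : FockPoly) :
    ev s (der z (-k) w) = X ^ k * (X * derivative (ev s w)) := by
  induction w using MvPolynomial.induction_on with
  | C a =>
    rw [MvPolynomial.derivation_C, map_zero, ev, MvPolynomial.aeval_C]
    simp
  | add p q hp hq => simp only [map_add, hp, hq, mul_add]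
  | mul_X p v hp =>
    obtain ⟨b, n, hn⟩ := v
    obtain ⟨m, rfl⟩ : ∃ m : ℕ, n = (m + 1 : ℕ) := ⟨(n - 1).toNat, by omega⟩
    rw [← var_of_pos z b hn, Derivation.leibniz, der_var z _ b hn.le, map_add, smul_eq_mul,
      smul_eq_mul, map_mul, map_mul, map_mul, hp, map_smul, sub_neg_eq_add, ← Nat.cast_add,
      ev_var z s b (by omega), ev_var z s b (by omega)]
    simp only [derivative_mul, derivative_C, derivative_X_pow, smul_eq_C_mul]
    push_cast
    simp only [map_add, map_natCast, map_one]
    ring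

theorem ev_quad {k : ℕ} (hk : 0 < k) : ev s (quad z (-k)) =
    C (((k : ℂ) - 1) * (s false * s true) - z false * s true - z true * s false) * X ^ k := by
  have h : quad z (-k) = ∑ i ∈ Finset.range (k + 1), var z false i * var z true ((k - i : ℕ)) := by
    rw [quad]
    refine (Finset.sum_nbij' (fun k : ℕ => (k : ℤ)) Int.toNat ?_ ?_ ?_ ?_ ?_).symm
    · intro i hi
      simp at hi ⊢
      omega
    · intro i hi
      simp at hi ⊢
      omega
    · simp
    · intro i hi
      simp at hi ⊢
      omega
    · intro i hi
      simp at hi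
      rw [Nat.cast_sub (by omega), neg_neg]
  obtain ⟨k, rfl⟩ : ∃ m, k = m + 1 := ⟨k - 1, by omega⟩
  have h1 : ∀ i ∈ Finset.range k, ev s (var z false (i + 1 : ℕ) * var z true ((k + 1 - (i + 1) : ℕ))) =
      C (s false * s true) * X ^ (k + 1) := by
    intro i hi
    rw [Finset.mem_range] at hi
    rw [map_mul, ev_var z s _ (by omega), ev_var z s _ (by omega),
      show X ^ (k + 1) = X ^ (i + 1) * (X : ℂ[X]) ^ (k + 1 - (i + 1)) by
        rw [← pow_add]; congr 1; omega]
    simp only [map_mul, map_neg]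
    ring
  rw [h, map_sum, Finset.sum_range_succ, Finset.sum_range_succ', Finset.sum_congr rfl h1,
    Finset.sum_const, Finset.card_range, Nat.sub_self, Nat.sub_zero, Nat.cast_zero, map_mul (ev s),
    map_mul (ev s), ev_var_zero, ev_var_zero, ev_var z s _ (by omega), ev_var z s _ (by omega),
    nsmul_eq_mul]
  push_cast
  simp only [map_mul, map_neg, map_sub, map_add, map_natCast, map_one]
  ring

/-- A negative mode has no second order part, so it passes through the algebra map `ev` and becomes
a first order operator in X. -/
theorem ev_vir {k : ℕ} (hk : 0 < k) (w : FockPoly) : ev s (vir z μ (-k) w) =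
    X ^ k * (X * derivative (ev s w) +
      C (((k : ℂ) - 1) * (s false * s true + μ true * s true + μ false * s false) -
        (z false * s true + z true * s false)) * ev s w) := by
  rw [vir_apply, annih, Finset.Ioo_eq_empty (by omega), Finset.sum_empty, LinearMap.zero_apply,
    mode_of_nonpos z _ (by omega), mode_of_nonpos z _ (by omega), neg_neg]
  simp only [map_add, map_mul, map_smul, ev_der, map_zero, ev_quad z s hk, ev_var z s _ hk]
  simp only [smul_eq_C_mul]
  push_cast
  simp only [map_mul, map_neg, map_sub, map_add, map_natCast, map_one]
  ring

theorem ev_mode (b : Bool) {k : ℕ} (hk : 0 < k) (w : FockPoly) :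
    ev s (mode z b (-k) w) = C (-s b) * X ^ k * ev s w := by
  rw [mode_of_nonpos z _ (by omega), neg_neg, map_mul, ev_var z s _ hk]

end FockPoly

/-! ### Highest weight vectors and the universal property of Verma modules -/

namespace Verma

variable (cL cI c h hI : ℂ)

/-- The highest weight vector. -/
def hwv : Verma cL cI c h hI :=
  (Submodule.Quotient.mk 1 : UniversalEnvelopingAlgebra ℂ HVir ⧸ vermaIdeal cL cI c h hI)

end Verma

/-- A vector killed by the positive modes on which the centre and the zero modes act by the given
scalars. -/
structure IsHighestWeight {X : Type*} [AddCommGroup X] [Module ℂ X] [LieRingModule HVir X]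
    (cL cI c h hI : ℂ) (x : X) : Prop where
  L_pos : ∀ n : ℤ, 0 < n → ⁅HVir.e (.L n), x⁆ = 0
  I_pos : ∀ n : ℤ, 0 < n → ⁅HVir.e (.I n), x⁆ = 0
  CL : ⁅HVir.e .CL, x⁆ = cL • x
  CI : ⁅HVir.e .CI, x⁆ = cI • x
  CLI : ⁅HVir.e .CLI, x⁆ = c • x
  L_zero : ⁅HVir.e (.L 0), x⁆ = h • x
  I_zero : ⁅HVir.e (.I 0), x⁆ = hI • x

namespace Verma

variable {cL cI c h hI : ℂ}

theorem smul_hwv (u : UniversalEnvelopingAlgebra ℂ HVir) : u • hwv cL cI c h hI =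
    (Submodule.Quotient.mk u : UniversalEnvelopingAlgebra ℂ HVir ⧸ vermaIdeal cL cI c h hI) := by
  have : u • (Submodule.Quotient.mk 1 :
      UniversalEnvelopingAlgebra ℂ HVir ⧸ vermaIdeal cL cI c h hI) = Submodule.Quotient.mk u := by
    rw [← Submodule.Quotient.mk_smul, smul_eq_mul, mul_one]
  exact this

theorem smul_hwv_eq_zero {u : UniversalEnvelopingAlgebra ℂ HVir}
    (hu : u ∈ vermaIdeal cL cI c h hI) : u • hwv cL cI c h hI = 0 := by
  rw [smul_hwv]
  exact (Submodule.Quotient.mk_eq_zero _).mpr hu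

theorem isHighestWeight_hwv : IsHighestWeight cL cI c h hI (hwv cL cI c h hI) := by
  have key : ∀ (x : HVir) (a : ℂ), UniversalEnvelopingAlgebra.ι ℂ x - algebraMap ℂ _ a ∈
      vermaIdeal cL cI c h hI → ⁅x, hwv cL cI c h hI⁆ = a • hwv cL cI c h hI := by
    intro x a hx
    have := smul_hwv_eq_zero hx
    rwa [sub_smul, sub_eq_zero, algebraMap_smul] at this
  refine ⟨fun n hn => ?_, fun n hn => ?_, ?_, ?_, ?_, ?_, ?_⟩
  · exact smul_hwv_eq_zero (Ideal.subset_span (Or.inl (Or.inl ⟨n, hn, rfl⟩)))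
  · exact smul_hwv_eq_zero (Ideal.subset_span (Or.inl (Or.inr ⟨n, hn, rfl⟩)))
  all_goals exact key _ _ (Ideal.subset_span (Or.inr (by simp)))

theorem exists_lift {X : Type*} [AddCommGroup X] [Module ℂ X] [LieRingModule HVir X]
    [LieModule ℂ HVir X] {x : X} (hx : IsHighestWeight cL cI c h hI x) :
    ∃ g : Verma cL cI c h hI →ₗ[ℂ] X, g (hwv cL cI c h hI) = x ∧
      ∀ (y : HVir) (m : Verma cL cI c h hI), g ⁅y, m⁆ = ⁅y, g m⁆ := by
  let ρ := UniversalEnvelopingAlgebra.lift ℂ (LieModule.toEnd ℂ HVir X)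
  have hρ : ∀ y w, ρ (UniversalEnvelopingAlgebra.ι ℂ y) w = ⁅y, w⁆ := by
    intro y w
    simp only [ρ, UniversalEnvelopingAlgebra.lift_ι_apply, LieModule.toEnd_apply_apply]
  let g0 : UniversalEnvelopingAlgebra ℂ HVir →ₗ[ℂ] X :=
    (LinearMap.applyₗ x).comp ρ.toLinearMap
  have hg0 : ∀ u, g0 u = ρ u x := fun u => rfl
  have hker : ∀ u ∈ vermaIdeal cL cI c h hI, g0 u = 0 := by
    intro u hu
    refine Submodule.span_induction (p := fun u _ => g0 u = 0) ?_ (map_zero _) ?_ ?_ hu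
    · rintro u ((⟨n, hn, rfl⟩ | ⟨n, hn, rfl⟩) | hu)
      · rw [hg0, hρ, hx.L_pos n hn]
      · rw [hg0, hρ, hx.I_pos n hn]
      · simp only [Set.mem_insert_iff, Set.mem_singleton_iff] at hu
        rcases hu with rfl | rfl | rfl | rfl | rfl <;>
          rw [map_sub, hg0, hg0, hρ, AlgHom.commutes, Module.algebraMap_end_apply, sub_eq_zero]
        exacts [hx.CL, hx.CI, hx.CLI, hx.L_zero, hx.I_zero]
    · intro a b _ _ ha hb
      rw [map_add, ha, hb, add_zero]
    · intro a b _ hb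
      rw [hg0] at hb ⊢
      rw [smul_eq_mul, map_mul, Module.End.mul_apply, hb, map_zero]
  let g : Verma cL cI c h hI →ₗ[ℂ] X :=
    ((vermaIdeal cL cI c h hI).restrictScalars ℂ).liftQ g0 hker
  have hg : ∀ u, g (u • hwv cL cI c h hI) = ρ u x := by
    intro u
    rw [smul_hwv]
    rfl
  refine ⟨g, ?_, fun y m => ?_⟩
  · have := hg 1
    rwa [one_smul, map_one] at this
  · obtain ⟨u, rfl⟩ : ∃ u, u • hwv cL cI c h hI = m := by
      obtain ⟨u, hu⟩ := Submodule.Quotient.mk_surjective _ m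
      exact ⟨u, by rw [smul_hwv]; exact hu⟩
    rw [bracket_def, smul_smul, hg, hg, map_mul, Module.End.mul_apply, hρ]

end Verma
end

/-! ### Polynomial-valued functionals on the Verma module -/

noncomputable section

namespace Fock

open Polynomial

variable (t : ℂ) (z μ s : Bool → ℂ)

theorem isHighestWeight_one : IsHighestWeight (2 - 24 * μ true * μ false) 0 (-(t * μ true))
    (FockPoly.lowestWeight z μ) (t * z false) (one t z μ) := by
  refine ⟨fun n hn => ?_, fun n hn => ?_, ?_, ?_, ?_, ?_, ?_⟩ <;> rw [lie_e]
  · exact FockPoly.vir_one_of_pos z μ hn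
  · change t • FockPoly.mode z false n 1 = 0
    rw [FockPoly.mode_one_of_pos z _ hn, smul_zero]
  · rfl
  · exact (zero_smul ℂ (1 : FockPoly)).symm
  · rfl
  · exact FockPoly.vir_zero_one z μ
  · change t • FockPoly.mode z false 0 1 = _
    rw [FockPoly.mode_zero_apply, smul_smul]
    rfl

/-- Evaluation as a linear map on the Fock space. -/
def evLin : Fock t z μ →ₗ[ℂ] ℂ[X] := (FockPoly.ev s).toLinearMap

theorem evLin_one : evLin t z μ s (one t z μ) = 1 := map_one (FockPoly.ev s)

theorem evLin_I {k : ℕ} (hk : 0 < k) (w : Fock t z μ) :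
    evLin t z μ s ⁅HVir.e (.I (-k)), w⁆ = C (-(t * s false)) * X ^ k * evLin t z μ s w := by
  rw [lie_e]
  refine (map_smul (FockPoly.ev s) t _).trans ?_
  have := FockPoly.ev_mode z s false hk w
  rw [smul_eq_C_mul]
  refine (congrArg (C t * ·) this).trans ?_
  simp only [map_mul, map_neg]
  change C t * (-C (s false) * X ^ k * evLin t z μ s w) = _
  ring

theorem evLin_L {k : ℕ} (hk : 0 < k) (w : Fock t z μ) :
    evLin t z μ s ⁅HVir.e (.L (-k)), w⁆ = X ^ k * (X * derivative (evLin t z μ s w) +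
      C (((k : ℂ) - 1) * (s false * s true + μ true * s true + μ false * s false) -
        (z false * s true + z true * s false)) * evLin t z μ s w) := by
  rw [lie_e]
  exact FockPoly.ev_vir z μ s hk w

end Fock

theorem IsHighestWeight.tmul {X Y : Type*} [AddCommGroup X] [Module ℂ X] [LieRingModule HVir X]
    [LieModule ℂ HVir X] [AddCommGroup Y] [Module ℂ Y] [LieRingModule HVir Y]
    [LieModule ℂ HVir Y] {cL cI c h hI cL' cI' c' h' hI' : ℂ} {x : X} {y : Y}
    (hx : IsHighestWeight cL cI c h hI x) (hy : IsHighestWeight cL' cI' c' h' hI' y) :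
    IsHighestWeight (cL + cL') (cI + cI') (c + c') (h + h') (hI + hI') (x ⊗ₜ[ℂ] y) := by
  refine ⟨fun n hn => ?_, fun n hn => ?_, ?_, ?_, ?_, ?_, ?_⟩ <;>
    rw [TensorProduct.LieModule.lie_tmul_right]
  · rw [hx.L_pos n hn, hy.L_pos n hn, TensorProduct.zero_tmul, TensorProduct.tmul_zero, add_zero]
  · rw [hx.I_pos n hn, hy.I_pos n hn, TensorProduct.zero_tmul, TensorProduct.tmul_zero, add_zero]
  · rw [hx.CL, hy.CL, ← TensorProduct.smul_tmul', TensorProduct.tmul_smul, ← add_smul]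
  · rw [hx.CI, hy.CI, ← TensorProduct.smul_tmul', TensorProduct.tmul_smul, ← add_smul]
  · rw [hx.CLI, hy.CLI, ← TensorProduct.smul_tmul', TensorProduct.tmul_smul, ← add_smul]
  · rw [hx.L_zero, hy.L_zero, ← TensorProduct.smul_tmul', TensorProduct.tmul_smul, ← add_smul]
  · rw [hx.I_zero, hy.I_zero, ← TensorProduct.smul_tmul', TensorProduct.tmul_smul, ← add_smul]

namespace Verma

open Polynomial

/-- The coinvariant functionals on the Verma module: the negative modes act on values as
differential operators in the indeterminate. -/
theorem exists_functional (cL : ℂ) {c : ℂ} (h : ℂ) {hI : ℂ} (hc : c ≠ 0) (hne : hI ≠ c)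
    (F A B : ℂ) : ∃ f : Verma cL 0 c h hI →ₗ[ℂ] ℂ[X], f (hwv cL 0 c h hI) = 1 ∧
      (∀ k : ℕ, 0 < k → ∀ w : Verma cL 0 c h hI,
        f ⁅HVir.e (.I (-k)), w⁆ = C (-F) * X ^ k * f w) ∧
      (∀ k : ℕ, 0 < k → ∀ w : Verma cL 0 c h hI, f ⁅HVir.e (.L (-k)), w⁆ =
        X ^ k * (X * derivative (f w) + C (A + k * B) * f w)) := by
  -- The central charges 2 + 24cν and 2 of the two Fock factors must add up to `cL`, which fixes ν.
  -- Their lowest weights are a(hI - c) + ν hI and 0, which fixes a and needs `hI ≠ c`. The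
  -- remaining zero modes and evaluation points make the constants of `Fock.evLin_L` for the two
  -- factors add up to A + kB. In the second factor t = 0, so I acts by zero there and only the
  -- Virasoro action is adjusted.
  set ν : ℂ := (cL - 4) / (24 * c) with hν
  set a : ℂ := (h - ν * hI) / (hI - c) with ha
  set z₁ : Bool → ℂ := fun b => if b then a else hI with hz₁
  set μ₁ : Bool → ℂ := fun b => if b then -c else ν with hμ₁
  set s₁ : Bool → ℂ := fun b => if b then 0 else F with hs₁
  set z₂ : Bool → ℂ := fun b => if b then 0 else -(A + a * F + B) with hz₂
  set s₂ : Bool → ℂ := fun b => if b then 1 else B - ν * F with hs₂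
  have hhw := (Fock.isHighestWeight_one 1 z₁ μ₁).tmul (Fock.isHighestWeight_one 0 z₂ 0)
  have hne' : hI - c ≠ 0 := sub_ne_zero.mpr hne
  have e1 : 2 - 24 * μ₁ true * μ₁ false + (2 - 24 * (0 : Bool → ℂ) true * (0 : Bool → ℂ) false) =
      cL := by
    simp only [hμ₁, hν, Pi.zero_apply, if_true, Bool.false_eq_true, if_false]
    field_simp
    ring
  have e2 : -(1 * μ₁ true) + -(0 * (0 : Bool → ℂ) true) = c := by simp [hμ₁]
  have e3 : FockPoly.lowestWeight z₁ μ₁ + FockPoly.lowestWeight z₂ 0 = h := by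
    simp only [FockPoly.lowestWeight, hμ₁, hz₁, hz₂, ha, Pi.zero_apply, if_true,
      Bool.false_eq_true, if_false]
    field_simp
    ring
  have e4 : 1 * z₁ false + 0 * z₂ false = hI := by simp [hz₁]
  rw [e1, e2, e3, e4, add_zero] at hhw
  obtain ⟨g, hg1, hg⟩ := exists_lift hhw
  obtain ⟨φ, hφ⟩ : ∃ φ : Fock 1 z₁ μ₁ ⊗[ℂ] Fock 0 z₂ 0 →ₗ[ℂ] ℂ[X],
      ∀ x y, φ (x ⊗ₜ y) = Fock.evLin 1 z₁ μ₁ s₁ x * Fock.evLin 0 z₂ 0 s₂ y :=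
    ⟨LinearMap.mul' ℂ ℂ[X] ∘ₗ
      TensorProduct.map (Fock.evLin 1 z₁ μ₁ s₁) (Fock.evLin 0 z₂ 0 s₂), fun x y => rfl⟩
  refine ⟨φ ∘ₗ g, ?_, fun k hk w => ?_, fun k hk w => ?_⟩
  · rw [LinearMap.comp_apply, hg1, hφ, Fock.evLin_one, Fock.evLin_one, one_mul]
  · rw [LinearMap.comp_apply, LinearMap.comp_apply, hg]
    generalize g w = w'
    induction w' using TensorProduct.induction_on with
    | zero => rw [lie_zero, map_zero]; simp
    | add x y hx hy => rw [lie_add, map_add, hx, hy, map_add, mul_add]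
    | tmul x y =>
      rw [TensorProduct.LieModule.lie_tmul_right, map_add, hφ, hφ, hφ, Fock.evLin_I _ _ _ _ hk,
        Fock.evLin_I _ _ _ _ hk]
      simp only [hs₁, Bool.false_eq_true, if_false, map_neg, map_mul, map_zero, map_one]
      ring
  · rw [LinearMap.comp_apply, LinearMap.comp_apply, hg]
    generalize g w = w'
    induction w' using TensorProduct.induction_on with
    | zero => rw [lie_zero, map_zero]; simp
    | add x y hx hy =>
      rw [lie_add, map_add φ, hx, hy, map_add φ, derivative_add]
      ring
    | tmul x y =>
      rw [TensorProduct.LieModule.lie_tmul_right, map_add, hφ, hφ, hφ, Fock.evLin_L _ _ _ _ hk,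
        Fock.evLin_L _ _ _ _ hk, derivative_mul]
      simp only [hs₁, hs₂, hz₁, hz₂, hμ₁, Pi.zero_apply, if_true, Bool.false_eq_true, if_false,
        map_neg, map_mul, map_zero, map_one, map_add, map_sub, map_natCast]
      ring

end Verma
end

/-! ### Submodules generated by negative modes -/

noncomputable section

set_option linter.unusedSectionVars false

namespace HVir

section Relations

variable {X : Type*} [AddCommGroup X] [Module ℂ X] [LieRingModule HVir X] [LieModule ℂ HVir X]

theorem lie_lie_e (i j : HVirIdx) (w : X) :
    ⁅e i, ⁅e j, w⁆⁆ = ⁅e j, ⁅e i, w⁆⁆ + ⁅basisBracket i j, w⁆ := by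
  rw [leibniz_lie, bracket_def, bracketHom_e, add_comm]

/-- The centre is generated by the modes: [L(2),L(-2)], [L(1),I(-1)] and [I(1),I(-1)] recover C_L,
C_LI and C_I. -/
theorem lie_mem_of_basis (S : Submodule ℂ X) (hL : ∀ (n : ℤ), ∀ w ∈ S, ⁅e (.L n), w⁆ ∈ S)
    (hI : ∀ (n : ℤ), ∀ w ∈ S, ⁅e (.I n), w⁆ ∈ S) (x : HVir) {w : X} (hw : w ∈ S) : ⁅x, w⁆ ∈ S := by
  induction x using induct with
  | h0 => rw [zero_lie]; exact S.zero_mem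
  | hadd x y hx hy => rw [add_lie]; exact S.add_mem hx hy
  | hsmul a i =>
    rw [smul_lie]
    refine S.smul_mem a ?_
    cases i with
    | L n => exact hL n w hw
    | I n => exact hI n w hw
    | CL =>
      have h := lie_lie_e (.L 2) (.L (-2)) w
      simp only [basisBracket, neg_neg, if_true, add_lie, smul_lie, add_neg_cancel] at h
      have h2 : ⁅e .CL, w⁆ = (2 : ℂ) • (⁅e (.L 2), ⁅e (.L (-2)), w⁆⁆ -
          ⁅e (.L (-2)), ⁅e (.L 2), w⁆⁆ - (4 : ℂ) • ⁅e (.L 0), w⁆) := by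
        rw [h]
        push_cast
        module
      rw [h2]
      exact S.smul_mem _ (S.sub_mem (S.sub_mem (hL _ _ (hL _ _ hw)) (hL _ _ (hL _ _ hw)))
        (S.smul_mem _ (hL _ _ hw)))
    | CLI =>
      have h := lie_lie_e (.L 1) (.I (-1)) w
      simp only [basisBracket, neg_neg, if_true, sub_lie, smul_lie, add_neg_cancel] at h
      have h2 : ⁅e .CLI, w⁆ = (-(1 / 2) : ℂ) • (⁅e (.L 1), ⁅e (.I (-1)), w⁆⁆ -
          ⁅e (.I (-1)), ⁅e (.L 1), w⁆⁆ - ⁅e (.I 0), w⁆) := by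
        rw [h]
        push_cast
        module
      rw [h2]
      exact S.smul_mem _ (S.sub_mem (S.sub_mem (hL _ _ (hI _ _ hw)) (hI _ _ (hL _ _ hw)))
        (hI _ _ hw))
    | CI =>
      have h := lie_lie_e (.I 1) (.I (-1)) w
      simp only [basisBracket, neg_neg, if_true, Int.cast_one, one_smul] at h
      have h2 : ⁅e .CI, w⁆ = ⁅e (.I 1), ⁅e (.I (-1)), w⁆⁆ - ⁅e (.I (-1)), ⁅e (.I 1), w⁆⁆ := by
        rw [h]
        abel
      rw [h2]
      exact S.sub_mem (hI _ _ (hI _ _ hw)) (hI _ _ (hI _ _ hw))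

/-- A subspace stable under all `L(n)` and `I(n)` as a submodule. -/
def submoduleOfStable (S : Submodule ℂ X) (hL : ∀ (n : ℤ), ∀ w ∈ S, ⁅e (.L n), w⁆ ∈ S)
    (hI : ∀ (n : ℤ), ∀ w ∈ S, ⁅e (.I n), w⁆ ∈ S) : LieSubmodule ℂ HVir X :=
  { S with lie_mem := fun {x _} hw => lie_mem_of_basis S hL hI x hw }

variable (X) in
/-- The central elements act by scalars, and `C_I` acts by zero. -/
structure HasLevel (cL c : ℂ) : Prop where
  CL : ∀ w : X, ⁅e .CL, w⁆ = cL • w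
  CLI : ∀ w : X, ⁅e .CLI, w⁆ = c • w
  CI : ∀ w : X, ⁅e .CI, w⁆ = 0

variable {cL c : ℂ}

theorem HasLevel.L_L (hX : HasLevel X cL c) (n m : ℤ) (w : X) :
    ⁅e (.L n), ⁅e (.L m), w⁆⁆ = ⁅e (.L m), ⁅e (.L n), w⁆⁆ + ((n : ℂ) - m) • ⁅e (.L (n + m)), w⁆ +
      ((if n = -m then ((n : ℂ) ^ 3 - n) / 12 else 0) * cL) • w := by
  rw [lie_lie_e]
  simp only [basisBracket, add_lie, smul_lie, hX.CL, smul_smul]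
  abel

theorem HasLevel.L_I (hX : HasLevel X cL c) (n m : ℤ) (w : X) :
    ⁅e (.L n), ⁅e (.I m), w⁆⁆ = ⁅e (.I m), ⁅e (.L n), w⁆⁆ - (m : ℂ) • ⁅e (.I (n + m)), w⁆ -
      ((if n = -m then (n : ℂ) ^ 2 + n else 0) * c) • w := by
  rw [lie_lie_e]
  simp only [basisBracket, sub_lie, smul_lie, hX.CLI, smul_smul]
  module

theorem HasLevel.I_I (hX : HasLevel X cL c) (n m : ℤ) (w : X) :
    ⁅e (.I n), ⁅e (.I m), w⁆⁆ = ⁅e (.I m), ⁅e (.I n), w⁆⁆ := by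
  rw [lie_lie_e]
  simp only [basisBracket, smul_lie, hX.CI, smul_zero, add_zero]

/-- Vectors obtained from a graded family of subspaces by applying negative modes. -/
inductive NegReach (B : ℤ → Submodule ℂ X) : ℤ → X → Prop
  | base {j : ℤ} {w : X} : w ∈ B j → NegReach B j w
  | L (k : ℕ) {j : ℤ} {w : X} : 0 < k → NegReach B j w → NegReach B (j + k) ⁅e (.L (-k)), w⁆
  | I (k : ℕ) {j : ℤ} {w : X} : 0 < k → NegReach B j w → NegReach B (j + k) ⁅e (.I (-k)), w⁆

/-- The degree `j` part of the closure of a graded family of subspaces under negative modes. -/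
def negSpan (B : ℤ → Submodule ℂ X) (j : ℤ) : Submodule ℂ X := Submodule.span ℂ {w | NegReach B j w}

/-- The action of a Lie algebra element as a linear map. -/
abbrev act (x : HVir) : X →ₗ[ℂ] X := LieModule.toEnd ℂ HVir X x

theorem act_apply (x : HVir) (w : X) : act x w = ⁅x, w⁆ := rfl

theorem lie_mem_of_span {s : Set X} {x : HVir} {T : Submodule ℂ X} (h : ∀ w ∈ s, ⁅x, w⁆ ∈ T) {w : X}
    (hw : w ∈ Submodule.span ℂ s) : ⁅x, w⁆ ∈ T := by
  have : Submodule.span ℂ s ≤ T.comap (act x) := Submodule.span_le.mpr h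
  exact this hw

variable {B : ℤ → Submodule ℂ X}

theorem L_neg_mem_negSpan {j : ℤ} {k : ℕ} (hk : 0 < k) {w : X} (hw : w ∈ negSpan B j) :
    ⁅e (.L (-k)), w⁆ ∈ negSpan B (j + k) :=
  lie_mem_of_span (fun _ h => Submodule.subset_span (NegReach.L k hk h)) hw

theorem I_neg_mem_negSpan {j : ℤ} {k : ℕ} (hk : 0 < k) {w : X} (hw : w ∈ negSpan B j) :
    ⁅e (.I (-k)), w⁆ ∈ negSpan B (j + k) :=
  lie_mem_of_span (fun _ h => Submodule.subset_span (NegReach.I k hk h)) hw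

theorem le_negSpan (j : ℤ) : B j ≤ negSpan B j := fun _ h => Submodule.subset_span (NegReach.base h)

/-- Moving any mode past the leading negative mode leaves some mode, possibly of another index,
acting on a shorter word, plus a scalar. Hence words of negative modes in any order span a
submodule, and no ordered basis is needed. -/
theorem NegReach.lie_mem (hX : HasLevel X cL c)
    (hL : ∀ n j : ℤ, 0 ≤ n → ∀ w ∈ B j, ⁅e (.L n), w⁆ ∈ B (j - n))
    (hI : ∀ n j : ℤ, 0 ≤ n → ∀ w ∈ B j, ⁅e (.I n), w⁆ ∈ B (j - n)) {j : ℤ} {w : X}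
    (hw : NegReach B j w) (n : ℤ) :
    ⁅e (.L n), w⁆ ∈ negSpan B (j - n) ∧ ⁅e (.I n), w⁆ ∈ negSpan B (j - n) := by
  induction hw generalizing n with
  | @base j w h =>
    rcases lt_or_ge n 0 with hn | hn
    · obtain ⟨k, rfl⟩ : ∃ k : ℕ, n = -k := ⟨n.natAbs, by omega⟩
      rw [sub_neg_eq_add]
      exact ⟨L_neg_mem_negSpan (by omega) (le_negSpan j h),
        I_neg_mem_negSpan (by omega) (le_negSpan j h)⟩
    · exact ⟨le_negSpan _ (hL n j hn w h), le_negSpan _ (hI n j hn w h)⟩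
  | @L k j w hk hw ih =>
    have e1 : j + k - n = j - n + k := by ring
    have e2 : j + k - n = j - (n + -k) := by ring
    constructor
    · rw [hX.L_L]
      refine Submodule.add_mem _ (Submodule.add_mem _ ?_ (Submodule.smul_mem _ _ ?_)) ?_
      · rw [e1]
        exact L_neg_mem_negSpan hk (ih n).1
      · rw [e2]
        exact (ih _).1
      · split_ifs with h
        · obtain rfl : n = k := by omega
          rw [add_sub_cancel_right]
          exact Submodule.smul_mem _ _ (Submodule.subset_span hw)
        · rw [zero_mul, zero_smul]
          exact Submodule.zero_mem _
    · have h := hX.L_I (-k) n w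
      rw [eq_comm, sub_eq_iff_eq_add, sub_eq_iff_eq_add] at h
      rw [h]
      refine Submodule.add_mem _ (Submodule.add_mem _ ?_ ?_) (Submodule.smul_mem _ _ ?_)
      · rw [e1]
        exact L_neg_mem_negSpan hk (ih n).2
      · split_ifs with h
        · obtain rfl : n = k := by omega
          rw [add_sub_cancel_right]
          exact Submodule.smul_mem _ _ (Submodule.subset_span hw)
        · rw [zero_mul, zero_smul]
          exact Submodule.zero_mem _
      · rw [e2, add_comm n]
        exact (ih _).2
  | @I k j w hk hw ih =>
    have e1 : j + k - n = j - n + k := by ring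
    have e2 : j + k - n = j - (n + -k) := by ring
    constructor
    · rw [hX.L_I]
      refine Submodule.sub_mem _ (Submodule.sub_mem _ ?_ (Submodule.smul_mem _ _ ?_)) ?_
      · rw [e1]
        exact I_neg_mem_negSpan hk (ih n).1
      · rw [e2]
        exact (ih _).2
      · split_ifs with h
        · obtain rfl : n = k := by omega
          rw [add_sub_cancel_right]
          exact Submodule.smul_mem _ _ (Submodule.subset_span hw)
        · rw [zero_mul, zero_smul]
          exact Submodule.zero_mem _
    · rw [hX.I_I, e1]
      exact I_neg_mem_negSpan hk (ih n).2

theorem lie_mem_negSpan (hX : HasLevel X cL c)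
    (hL : ∀ n j : ℤ, 0 ≤ n → ∀ w ∈ B j, ⁅e (.L n), w⁆ ∈ B (j - n))
    (hI : ∀ n j : ℤ, 0 ≤ n → ∀ w ∈ B j, ⁅e (.I n), w⁆ ∈ B (j - n)) (n : ℤ) {j : ℤ} {w : X}
    (hw : w ∈ negSpan B j) :
    ⁅e (.L n), w⁆ ∈ negSpan B (j - n) ∧ ⁅e (.I n), w⁆ ∈ negSpan B (j - n) :=
  ⟨lie_mem_of_span (fun _ h => (h.lie_mem hX hL hI n).1) hw,
    lie_mem_of_span (fun _ h => (h.lie_mem hX hL hI n).2) hw⟩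

/-- The submodule generated by a graded family of subspaces stable under nonnegative modes. -/
def negSubmodule (hX : HasLevel X cL c)
    (hL : ∀ n j : ℤ, 0 ≤ n → ∀ w ∈ B j, ⁅e (.L n), w⁆ ∈ B (j - n))
    (hI : ∀ n j : ℤ, 0 ≤ n → ∀ w ∈ B j, ⁅e (.I n), w⁆ ∈ B (j - n)) : LieSubmodule ℂ HVir X :=
  submoduleOfStable (⨆ j, negSpan B j)
    (fun n w hw => by
      have : ⨆ j, negSpan B j ≤ (⨆ j, negSpan B j).comap (act (e (.L n))) :=
        iSup_le fun j _ h => Submodule.mem_iSup_of_mem _ (lie_mem_negSpan hX hL hI n h).1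
      exact this hw)
    (fun n w hw => by
      have : ⨆ j, negSpan B j ≤ (⨆ j, negSpan B j).comap (act (e (.I n))) :=
        iSup_le fun j _ h => Submodule.mem_iSup_of_mem _ (lie_mem_negSpan hX hL hI n h).2
      exact this hw)

theorem mem_negSubmodule (hX : HasLevel X cL c)
    (hL : ∀ n j : ℤ, 0 ≤ n → ∀ w ∈ B j, ⁅e (.L n), w⁆ ∈ B (j - n))
    (hI : ∀ n j : ℤ, 0 ≤ n → ∀ w ∈ B j, ⁅e (.I n), w⁆ ∈ B (j - n)) {w : X} :
    w ∈ negSubmodule hX hL hI ↔ w ∈ ⨆ j, negSpan B j := Iff.rfl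

end Relations

/-! ### Grading of highest weight modules -/

section HighestWeight

variable {X : Type*} [AddCommGroup X] [Module ℂ X] [LieRingModule HVir X] [LieModule ℂ HVir X]
  {cL c h hI : ℂ} {x : X}

/-- The line through a vector, placed in degree zero. -/
def lineFamily (x : X) (j : ℤ) : Submodule ℂ X := if j = 0 then Submodule.span ℂ {x} else ⊥

theorem mem_lineFamily_zero (x : X) : x ∈ lineFamily x 0 := by
  rw [lineFamily, if_pos rfl]
  exact Submodule.mem_span_singleton_self x

theorem lie_mem_lineFamily {y : HVir} {a : ℂ} {n : ℤ} (hpos : 0 < n → ⁅y, x⁆ = 0)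
    (hzero : n = 0 → ⁅y, x⁆ = a • x) (hn : 0 ≤ n) (j : ℤ) {w : X} (hw : w ∈ lineFamily x j) :
    ⁅y, w⁆ ∈ lineFamily x (j - n) := by
  rw [lineFamily] at hw
  split_ifs at hw with hj
  · obtain ⟨b, rfl⟩ := Submodule.mem_span_singleton.mp hw
    rw [lie_smul]
    rcases hn.eq_or_lt with rfl | hn
    · rw [hzero rfl, hj, sub_zero]
      exact Submodule.smul_mem _ _ (Submodule.smul_mem _ _ (mem_lineFamily_zero x))
    · rw [hpos hn, smul_zero]
      exact Submodule.zero_mem _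
  · rw [(Submodule.mem_bot ℂ).mp hw, lie_zero]
    exact Submodule.zero_mem _

theorem _root_.IsHighestWeight.L_mem (hx : IsHighestWeight cL 0 c h hI x) (n j : ℤ) (hn : 0 ≤ n)
    (w : X) (hw : w ∈ lineFamily x j) : ⁅e (.L n), w⁆ ∈ lineFamily x (j - n) :=
  lie_mem_lineFamily (hx.L_pos n) (fun h0 => by rw [h0]; exact hx.L_zero) hn j hw

theorem _root_.IsHighestWeight.I_mem (hx : IsHighestWeight cL 0 c h hI x) (n j : ℤ) (hn : 0 ≤ n)
    (w : X) (hw : w ∈ lineFamily x j) : ⁅e (.I n), w⁆ ∈ lineFamily x (j - n) :=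
  lie_mem_lineFamily (hx.I_pos n) (fun h0 => by rw [h0]; exact hx.I_zero) hn j hw

/-- The submodule generated by a highest weight vector. -/
def hwSubmodule (hX : HasLevel X cL c) (hx : IsHighestWeight cL 0 c h hI x) :
    LieSubmodule ℂ HVir X := negSubmodule hX hx.L_mem hx.I_mem

theorem self_mem_hwSubmodule (hX : HasLevel X cL c) (hx : IsHighestWeight cL 0 c h hI x) :
    x ∈ hwSubmodule hX hx :=
  Submodule.mem_iSup_of_mem 0 (le_negSpan 0 (mem_lineFamily_zero x))

theorem NegReach.eq_zero {j : ℤ} {w : X} (hw : NegReach (lineFamily x) j w) (hj : j < 0) :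
    w = 0 := by
  induction hw with
  | base h =>
    rw [lineFamily, if_neg hj.ne] at h
    exact (Submodule.mem_bot ℂ).mp h
  | L k hk _ ih => rw [ih (by omega), lie_zero]
  | I k hk _ ih => rw [ih (by omega), lie_zero]

theorem negSpan_lineFamily_of_neg {j : ℤ} (hj : j < 0) : negSpan (lineFamily x) j = ⊥ := by
  rw [negSpan, Submodule.span_eq_bot]
  exact fun w hw => NegReach.eq_zero hw hj

theorem negSpan_lineFamily_zero : negSpan (lineFamily x) 0 = Submodule.span ℂ {x} := by
  refine le_antisymm (Submodule.span_le.mpr ?_) ?_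
  · intro w hw
    have key : ∀ (j : ℤ) (w : X), NegReach (lineFamily x) j w → j = 0 →
        w ∈ Submodule.span ℂ {x} := by
      intro j w hw hj
      cases hw with
      | base h => rwa [lineFamily, if_pos hj] at h
      | L k hk h =>
        rw [h.eq_zero (by omega), lie_zero]
        exact Submodule.zero_mem _
      | I k hk h =>
        rw [h.eq_zero (by omega), lie_zero]
        exact Submodule.zero_mem _
    exact key 0 w hw rfl
  · rw [Submodule.span_singleton_le_iff_mem]
    exact le_negSpan 0 (mem_lineFamily_zero x)

theorem L_zero_negSpan (hX : HasLevel X cL c) (hx : IsHighestWeight cL 0 c h hI x) {j : ℤ} {w : X}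
    (hw : w ∈ negSpan (lineFamily x) j) : ⁅e (.L 0), w⁆ = (h + j) • w := by
  have key : ∀ w, NegReach (lineFamily x) j w → ⁅e (.L 0), w⁆ = (h + j) • w := by
    clear hw
    intro w hw
    induction hw with
    | @base j w hb =>
      rw [lineFamily] at hb
      split_ifs at hb with hj
      · obtain ⟨b, rfl⟩ := Submodule.mem_span_singleton.mp hb
        rw [lie_smul, hx.L_zero, hj, Int.cast_zero, add_zero, smul_comm]
      · rw [(Submodule.mem_bot ℂ).mp hb, lie_zero, smul_zero]
    | L k hk _ ih =>
      rw [hX.L_L, ih, lie_smul, if_neg (by omega), zero_add]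
      push_cast
      module
    | I k hk _ ih =>
      rw [hX.L_I, ih, lie_smul, if_neg (by omega), zero_add]
      push_cast
      module
  refine Submodule.span_induction (p := fun w _ => ⁅e (.L 0), w⁆ = (h + j) • w) key ?_ ?_ ?_ hw
  · rw [lie_zero, smul_zero]
  · intro a b _ _ ha hb
    rw [lie_add, ha, hb, smul_add]
  · intro a b _ hb
    rw [lie_smul, hb, smul_comm]

theorem lie_eq_zero_of_lt (hX : HasLevel X cL c) (hx : IsHighestWeight cL 0 c h hI x) {j n : ℤ}
    {w : X} (hw : w ∈ negSpan (lineFamily x) j) (hn : j < n) :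
    ⁅e (.L n), w⁆ = 0 ∧ ⁅e (.I n), w⁆ = 0 := by
  have := lie_mem_negSpan hX hx.L_mem hx.I_mem n hw
  rwa [negSpan_lineFamily_of_neg (by omega), Submodule.mem_bot, Submodule.mem_bot] at this

/-- Highest weight modules are locally nilpotent for high positive modes. -/
theorem exists_forall_lie_eq_zero (hX : HasLevel X cL c) (hx : IsHighestWeight cL 0 c h hI x) {w : X}
    (hw : w ∈ hwSubmodule hX hx) :
    ∃ K : ℤ, ∀ n, K ≤ n → ⁅e (.L n), w⁆ = 0 ∧ ⁅e (.I n), w⁆ = 0 := by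
  rw [hwSubmodule, mem_negSubmodule] at hw
  refine Submodule.iSup_induction (motive := fun w => ∃ K : ℤ, ∀ n, K ≤ n →
    ⁅e (.L n), w⁆ = 0 ∧ ⁅e (.I n), w⁆ = 0) _ hw ?_ ⟨0, fun n _ => ⟨lie_zero _, lie_zero _⟩⟩ ?_
  · intro j w hw
    exact ⟨j + 1, fun n hn => lie_eq_zero_of_lt hX hx hw (by omega)⟩
  · rintro a b ⟨K, hK⟩ ⟨K', hK'⟩
    refine ⟨max K K', fun n hn => ?_⟩
    rw [lie_add, lie_add, (hK n (by omega)).1, (hK n (by omega)).2, (hK' n (by omega)).1,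
      (hK' n (by omega)).2, add_zero]
    exact ⟨rfl, rfl⟩

theorem I_zero_apply (hX : HasLevel X cL c) (hx : IsHighestWeight cL 0 c h hI x) {w : X}
    (hw : w ∈ hwSubmodule hX hx) : ⁅e (.I 0), w⁆ = hI • w := by
  rw [hwSubmodule, mem_negSubmodule] at hw
  refine Submodule.iSup_induction (motive := fun w => ⁅e (.I 0), w⁆ = hI • w) _ hw ?_ ?_ ?_
  · intro j w hw
    refine Submodule.span_induction (p := fun w _ => ⁅e (.I 0), w⁆ = hI • w) ?_ ?_ ?_ ?_ hw
    · clear hw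
      intro w hw
      induction hw with
      | @base j w hb =>
        rw [lineFamily] at hb
        split_ifs at hb with hj
        · obtain ⟨b, rfl⟩ := Submodule.mem_span_singleton.mp hb
          rw [lie_smul, hx.I_zero, smul_comm]
        · rw [(Submodule.mem_bot ℂ).mp hb, lie_zero, smul_zero]
      | @L k j w hk _ ih =>
        have h := hX.L_I (-k) 0 w
        rw [if_neg (by omega), Int.cast_zero, ih] at h
        rw [lie_smul, zero_smul, zero_mul, zero_smul, sub_zero, sub_zero] at h
        exact h.symm
      | @I k j w hk _ ih => rw [hX.I_I, ih, lie_smul]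
    · rw [lie_zero, smul_zero]
    · intro a b _ _ ha hb
      rw [lie_add, ha, hb, smul_add]
    · intro a b _ hb
      rw [lie_smul, hb, smul_comm]
  · rw [lie_zero, smul_zero]
  · intro a b ha hb
    rw [lie_add, ha, hb, smul_add]

end HighestWeight
end HVir
end

/-! ### The singular vector S_p -/

noncomputable section

set_option linter.unusedSectionVars false

namespace HVir

variable {X : Type*} [AddCommGroup X] [Module ℂ X] [LieRingModule HVir X] [LieModule ℂ HVir X]
  {cL c h hI : ℂ} {x : X}

/-- The Schur polynomials in the modes `-I(-k) / c`, applied to a vector. -/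
def schurVec (c : ℂ) (x : X) : ℕ → X
  | 0 => x
  | n + 1 => (-(1 / (c * (n + 1)))) • ∑ i : Fin (n + 1), ⁅e (.I ((i : ℤ) - (n + 1))), schurVec c x i⁆
decreasing_by exact i.2

theorem schurVec_zero (c : ℂ) (x : X) : schurVec c x 0 = x := by rw [schurVec]

/-- Newton's recursion for the generating series exp(-Σ I(-k) z^k/(ck)). -/
theorem sum_schurVec (hc : c ≠ 0) (x : X) (n : ℕ) :
    ∑ i ∈ Finset.range n, ⁅e (.I ((i : ℤ) - n)), schurVec c x i⁆ = (-(c * n)) • schurVec c x n := by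
  cases n with
  | zero => simp
  | succ n =>
    have hn : (n : ℂ) + 1 ≠ 0 := Nat.cast_add_one_ne_zero n
    rw [schurVec, smul_smul, Finset.sum_range]
    push_cast
    rw [show -(c * ((n : ℂ) + 1)) * -(1 / (c * (n + 1))) = 1 by field_simp, one_smul]

theorem schurVec_mem (hc : c ≠ 0) {B : ℤ → Submodule ℂ X} {j : ℤ} (hx : x ∈ negSpan B j) (n : ℕ) :
    schurVec c x n ∈ negSpan B (j + n) := by
  induction n using Nat.strong_induction_on with
  | _ n ih =>
    rcases n.eq_zero_or_pos with rfl | hn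
    · rw [schurVec_zero]
      simpa using hx
    · have hn' : -(c * n) ≠ 0 := neg_ne_zero.mpr (mul_ne_zero hc (by exact_mod_cast hn.ne'))
      rw [← Submodule.smul_mem_iff _ hn', ← sum_schurVec hc]
      refine Submodule.sum_mem _ fun i hi => ?_
      rw [Finset.mem_range] at hi
      have := I_neg_mem_negSpan (k := n - i) (by omega) (ih i hi)
      rw [Nat.cast_sub hi.le, neg_sub] at this
      rwa [show j + (i : ℤ) + (n - i) = j + n by ring] at this

theorem I_schurVec (hc : c ≠ 0) (hX : HasLevel X cL c) {m : ℤ} {a : ℂ} (hx : ⁅e (.I m), x⁆ = a • x)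
    (n : ℕ) : ⁅e (.I m), schurVec c x n⁆ = a • schurVec c x n := by
  induction n using Nat.strong_induction_on with
  | _ n ih =>
    rcases n.eq_zero_or_pos with rfl | hn
    · rwa [schurVec_zero]
    · have hn' : -(c * n) ≠ 0 := neg_ne_zero.mpr (mul_ne_zero hc (by exact_mod_cast hn.ne'))
      refine smul_right_injective X hn' ?_
      change -(c * n) • ⁅e (.I m), schurVec c x n⁆ = -(c * n) • a • schurVec c x n
      rw [← lie_smul, smul_comm, ← sum_schurVec hc, lie_sum, Finset.smul_sum]
      refine Finset.sum_congr rfl fun i hi => ?_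
      rw [hX.I_I, ih i (Finset.mem_range.mp hi), lie_smul]

/-- Commute L(k) through Newton's recursion for S_n and put r = n - k. Below index r, the brackets
and the inductive terms are multiples of I(m-r) S_m, which the recursion for S_r resums to
-cr(2k+r-p) S_r. At index r, I(0) and the centre add kc(p+1) - (k²+k)c. Above r only positive
I-modes occur, and they vanish. The total is -cn(n-p) S_r. -/
theorem L_schurVec (hc : c ≠ 0) (hX : HasLevel X cL c) {p : ℂ}
    (hx : IsHighestWeight cL 0 c h (c * (p + 1)) x) {k : ℕ} (hk : 0 < k) (n : ℕ) :
    ⁅e (.L k), schurVec c x n⁆ = if k ≤ n then ((n : ℂ) - p) • schurVec c x (n - k) else 0 := by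
  have hI0 : ∀ n, ⁅e (.I 0), schurVec c x n⁆ = (c * (p + 1)) • schurVec c x n :=
    I_schurVec hc hX hx.I_zero
  have hIpos : ∀ (m : ℤ) n, 0 < m → ⁅e (.I m), schurVec c x n⁆ = 0 := by
    intro m n hm
    rw [I_schurVec hc hX (a := 0), zero_smul]
    rw [hx.I_pos m hm, zero_smul]
  induction n using Nat.strong_induction_on with
  | _ n ih =>
    rcases n.eq_zero_or_pos with rfl | hn
    · rw [schurVec_zero, if_neg (by omega), hx.L_pos k (by exact_mod_cast hk)]
    have hn' : -(c * n) ≠ 0 := neg_ne_zero.mpr (mul_ne_zero hc (by exact_mod_cast hn.ne'))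
    have key : -(c * n) • ⁅e (.L k), schurVec c x n⁆ =
        ∑ i ∈ Finset.range n, ⁅e (.I ((i : ℤ) - n)), ⁅e (.L k), schurVec c x i⁆⁆ +
        ∑ i ∈ Finset.range n, (((n : ℂ) - i) • ⁅e (.I (k + i - n)), schurVec c x i⁆ -
          ((if k + i = n then (k : ℂ) ^ 2 + k else 0) * c) • schurVec c x i) := by
      rw [← lie_smul, ← sum_schurVec hc, lie_sum, ← Finset.sum_add_distrib]
      refine Finset.sum_congr rfl fun i _ => ?_
      have e1 : ((k : ℤ) = -((i : ℤ) - n)) ↔ (k + i = n) := by omega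
      rw [hX.L_I, show (k : ℤ) + ((i : ℤ) - n) = k + i - n by ring]
      simp only [e1]
      push_cast
      module
    by_cases hkn : k ≤ n
    · obtain ⟨r, rfl⟩ := Nat.exists_eq_add_of_le hkn
      have h1 : ∑ i ∈ Finset.range (k + r),
          ⁅e (.I ((i : ℤ) - (k + r : ℕ))), ⁅e (.L k), schurVec c x i⁆⁆ =
          ∑ m ∈ Finset.range r, ((k : ℂ) + m - p) • ⁅e (.I ((m : ℤ) - r)), schurVec c x m⁆ := by
        rw [Finset.sum_range_add, Finset.sum_eq_zero, zero_add]
        · refine Finset.sum_congr rfl fun m hm => ?_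
          rw [Finset.mem_range] at hm
          rw [ih _ (by omega), if_pos (by omega), Nat.add_sub_cancel_left, lie_smul]
          push_cast
          rw [show (k : ℤ) + m - (k + r) = m - r by ring]
        · intro i hi
          rw [Finset.mem_range] at hi
          rw [ih _ (by omega), if_neg (by omega), lie_zero]
      have h2 : ∑ i ∈ Finset.range (k + r),
          ((((k + r : ℕ) : ℂ) - i) • ⁅e (.I (k + i - (k + r : ℕ))), schurVec c x i⁆ -
          ((if k + i = k + r then (k : ℂ) ^ 2 + k else 0) * c) • schurVec c x i) =
          ∑ m ∈ Finset.range r, ((k : ℂ) + r - m) • ⁅e (.I ((m : ℤ) - r)), schurVec c x m⁆ +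
          ((k : ℂ) * (c * (p + 1)) - ((k : ℂ) ^ 2 + k) * c) • schurVec c x r := by
        rw [add_comm k r, Finset.sum_range_add]
        congr 1
        · refine Finset.sum_congr rfl fun m hm => ?_
          rw [Finset.mem_range] at hm
          rw [if_neg (by omega)]
          push_cast
          rw [show (k : ℤ) + m - (r + k) = m - r by ring]
          module
        · obtain ⟨k, rfl⟩ : ∃ k', k = k' + 1 := ⟨k - 1, by omega⟩
          rw [Finset.sum_range_succ', Finset.sum_eq_zero, zero_add]
          · rw [if_pos (by omega), add_zero]
            push_cast
            rw [show (k : ℤ) + 1 + r - (r + (k + 1)) = 0 by ring, hI0]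
            module
          · intro i _
            rw [if_neg (by omega), hIpos _ _ (by push_cast; omega)]
            simp
      rw [if_pos hkn, Nat.add_sub_cancel_left]
      refine smul_right_injective X hn' ?_
      change -(c * (k + r : ℕ)) • ⁅e (.L k), schurVec c x (k + r)⁆ = _
      rw [key, h1, h2, ← add_assoc, ← Finset.sum_add_distrib]
      have h3 : ∑ m ∈ Finset.range r, (((k : ℂ) + m - p) • ⁅e (.I ((m : ℤ) - r)), schurVec c x m⁆ +
          ((k : ℂ) + r - m) • ⁅e (.I ((m : ℤ) - r)), schurVec c x m⁆) =
          (2 * (k : ℂ) + r - p) • (-(c * r)) • schurVec c x r := by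
        rw [← sum_schurVec hc, Finset.smul_sum]
        refine Finset.sum_congr rfl fun m _ => ?_
        module
      rw [h3]
      push_cast
      module
    · rw [if_neg hkn]
      refine (smul_eq_zero.mp (key.trans ?_)).resolve_left hn'
      rw [Finset.sum_eq_zero, Finset.sum_eq_zero, add_zero]
      · intro i hi
        rw [hIpos _ _ (by omega), if_neg (by omega)]
        simp
      · intro i hi
        rw [Finset.mem_range] at hi
        rw [ih i hi, if_neg (by omega), lie_zero]

theorem isHighestWeight_schurVec (hc : c ≠ 0) (hX : HasLevel X cL c) {p : ℕ}
    (hx : IsHighestWeight cL 0 c h (c * (p + 1)) x) :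
    IsHighestWeight cL 0 c (h + p) (c * (p + 1)) (schurVec c x p) := by
  refine ⟨fun n hn => ?_, fun n hn => ?_, hX.CL _, ?_, hX.CLI _, ?_, I_schurVec hc hX hx.I_zero p⟩
  · obtain ⟨k, rfl⟩ : ∃ k : ℕ, n = k := ⟨n.toNat, by omega⟩
    rw [L_schurVec hc hX hx (by omega)]
    split_ifs <;> simp
  · rw [I_schurVec hc hX (a := 0), zero_smul]
    rw [hx.I_pos n hn, zero_smul]
  · rw [hX.CI, zero_smul]
  · have := L_zero_negSpan hX hx (schurVec_mem hc (le_negSpan 0 (mem_lineFamily_zero x)) p)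
    rw [this]
    push_cast
    rw [zero_add]

end HVir
end

/-! ### Separating the highest weight vector from the positive part -/

noncomputable section

set_option linter.unusedSectionVars false

namespace HVir

section

variable {X Y : Type*} [AddCommGroup X] [Module ℂ X] [LieRingModule HVir X] [LieModule ℂ HVir X]
  [AddCommGroup Y] [Module ℂ Y] [LieRingModule HVir Y] [LieModule ℂ HVir Y]
  {cL c h hI : ℂ} {x : X}

theorem negSpan_lineFamily_le {B : ℤ → Submodule ℂ X} {d : ℤ} (hx : x ∈ negSpan B d) (j : ℤ) :
    negSpan (lineFamily x) j ≤ negSpan B (j + d) := by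
  refine Submodule.span_le.mpr fun w hw => ?_
  induction hw with
  | @base j w hb =>
    rw [lineFamily] at hb
    split_ifs at hb with hj
    · obtain ⟨b, rfl⟩ := Submodule.mem_span_singleton.mp hb
      rw [hj, zero_add]
      exact Submodule.smul_mem _ b hx
    · rw [(Submodule.mem_bot ℂ).mp hb]
      exact Submodule.zero_mem _
  | @L k j w hk _ ih =>
    rw [show j + (k : ℤ) + d = j + d + k by ring]
    exact L_neg_mem_negSpan hk ih
  | @I k j w hk _ ih =>
    rw [show j + (k : ℤ) + d = j + d + k by ring]
    exact I_neg_mem_negSpan hk ih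

/-- The span of the vectors of positive degree generated by a vector. -/
def posPart (x : X) : Submodule ℂ X := ⨆ j : ℕ, negSpan (lineFamily x) (j + 1)

theorem exists_add_mem_posPart (hX : HasLevel X cL c) (hx : IsHighestWeight cL 0 c h hI x) {w : X}
    (hw : w ∈ hwSubmodule hX hx) : ∃ a : ℂ, ∃ ρ ∈ posPart x, w = a • x + ρ := by
  rw [hwSubmodule, mem_negSubmodule] at hw
  refine Submodule.iSup_induction (motive := fun w => ∃ a : ℂ, ∃ ρ ∈ posPart x, w = a • x + ρ)
    _ hw ?_ ⟨0, 0, Submodule.zero_mem _, by simp⟩ ?_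
  · intro j w hw
    rcases lt_trichotomy j 0 with hj | rfl | hj
    · rw [negSpan_lineFamily_of_neg hj, Submodule.mem_bot] at hw
      exact ⟨0, 0, Submodule.zero_mem _, by simp [hw]⟩
    · rw [negSpan_lineFamily_zero] at hw
      obtain ⟨b, rfl⟩ := Submodule.mem_span_singleton.mp hw
      exact ⟨b, 0, Submodule.zero_mem _, by simp⟩
    · obtain ⟨i, rfl⟩ : ∃ i : ℕ, j = i + 1 := ⟨(j - 1).toNat, by omega⟩
      exact ⟨0, w, Submodule.mem_iSup_of_mem i hw, by simp⟩
  · rintro _ _ ⟨a, ρ, hρ, rfl⟩ ⟨a', ρ', hρ', rfl⟩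
    exact ⟨a + a', ρ + ρ', Submodule.add_mem _ hρ hρ', by module⟩

theorem exists_aeval_eq_zero (hX : HasLevel X cL c) (hx : IsHighestWeight cL 0 c h hI x) {ρ : X}
    (hρ : ρ ∈ posPart x) : ∃ q : Polynomial ℂ, q.eval h ≠ 0 ∧
      Polynomial.aeval (LieModule.toEnd ℂ HVir X (e (.L 0))) q ρ = 0 := by
  refine Submodule.iSup_induction (motive := fun ρ => ∃ q : Polynomial ℂ, q.eval h ≠ 0 ∧
      Polynomial.aeval (LieModule.toEnd ℂ HVir X (e (.L 0))) q ρ = 0) _ hρ ?_ ⟨1, by simp⟩ ?_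
  · intro j w hw
    refine ⟨Polynomial.X - Polynomial.C (h + (j + 1)), ?_, ?_⟩
    · simp only [Polynomial.eval_sub, Polynomial.eval_X, Polynomial.eval_C]
      rw [show h - (h + ((j : ℂ) + 1)) = -((j : ℂ) + 1) by ring]
      exact neg_ne_zero.mpr (Nat.cast_add_one_ne_zero j)
    · have := L_zero_negSpan hX hx hw
      simp only [map_sub, Polynomial.aeval_X, Polynomial.aeval_C, LinearMap.sub_apply,
        LieModule.toEnd_apply_apply, Module.algebraMap_end_apply, this]
      push_cast
      exact sub_self _
  · rintro a b ⟨q, hq, hqa⟩ ⟨r, hr, hrb⟩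
    refine ⟨q * r, by rw [Polynomial.eval_mul]; exact mul_ne_zero hq hr, ?_⟩
    have h1 : Polynomial.aeval (LieModule.toEnd ℂ HVir X (e (.L 0))) (q * r) a = 0 := by
      rw [mul_comm, map_mul, Module.End.mul_apply, hqa, map_zero]
    have h2 : Polynomial.aeval (LieModule.toEnd ℂ HVir X (e (.L 0))) (q * r) b = 0 := by
      rw [map_mul, Module.End.mul_apply, hrb, map_zero]
    rw [map_add, h1, h2, add_zero]

/-- A polynomial in L(0) that kills ρ but does not vanish at the weight h of x isolates x. -/
theorem mem_of_add_mem (hX : HasLevel X cL c) (hx : IsHighestWeight cL 0 c h hI x)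
    (N : LieSubmodule ℂ HVir X) {a : ℂ} (ha : a ≠ 0) {ρ : X} (hρ : ρ ∈ posPart x)
    (hN : a • x + ρ ∈ N) : x ∈ N := by
  obtain ⟨q, hq, hqρ⟩ := exists_aeval_eq_zero hX hx hρ
  set T := LieModule.toEnd ℂ HVir X (e (.L 0)) with hT
  have hTx : T x = h • x := hx.L_zero
  have h1 : Polynomial.aeval T q x = q.eval h • x :=
    Module.End.aeval_apply_of_mem_apply_eq_smul hTx
  have h2 : ∀ (q : Polynomial ℂ), ∀ w ∈ N, Polynomial.aeval T q w ∈ N := by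
    intro q w hw
    induction q using Polynomial.induction_on' generalizing w with
    | add q r hq' hr' =>
      rw [map_add]
      exact N.add_mem (hq' w hw) (hr' w hw)
    | monomial n a =>
      rw [Polynomial.aeval_monomial, Module.End.mul_apply, Module.algebraMap_end_apply]
      refine N.smul_mem a ?_
      induction n generalizing w with
      | zero => simpa using hw
      | succ n ih =>
        rw [pow_succ, Module.End.mul_apply]
        exact ih _ (N.lie_mem hw)
  have h3 := h2 q _ hN
  rw [map_add, map_smul, h1, hqρ, add_zero, smul_smul] at h3
  have := N.smul_mem (a * q.eval h)⁻¹ h3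
  rwa [smul_smul, inv_mul_cancel₀ (mul_ne_zero ha hq), one_smul] at this

end
end HVir
end

/-! ### Maximal submodules of Verma modules -/

noncomputable section

set_option linter.unusedSectionVars false

namespace Verma

variable {cL cI c h hI : ℂ}

section

attribute [local instance] LieRing.ofAssociativeRing LieAlgebra.ofAssociativeAlgebra

/-- The elements preserving N form a subalgebra containing the image of `ι`. The universal property
maps the enveloping algebra into it compatibly with the inclusion, so it is everything. -/
theorem uea_smul_mem (N : LieSubmodule ℂ HVir (Verma cL cI c h hI))
    (u : UniversalEnvelopingAlgebra ℂ HVir) {w : Verma cL cI c h hI} (hw : w ∈ N) : u • w ∈ N := by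
  let S : Subalgebra ℂ (UniversalEnvelopingAlgebra ℂ HVir) :=
    { carrier := {u | ∀ w ∈ N, u • w ∈ N}
      mul_mem' := fun {a b} ha hb w hw => by
        rw [mul_smul]
        exact ha _ (hb _ hw)
      add_mem' := fun {a b} ha hb w hw => by
        rw [add_smul]
        exact N.add_mem (ha _ hw) (hb _ hw)
      algebraMap_mem' := fun r w hw => by
        rw [algebraMap_smul]
        exact N.smul_mem r hw }
  let φ : HVir →ₗ⁅ℂ⁆ S :=
    { toFun := fun x => ⟨UniversalEnvelopingAlgebra.ι ℂ x, fun w hw => N.lie_mem (x := x) hw⟩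
      map_add' := fun x y => Subtype.ext (map_add _ x y)
      map_smul' := fun r x => Subtype.ext (map_smul _ r x)
      map_lie' := fun {x y} => Subtype.ext (LieHom.map_lie _ x y) }
  have h : S.val.comp (UniversalEnvelopingAlgebra.lift ℂ φ) = AlgHom.id ℂ _ := by
    apply UniversalEnvelopingAlgebra.hom_ext
    refine LieHom.ext fun x => ?_
    change ((UniversalEnvelopingAlgebra.lift ℂ φ (UniversalEnvelopingAlgebra.ι ℂ x) : S) :
      UniversalEnvelopingAlgebra ℂ HVir) = UniversalEnvelopingAlgebra.ι ℂ x
    rw [UniversalEnvelopingAlgebra.lift_ι_apply]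
    rfl
  have hu : ((UniversalEnvelopingAlgebra.lift ℂ φ u : S) : UniversalEnvelopingAlgebra ℂ HVir) = u :=
    DFunLike.congr_fun h u
  rw [← hu]
  exact (UniversalEnvelopingAlgebra.lift ℂ φ u).2 w hw

end

theorem eq_top_of_hwv_mem {N : LieSubmodule ℂ HVir (Verma cL cI c h hI)}
    (hN : hwv cL cI c h hI ∈ N) : N = ⊤ := by
  refine eq_top_iff.mpr fun m _ => ?_
  obtain ⟨u, hu⟩ := Submodule.Quotient.mk_surjective _ m
  have : m = u • hwv cL cI c h hI := by
    rw [smul_hwv]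
    exact hu.symm
  rw [this]
  exact uea_smul_mem N u hN

end Verma

namespace HVir

section

variable {X Y : Type*} [AddCommGroup X] [Module ℂ X] [LieRingModule HVir X] [LieModule ℂ HVir X]
  [AddCommGroup Y] [Module ℂ Y] [LieRingModule HVir Y] [LieModule ℂ HVir Y]
  {cL c h hI : ℂ} {x : X}

theorem basisBracket_CL (i : HVirIdx) : basisBracket i .CL = 0 := by cases i <;> rfl
theorem basisBracket_CLI (i : HVirIdx) : basisBracket i .CLI = 0 := by cases i <;> rfl
theorem basisBracket_CI (i : HVirIdx) : basisBracket i .CI = 0 := by cases i <;> rfl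

/-- The vectors on which a central basis element acts by a scalar. -/
def scalarSubmodule (X : Type*) [AddCommGroup X] [Module ℂ X] [LieRingModule HVir X]
    [LieModule ℂ HVir X] (z : HVirIdx) (hz : ∀ i, basisBracket i z = 0) (a : ℂ) :
    LieSubmodule ℂ HVir X :=
  submoduleOfStable (LinearMap.ker (act (e z) - a • (LinearMap.id : X →ₗ[ℂ] X)))
    (fun n w hw => by
      simp only [LinearMap.mem_ker, LinearMap.sub_apply, LinearMap.smul_apply, LinearMap.id_apply,
        act_apply, sub_eq_zero] at hw ⊢
      have := lie_lie_e (.L n) z w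
      rwa [hz, zero_lie, add_zero, hw, lie_smul, eq_comm] at this)
    (fun n w hw => by
      simp only [LinearMap.mem_ker, LinearMap.sub_apply, LinearMap.smul_apply, LinearMap.id_apply,
        act_apply, sub_eq_zero] at hw ⊢
      have := lie_lie_e (.I n) z w
      rwa [hz, zero_lie, add_zero, hw, lie_smul, eq_comm] at this)

theorem mem_scalarSubmodule {z : HVirIdx} {hz : ∀ i, basisBracket i z = 0} {a : ℂ} {w : X} :
    w ∈ scalarSubmodule X z hz a ↔ ⁅e z, w⁆ = a • w := by
  have : w ∈ scalarSubmodule X z hz a ↔ 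
      (act (e z) - a • LinearMap.id : X →ₗ[ℂ] X) w = 0 := Iff.rfl
  rw [this, LinearMap.sub_apply, sub_eq_zero]
  rfl

/-- An eigenspace of a central element is a submodule, and here it contains the generator. -/
theorem hasLevel_of_eq_top (hx : IsHighestWeight cL 0 c h hI x)
    (htop : ∀ N : LieSubmodule ℂ HVir X, x ∈ N → N = ⊤) : HasLevel X cL c := by
  have key : ∀ (z : HVirIdx) (hz : ∀ i, basisBracket i z = 0) (a : ℂ), ⁅e z, x⁆ = a • x →
      ∀ w : X, ⁅e z, w⁆ = a • w := by
    intro z hz a hx w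
    have := htop (scalarSubmodule X z hz a) (mem_scalarSubmodule.mpr hx)
    exact (mem_scalarSubmodule (hz := hz)).mp (this ▸ LieSubmodule.mem_top w)
  refine ⟨key _ basisBracket_CL _ hx.CL, key _ basisBracket_CLI _ hx.CLI, fun w => ?_⟩
  rw [key _ basisBracket_CI _ hx.CI, zero_smul]

variable (π : X →ₗ⁅ℂ,HVir⁆ Y)

theorem _root_.IsHighestWeight.map {cI : ℂ} (hx : IsHighestWeight cL cI c h hI x) :
    IsHighestWeight cL cI c h hI (π x) := by
  refine ⟨fun n hn => ?_, fun n hn => ?_, ?_, ?_, ?_, ?_, ?_⟩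
  · rw [← LieModuleHom.map_lie, hx.L_pos n hn, map_zero]
  · rw [← LieModuleHom.map_lie, hx.I_pos n hn, map_zero]
  · rw [← LieModuleHom.map_lie, hx.CL, map_smul]
  · rw [← LieModuleHom.map_lie, hx.CI, map_smul]
  · rw [← LieModuleHom.map_lie, hx.CLI, map_smul]
  · rw [← LieModuleHom.map_lie, hx.L_zero, map_smul]
  · rw [← LieModuleHom.map_lie, hx.I_zero, map_smul]

theorem HasLevel.of_surjective (hπ : Function.Surjective π) (hX : HasLevel X cL c) :
    HasLevel Y cL c := by
  refine ⟨fun w => ?_, fun w => ?_, fun w => ?_⟩ <;> obtain ⟨w, rfl⟩ := hπ w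
  · rw [← LieModuleHom.map_lie, hX.CL, map_smul]
  · rw [← LieModuleHom.map_lie, hX.CLI, map_smul]
  · rw [← LieModuleHom.map_lie, hX.CI, map_zero]

theorem map_schurVec (c : ℂ) (x : X) (n : ℕ) : π (schurVec c x n) = schurVec c (π x) n := by
  induction n using Nat.strong_induction_on with
  | _ n ih =>
    cases n with
    | zero => rw [schurVec_zero, schurVec_zero]
    | succ n =>
      rw [schurVec, schurVec, map_smul, map_sum]
      congr 1
      exact Finset.sum_congr rfl fun i _ => by rw [LieModuleHom.map_lie, ih i i.2]

end

end HVir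

namespace Verma
open HVir Polynomial

variable {cL c h hI : ℂ}

theorem hasLevel : HasLevel (Verma cL 0 c h hI) cL c :=
  hasLevel_of_eq_top isHighestWeight_hwv fun _ => eq_top_of_hwv_mem

theorem hwSubmodule_eq_top :
    hwSubmodule (hasLevel (cL := cL) (c := c) (h := h) (hI := hI)) isHighestWeight_hwv = ⊤ :=
  eq_top_of_hwv_mem (self_mem_hwSubmodule _ _)

/-- The functional of `exists_functional` has constant coefficient 1 on the highest weight vector
and 0 on the image of any negative mode. This plays the role of linear independence of the PBW
monomials. -/
theorem hwv_notMem_posPart (hc : c ≠ 0) (hne : hI ≠ c) :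
    hwv cL 0 c h hI ∉ posPart (hwv cL 0 c h hI) := by
  obtain ⟨f, hf1, hfI, hfL⟩ := exists_functional cL h hc hne 0 0 0
  intro hmem
  have key : posPart (hwv cL 0 c h hI) ≤ LinearMap.ker ((lcoeff ℂ 0).comp f) := by
    refine iSup_le fun i => Submodule.span_le.mpr fun w hw => ?_
    have hpos : ∀ (j : ℤ) (w : Verma cL 0 c h hI), NegReach (lineFamily (hwv cL 0 c h hI)) j w →
        j ≠ 0 → (f w).coeff 0 = 0 := by
      intro j w hw hj
      cases hw with
      | base hb =>
        rw [lineFamily, if_neg hj] at hb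
        rw [(Submodule.mem_bot ℂ).mp hb, map_zero, coeff_zero]
      | L k hk h =>
        rw [hfL k hk, mul_coeff_zero, coeff_X_pow, if_neg (by omega), zero_mul]
      | I k hk h =>
        rw [hfI k hk, mul_assoc, mul_coeff_zero, mul_coeff_zero, coeff_X_pow, if_neg (by omega),
          zero_mul, mul_zero]
    exact hpos _ w hw (by omega)
  have := key hmem
  rw [LinearMap.mem_ker, LinearMap.comp_apply, hf1, lcoeff_apply, coeff_one_zero] at this
  exact one_ne_zero this

theorem le_posPart {N : LieSubmodule ℂ HVir (Verma cL 0 c h hI)} (hN : N ≠ ⊤)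
    {w : Verma cL 0 c h hI} (hw : w ∈ N) : w ∈ posPart (hwv cL 0 c h hI) := by
  obtain ⟨a, ρ, hρ, rfl⟩ := exists_add_mem_posPart hasLevel isHighestWeight_hwv
    (hwSubmodule_eq_top.symm ▸ LieSubmodule.mem_top w)
  rcases eq_or_ne a 0 with rfl | ha
  · rwa [zero_smul, zero_add]
  · exact absurd (eq_top_of_hwv_mem (mem_of_add_mem hasLevel isHighestWeight_hwv N ha hρ hw)) hN

/-- Every proper submodule lies in the positive part, hence so does the sum of all of them. -/
theorem hwv_notMem_maxSubmodule (hc : c ≠ 0) (hne : hI ≠ c) :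
    hwv cL 0 c h hI ∉ maxSubmodule cL 0 c h hI := by
  intro hmem
  have : (maxSubmodule cL 0 c h hI : Submodule ℂ (Verma cL 0 c h hI)) ≤
      posPart (hwv cL 0 c h hI) := by
    rw [maxSubmodule, LieSubmodule.sSup_toSubmodule]
    refine sSup_le ?_
    rintro _ ⟨N, hN, rfl⟩
    exact fun w hw => le_posPart hN hw
  exact hwv_notMem_posPart hc hne (this hmem)

theorem le_maxSubmodule {cI : ℂ} {N : LieSubmodule ℂ HVir (Verma cL cI c h hI)} (hN : N ≠ ⊤) :
    N ≤ maxSubmodule cL cI c h hI := le_sSup hN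

/-- The submodule generated by a vector of positive degree is proper. -/
theorem hwSubmodule_le_posPart {h' hI' : ℂ} {x : Verma cL 0 c h hI}
    (hx : IsHighestWeight cL 0 c h' hI' x) {d : ℕ} (hd : 0 < d)
    (hmem : x ∈ negSpan (lineFamily (hwv cL 0 c h hI)) d) {w : Verma cL 0 c h hI}
    (hw : w ∈ hwSubmodule hasLevel hx) : w ∈ posPart (hwv cL 0 c h hI) := by
  rw [hwSubmodule, mem_negSubmodule] at hw
  have : ⨆ j, negSpan (lineFamily x) j ≤ posPart (hwv cL 0 c h hI) := by
    refine iSup_le fun j => ?_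
    rcases lt_or_ge j 0 with hj | hj
    · rw [negSpan_lineFamily_of_neg hj]
      exact bot_le
    · refine (negSpan_lineFamily_le hmem j).trans fun y hy => ?_
      refine Submodule.mem_iSup_of_mem (j + d - 1).toNat ?_
      rwa [show (((j + d - 1).toNat : ℕ) : ℤ) + 1 = j + d by omega]
  exact this hw

end Verma

theorem mul_add_one_ne {c : ℂ} (hc : c ≠ 0) {p : ℕ} (hp : 0 < p) : c * (p + 1) ≠ c := by
  intro h0
  have : c * p = 0 := by linear_combination h0
  rcases mul_eq_zero.mp this with h1 | h1
  · exact hc h1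
  · exact hp.ne' (by exact_mod_cast h1)

/-! ### The irreducible highest weight module -/

namespace IrreducibleHW
open HVir

variable (cL : ℂ) {c : ℂ} (h : ℂ) {hI : ℂ}

/-- The image of the highest weight vector. -/
def hwv (cL c h hI : ℂ) : IrreducibleHW cL 0 c h hI :=
  LieSubmodule.Quotient.mk' _ (Verma.hwv cL 0 c h hI)

theorem isHighestWeight_hwv : IsHighestWeight cL 0 c h hI (hwv cL c h hI) :=
  Verma.isHighestWeight_hwv.map _

theorem hasLevel : HasLevel (IrreducibleHW cL 0 c h hI) cL c :=
  Verma.hasLevel.of_surjective _ (LieSubmodule.Quotient.surjective_mk' _)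

theorem hwv_ne_zero (hc : c ≠ 0) (hne : hI ≠ c) : hwv cL c h hI ≠ 0 := by
  rw [hwv, Ne, LieSubmodule.Quotient.mk_eq_zero]
  exact Verma.hwv_notMem_maxSubmodule hc hne

theorem isIrreducible (hc : c ≠ 0) (hne : hI ≠ c) :
    LieModule.IsIrreducible ℂ HVir (IrreducibleHW cL 0 c h hI) := by
  have : Nontrivial (IrreducibleHW cL 0 c h hI) := ⟨_, _, hwv_ne_zero cL h hc hne⟩
  refine LieModule.IsIrreducible.mk fun N hN => ?_
  by_contra hNtop
  refine hN (eq_bot_iff.mpr fun w hw => ?_)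
  obtain ⟨w, rfl⟩ := LieSubmodule.Quotient.surjective_mk' _ w
  rw [LieSubmodule.mem_bot, LieSubmodule.Quotient.mk_eq_zero]
  have htop : N.comap (LieSubmodule.Quotient.mk' _) ≠ ⊤ := by
    intro h
    refine hNtop (eq_top_iff.mpr fun y _ => ?_)
    obtain ⟨y, rfl⟩ := LieSubmodule.Quotient.surjective_mk' _ y
    have : y ∈ N.comap (LieSubmodule.Quotient.mk' _) := h ▸ LieSubmodule.mem_top y
    exact this
  exact Verma.le_maxSubmodule htop hw

/-- In the Verma module S_p is singular of degree p > 0, so the submodule it generates stays in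
positive degrees and is proper. -/
theorem schurVec_hwv {p : ℕ} (hc : c ≠ 0) (hp : 0 < p) :
    schurVec c (hwv cL c h (c * (p + 1))) p = 0 := by
  have hne := mul_add_one_ne hc hp
  rw [hwv, ← map_schurVec, LieSubmodule.Quotient.mk_eq_zero]
  have hx := isHighestWeight_schurVec hc Verma.hasLevel
    (Verma.isHighestWeight_hwv (cL := cL) (h := h) (c := c) (hI := c * (p + 1)))
  refine Verma.le_maxSubmodule (N := hwSubmodule Verma.hasLevel hx) (fun htop => ?_)
    (self_mem_hwSubmodule _ _)
  refine Verma.hwv_notMem_posPart (cL := cL) (h := h) hc hne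
    (Verma.hwSubmodule_le_posPart hx hp ?_ (htop.symm ▸ LieSubmodule.mem_top _))
  have := schurVec_mem hc (le_negSpan 0
    (mem_lineFamily_zero (Verma.hwv cL 0 c h (c * (p + 1))))) p
  rwa [zero_add] at this

end IrreducibleHW
end

/-! ### Irreducibility for non-exceptional F -/

noncomputable section

set_option linter.unusedSectionVars false

namespace HVir
open Filter

section

variable {E X : Type*} [AddCommGroup E] [Module ℂ E] [LieRingModule HVir E] [LieModule ℂ HVir E]
  [AddCommGroup X] [Module ℂ X] [LieRingModule HVir X] [LieModule ℂ HVir X]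
  {cL c h hI : ℂ} {x : X} {α β F : ℂ} {b : Module.Basis ℤ ℂ E}

/-- A basis on which the algebra acts as on the basis `v_n` of an intermediate series module. -/
structure IsIntermediateBasis (α β F : ℂ) (b : Module.Basis ℤ ℂ E) : Prop where
  L : ∀ k n : ℤ, ⁅e (.L k), b n⁆ = (-((n : ℂ) + α + β + k * β)) • b (n + k)
  I : ∀ k n : ℤ, ⁅e (.I k), b n⁆ = F • b (n + k)

/-- The coefficients of the binomial series `(1 - z) ^ (-F / c)`. -/
def schurCoeff (c F : ℂ) (d : ℕ) : ℂ := ∏ j ∈ Finset.range d, (F + j * c) / (c * (j + 1))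

theorem schurCoeff_zero : schurCoeff c F 0 = 1 := by simp [schurCoeff]

/-- This is the recursion of `sum_schurVec` with every I(-k) replaced by -F. -/
theorem sum_schurCoeff (hc : c ≠ 0) (d : ℕ) :
    F * ∑ i ∈ Finset.range d, schurCoeff c F i = c * d * schurCoeff c F d := by
  induction d with
  | zero => simp
  | succ d ih =>
    have hd : (d : ℂ) + 1 ≠ 0 := Nat.cast_add_one_ne_zero d
    rw [Finset.sum_range_succ, mul_add, ih]
    have : schurCoeff c F (d + 1) = schurCoeff c F d * ((F + d * c) / (c * (d + 1))) :=
      Finset.prod_range_succ _ _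
    rw [this]
    push_cast
    field_simp
    ring

/-- The vectors whose products with the basis vectors eventually lie in a submodule. -/
def eventualSubmodule (hb : IsIntermediateBasis α β F b) (W : LieSubmodule ℂ HVir (E ⊗[ℂ] X))
    (l : Filter ℤ) (hl : ∀ k : ℤ, Tendsto (· + k) l l) : LieSubmodule ℂ HVir X :=
  submoduleOfStable
    { carrier := {w | ∀ᶠ n in l, b n ⊗ₜ[ℂ] w ∈ W}
      add_mem' := fun ha hb => by
        filter_upwards [ha, hb] with n h1 h2
        rw [TensorProduct.tmul_add]
        exact W.add_mem h1 h2
      zero_mem' := by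
        refine Eventually.of_forall fun n => ?_
        rw [TensorProduct.tmul_zero]
        exact W.zero_mem
      smul_mem' := fun a w ha => by
        filter_upwards [ha] with n h1
        rw [TensorProduct.tmul_smul]
        exact W.smul_mem a h1 }
    (fun k w hw => by
      -- Applying the mode to b_n ⊗ w also produces a multiple of b_{n+k} ⊗ w, which eventually lies
      -- in W because the filter is stable under translation.
      change ∀ᶠ n in l, b n ⊗ₜ[ℂ] w ∈ W at hw
      change ∀ᶠ n in l, b n ⊗ₜ[ℂ] ⁅e (.L k), w⁆ ∈ W
      filter_upwards [hw, hl k hw] with n h1 h2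
      have h3 := W.lie_mem (x := e (.L k)) h1
      rw [TensorProduct.LieModule.lie_tmul_right, hb.L, ← TensorProduct.smul_tmul'] at h3
      exact (W.add_mem_iff_right (W.smul_mem _ h2)).mp h3)
    (fun k w hw => by
      change ∀ᶠ n in l, b n ⊗ₜ[ℂ] w ∈ W at hw
      change ∀ᶠ n in l, b n ⊗ₜ[ℂ] ⁅e (.I k), w⁆ ∈ W
      filter_upwards [hw, hl k hw] with n h1 h2
      have h3 := W.lie_mem (x := e (.I k)) h1
      rw [TensorProduct.LieModule.lie_tmul_right, hb.I, ← TensorProduct.smul_tmul'] at h3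
      exact (W.add_mem_iff_right (W.smul_mem _ h2)).mp h3)

theorem mem_eventualSubmodule (hb : IsIntermediateBasis α β F b)
    (W : LieSubmodule ℂ HVir (E ⊗[ℂ] X)) (l : Filter ℤ) (hl : ∀ k : ℤ, Tendsto (· + k) l l)
    {w : X} : w ∈ eventualSubmodule hb W l hl ↔ ∀ᶠ n in l, b n ⊗ₜ[ℂ] w ∈ W := Iff.rfl

/-- Every vector is killed by all sufficiently high modes. -/
def IsSmooth (X : Type*) [AddCommGroup X] [LieRingModule HVir X] : Prop :=
  ∀ w : X, ∃ K : ℤ, ∀ n, K ≤ n → ⁅e (.L n), w⁆ = 0 ∧ ⁅e (.I n), w⁆ = 0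

theorem IsSmooth.exists_forall (hX : IsSmooth X) (S : Finset ℤ) (w : ℤ → X) :
    ∃ K : ℤ, ∀ n, K ≤ n → ∀ i ∈ S, ⁅e (.L n), w i⁆ = 0 ∧ ⁅e (.I n), w i⁆ = 0 := by
  choose K hK using fun i => hX (w i)
  obtain ⟨M, hM⟩ := (S.image K).exists_le
  exact ⟨M, fun n hn i hi => hK i n ((hM _ (Finset.mem_image_of_mem K hi)).trans hn)⟩

/-- A fixed high mode L(K) kills every `w n`, so on the sum shifted by s - K it acts through the
first factor alone, with coefficients affine in n. A multiple of the unweighted sum at shift s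
corrects them to n - a. -/
theorem eventually_sum_sub_smul_mem (hb : IsIntermediateBasis α β F b) (hX : IsSmooth X)
    (W : LieSubmodule ℂ HVir (E ⊗[ℂ] X)) (S : Finset ℤ) (w : ℤ → X)
    (hw : ∀ᶠ k in atTop, ∑ n ∈ S, b (n + k) ⊗ₜ[ℂ] w n ∈ W) (a : ℤ) :
    ∀ᶠ k in atTop, ∑ n ∈ S, b (n + k) ⊗ₜ[ℂ] (((n : ℂ) - a) • w n) ∈ W := by
  obtain ⟨K, hK⟩ := hX.exists_forall S w
  obtain ⟨K', hK'⟩ := eventually_atTop.mp hw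
  refine eventually_atTop.mpr ⟨max K' (K + K'), fun s hs => ?_⟩
  have h1 := W.lie_mem (x := e (.L K)) (hK' (s - K) (by omega))
  have h2 : ⁅e (.L K), ∑ n ∈ S, b (n + (s - K)) ⊗ₜ[ℂ] w n⁆ =
      ∑ n ∈ S, (-((n : ℂ) + (s - K) + α + β + K * β)) • b (n + s) ⊗ₜ[ℂ] w n := by
    rw [lie_sum]
    refine Finset.sum_congr rfl fun n hn => ?_
    rw [TensorProduct.LieModule.lie_tmul_right, (hK K le_rfl n hn).1, TensorProduct.tmul_zero,
      add_zero, hb.L, show n + (s - K) + K = n + s by ring, ← TensorProduct.smul_tmul']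
    push_cast
    rfl
  rw [h2] at h1
  have h3 : ∑ n ∈ S, b (n + s) ⊗ₜ[ℂ] (((n : ℂ) - a) • w n) =
      -(∑ n ∈ S, (-((n : ℂ) + (s - K) + α + β + K * β)) • b (n + s) ⊗ₜ[ℂ] w n) -
        ((s - K) + α + β + K * β + a) • ∑ n ∈ S, b (n + s) ⊗ₜ[ℂ] w n := by
    rw [Finset.smul_sum, ← Finset.sum_neg_distrib, ← Finset.sum_sub_distrib]
    refine Finset.sum_congr rfl fun n _ => ?_
    rw [TensorProduct.tmul_smul]
    module
  rw [h3]
  exact W.sub_mem (W.neg_mem h1) (W.smul_mem _ (hK' s (by omega)))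

/-- High modes I(k) translate a nonzero tensor of W to all large positions, because F ≠ 0. Weighting
by the product of n - a over the other indices a of the support then leaves a single term. -/
theorem exists_eventually_tmul_mem (hb : IsIntermediateBasis α β F b) (hF : F ≠ 0)
    (hX : IsSmooth X) {W : LieSubmodule ℂ HVir (E ⊗[ℂ] X)} (hW : W ≠ ⊥) :
    ∃ w : X, w ≠ 0 ∧ ∀ᶠ k in atTop, b k ⊗ₜ[ℂ] w ∈ W := by
  obtain ⟨t, htW, ht0⟩ : ∃ t ∈ W, t ≠ 0 := by
    by_contra! h
    exact hW ((LieSubmodule.eq_bot_iff W).mpr h)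
  obtain ⟨w, rfl⟩ := TensorProduct.eq_repr_basis_left b t
  have hw0 : w ≠ 0 := by
    rintro rfl
    exact ht0 Finsupp.sum_zero_index
  obtain ⟨m, hm⟩ := Finsupp.support_nonempty_iff.mpr hw0
  have hm0 : w m ≠ 0 := Finsupp.mem_support_iff.mp hm
  have h1 : ∀ᶠ k in atTop, ∑ n ∈ w.support, b (n + k) ⊗ₜ[ℂ] w n ∈ W := by
    obtain ⟨K, hK⟩ := hX.exists_forall w.support w
    refine eventually_atTop.mpr ⟨K, fun k hk => ?_⟩
    have h := W.lie_mem (x := e (.I k)) htW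
    have h2 : ⁅e (.I k), w.sum fun i n => b i ⊗ₜ[ℂ] n⁆ =
        F • ∑ n ∈ w.support, b (n + k) ⊗ₜ[ℂ] w n := by
      rw [Finsupp.sum, lie_sum, Finset.smul_sum]
      refine Finset.sum_congr rfl fun n hn => ?_
      rw [TensorProduct.LieModule.lie_tmul_right, (hK k hk n hn).2, TensorProduct.tmul_zero,
        add_zero, hb.I, TensorProduct.smul_tmul']
    rw [h2] at h
    have := W.smul_mem F⁻¹ h
    rwa [smul_smul, inv_mul_cancel₀ hF, one_smul] at this
  have h2 : ∀ T : Finset ℤ, ∀ᶠ k in atTop,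
      ∑ n ∈ w.support, b (n + k) ⊗ₜ[ℂ] ((∏ a ∈ T, ((n : ℂ) - a)) • w n) ∈ W := by
    intro T
    induction T using Finset.induction_on with
    | empty => simpa using h1
    | insert a T ha ih =>
      have := eventually_sum_sub_smul_mem hb hX W w.support _ ih a
      simpa only [Finset.prod_insert ha, mul_smul] using this
  refine ⟨(∏ a ∈ w.support.erase m, ((m : ℂ) - a)) • w m, smul_ne_zero ?_ hm0, ?_⟩
  · refine Finset.prod_ne_zero_iff.mpr fun a ha => ?_
    rw [sub_ne_zero]
    exact_mod_cast (Finset.ne_of_mem_erase ha).symm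
  · have h3 := (tendsto_atTop_add_const_right atTop (-m) tendsto_id).eventually
      (h2 (w.support.erase m))
    filter_upwards [h3] with k hk
    rw [Finset.sum_eq_single_of_mem m hm] at hk
    · rwa [id, show m + (k + -m) = k by ring] at hk
    · intro n hn hnm
      rw [Finset.prod_eq_zero (Finset.mem_erase.mpr ⟨hnm, hn⟩) (sub_self (n : ℂ)), zero_smul,
        TensorProduct.tmul_zero]

/-- Applying a mode of index -k to b_n ⊗ w costs a multiple of b_{n-k} ⊗ w, so the threshold rises
by exactly the degree of the word. -/
theorem tmul_mem_of_negReach (hb : IsIntermediateBasis α β F b)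
    {W : LieSubmodule ℂ HVir (E ⊗[ℂ] X)} {N : ℤ} (hN : ∀ n, N < n → b n ⊗ₜ[ℂ] x ∈ W) {j : ℤ} {w : X}
    (hw : NegReach (lineFamily x) j w) : ∀ n, N + j < n → b n ⊗ₜ[ℂ] w ∈ W := by
  induction hw with
  | @base j w hw =>
    intro n hn
    rw [lineFamily] at hw
    split_ifs at hw with hj
    · obtain ⟨a, rfl⟩ := Submodule.mem_span_singleton.mp hw
      rw [TensorProduct.tmul_smul]
      exact W.smul_mem a (hN n (by omega))
    · rw [(Submodule.mem_bot ℂ).mp hw, TensorProduct.tmul_zero]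
      exact W.zero_mem
  | L k hk _ ih =>
    intro n hn
    have h3 := W.lie_mem (x := e (.L (-k))) (ih n (by omega))
    rw [TensorProduct.LieModule.lie_tmul_right, hb.L, ← TensorProduct.smul_tmul'] at h3
    exact (W.add_mem_iff_right (W.smul_mem _ (ih _ (by omega)))).mp h3
  | I k hk _ ih =>
    intro n hn
    have h3 := W.lie_mem (x := e (.I (-k))) (ih n (by omega))
    rw [TensorProduct.LieModule.lie_tmul_right, hb.I, ← TensorProduct.smul_tmul'] at h3
    exact (W.add_mem_iff_right (W.smul_mem _ (ih _ (by omega)))).mp h3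

theorem tmul_mem_of_mem_negSpan (hb : IsIntermediateBasis α β F b)
    {W : LieSubmodule ℂ HVir (E ⊗[ℂ] X)} {N : ℤ} (hN : ∀ n, N < n → b n ⊗ₜ[ℂ] x ∈ W) {j : ℤ} {w : X}
    (hw : w ∈ negSpan (lineFamily x) j) {n : ℤ} (hn : N + j < n) : b n ⊗ₜ[ℂ] w ∈ W := by
  have : negSpan (lineFamily x) j ≤ (W : Submodule ℂ (E ⊗[ℂ] X)).comap
      (TensorProduct.mk ℂ E X (b n)) :=
    Submodule.span_le.mpr fun w hw => tmul_mem_of_negReach hb hN hw n hn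
  exact this hw

/-- For i < d the vector b_{N+d} ⊗ S_i lies in W. Applying I(i-d) and summing over i gives c d
b_{N+d} ⊗ S_d ≡ F Σ_{i<d} b_{N+i} ⊗ S_i modulo W. By `sum_schurCoeff` the solution is b_{N+d} ⊗ S_d
≡ g_d b_N ⊗ x; at d = p the left side is 0 while g_p ≠ 0. -/
theorem tmul_mem_of_forall_lt (hc : c ≠ 0) (hb : IsIntermediateBasis α β F b) {p : ℕ}
    (hxp : schurVec c x p = 0) (hF : ∀ j < p, F + j * c ≠ 0) {W : LieSubmodule ℂ HVir (E ⊗[ℂ] X)}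
    {N : ℤ} (hN : ∀ n, N < n → b n ⊗ₜ[ℂ] x ∈ W) : b N ⊗ₜ[ℂ] x ∈ W := by
  have key : ∀ d : ℕ, b (N + d) ⊗ₜ[ℂ] schurVec c x d - schurCoeff c F d • b N ⊗ₜ[ℂ] x ∈ W := by
    intro d
    induction d using Nat.strong_induction_on with
    | _ d ih =>
      rcases d.eq_zero_or_pos with rfl | hd
      · rw [schurVec_zero, schurCoeff_zero, one_smul, Nat.cast_zero, add_zero, sub_self]
        exact W.zero_mem
      · have hcd : c * d ≠ 0 := mul_ne_zero hc (by exact_mod_cast hd.ne')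
        have h1 : ∑ i ∈ Finset.range d, (b (N + d) ⊗ₜ[ℂ] ⁅e (.I ((i : ℤ) - d)), schurVec c x i⁆ +
            F • b (N + i) ⊗ₜ[ℂ] schurVec c x i) ∈ W := by
          refine W.sum_mem fun i hi => ?_
          rw [Finset.mem_range] at hi
          have hmem := tmul_mem_of_mem_negSpan hb hN (n := N + d)
            (schurVec_mem hc (le_negSpan 0 (mem_lineFamily_zero x)) i) (by omega)
          have h3 := W.lie_mem (x := e (.I ((i : ℤ) - d))) hmem
          rwa [TensorProduct.LieModule.lie_tmul_right, hb.I,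
            show N + (d : ℤ) + (i - d) = N + i by ring, add_comm, ← TensorProduct.smul_tmul'] at h3
        have h2 : ∑ i ∈ Finset.range d, (b (N + i) ⊗ₜ[ℂ] schurVec c x i -
            schurCoeff c F i • b N ⊗ₜ[ℂ] x) ∈ W :=
          W.sum_mem fun i hi => ih i (Finset.mem_range.mp hi)
        rw [Finset.sum_add_distrib, ← TensorProduct.tmul_sum, sum_schurVec hc,
          ← Finset.smul_sum] at h1
        rw [Finset.sum_sub_distrib, ← Finset.sum_smul] at h2
        have h3 := W.sub_mem (W.smul_mem F h2) h1
        rw [smul_sub, smul_smul, sum_schurCoeff hc, TensorProduct.tmul_smul,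
          show ∀ y : E ⊗[ℂ] X, y - (c * d * schurCoeff c F d) • b N ⊗ₜ[ℂ] x -
          ((-(c * d)) • b (N + d) ⊗ₜ[ℂ] schurVec c x d + y) =
          (c * d) • (b (N + d) ⊗ₜ[ℂ] schurVec c x d - schurCoeff c F d • b N ⊗ₜ[ℂ] x) from
            fun y => by module] at h3
        have h4 := W.smul_mem (c * d)⁻¹ h3
        rwa [smul_smul, inv_mul_cancel₀ hcd, one_smul] at h4
  have h := key p
  rw [hxp, TensorProduct.tmul_zero, zero_sub] at h
  have hg : schurCoeff c F p ≠ 0 := by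
    refine Finset.prod_ne_zero_iff.mpr fun j hj => ?_
    exact div_ne_zero (hF j (Finset.mem_range.mp hj))
      (mul_ne_zero hc (Nat.cast_add_one_ne_zero j))
  have h2 := W.smul_mem (schurCoeff c F p)⁻¹ (W.neg_mem h)
  rwa [neg_neg, smul_smul, inv_mul_cancel₀ hg, one_smul] at h2

theorem eq_top_of_forall_tmul_mem {W : LieSubmodule ℂ HVir (E ⊗[ℂ] X)}
    (h : ∀ n w, b n ⊗ₜ[ℂ] w ∈ W) : W = ⊤ := by
  refine eq_top_iff.mpr fun t _ => ?_
  induction t using TensorProduct.induction_on with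
  | zero => exact W.zero_mem
  | add s t hs ht => exact W.add_mem (hs trivial) (ht trivial)
  | tmul y w =>
    have : (⊤ : Submodule ℂ E) ≤ (W : Submodule ℂ (E ⊗[ℂ] X)).comap
        ((TensorProduct.mk ℂ E X).flip w) := by
      rw [← b.span_eq, Submodule.span_le]
      rintro _ ⟨n, rfl⟩
      exact h n w
    exact this (Submodule.mem_top (x := y))

theorem isIrreducible_tensor (hc : c ≠ 0) (hb : IsIntermediateBasis α β F b) (hF0 : F ≠ 0)
    (hX : IsSmooth X) [LieModule.IsIrreducible ℂ HVir X] (hx0 : x ≠ 0) {p : ℕ}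
    (hxp : schurVec c x p = 0) (hF : ∀ j < p, F + j * c ≠ 0) :
    LieModule.IsIrreducible ℂ HVir (E ⊗[ℂ] X) := by
  have hne : b 0 ⊗ₜ[ℂ] x ≠ 0 := by
    intro h0
    have h1 := TensorProduct.equivFinsuppOfBasisLeft_apply_tmul_apply b (b 0) x 0
    rw [h0, b.repr_self, Finsupp.single_eq_same, one_smul] at h1
    simp only [map_zero] at h1
    exact hx0 h1.symm
  have : Nontrivial (E ⊗[ℂ] X) := ⟨_, _, hne⟩
  refine LieModule.IsIrreducible.mk fun W hW => ?_
  have hshift : ∀ k : ℤ, Tendsto (· + k) (atTop : Filter ℤ) atTop :=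
    fun k => tendsto_atTop_add_const_right atTop k tendsto_id
  have hxN : ∃ N : ℤ, ∀ n, N ≤ n → b n ⊗ₜ[ℂ] x ∈ W := by
    obtain ⟨w, hw0, hw⟩ := exists_eventually_tmul_mem hb hF0 hX hW
    have htop : eventualSubmodule hb W atTop hshift = ⊤ :=
      (IsSimpleOrder.eq_bot_or_eq_top _).resolve_left
        fun h => hw0 ((LieSubmodule.eq_bot_iff _).mp h w hw)
    have : x ∈ eventualSubmodule hb W atTop hshift := htop ▸ LieSubmodule.mem_top x
    exact eventually_atTop.mp ((mem_eventualSubmodule hb W _ hshift).mp this)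
  obtain ⟨N, hN⟩ := hxN
  have hdesc : ∀ d : ℕ, ∀ n, N - d ≤ n → b n ⊗ₜ[ℂ] x ∈ W := by
    intro d
    induction d with
    | zero => simpa using hN
    | succ d ih =>
      intro n hn
      rcases hn.eq_or_lt with rfl | hn
      · exact tmul_mem_of_forall_lt hc hb hxp hF fun n hn => ih n (by push_cast at hn; omega)
      · exact ih n (by push_cast at hn; omega)
  -- With the filter `⊤`, "eventually" means "for all n", so the same construction spreads
  -- membership from x to the whole module.
  have hall : x ∈ eventualSubmodule hb W ⊤ fun k => tendsto_top := by
    rw [mem_eventualSubmodule, eventually_top]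
    exact fun n => hdesc (N - n).toNat n (by omega)
  have htop : eventualSubmodule hb W ⊤ (fun k => tendsto_top) = ⊤ :=
    (IsSimpleOrder.eq_bot_or_eq_top _).resolve_left
      fun h => hx0 ((LieSubmodule.eq_bot_iff _).mp h x hall)
  refine eq_top_of_forall_tmul_mem (b := b) fun n w => ?_
  have hw : w ∈ eventualSubmodule hb W ⊤ fun k => tendsto_top := htop ▸ LieSubmodule.mem_top w
  rw [mem_eventualSubmodule, eventually_top] at hw
  exact hw n

end

end HVir
end

/-! ### Subquotients of intermediate series modules -/

noncomputable section

set_option linter.unusedSectionVars false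

namespace IntermediateSeries
open HVir

variable (α β F : ℂ)

/-- The basis `v_n`. -/
def basis : Module.Basis ℤ ℂ (IntermediateSeries α β F) :=
  Module.Basis.ofRepr (LinearEquiv.refl ℂ (ℤ →₀ ℂ))

theorem isIntermediateBasis : IsIntermediateBasis α β F (basis α β F) :=
  ⟨fun _ _ => actionHom_e_v α β F _ _, fun _ _ => actionHom_e_v α β F _ _⟩

theorem hasLevel : HasLevel (IntermediateSeries α β F) 0 0 := by
  have key : ∀ i, (∀ n, basisAction α β F i n = 0) →
      ∀ w : IntermediateSeries α β F, ⁅e i, w⁆ = 0 := by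
    intro i hi w
    have : actionHom α β F (e i) = 0 := hom_ext α β F fun n => by
      rw [actionHom_e_v, hi, LinearMap.zero_apply]
    rw [bracket_def, this, LinearMap.zero_apply]
  refine ⟨fun w => ?_, fun w => ?_, key _ fun _ => rfl⟩ <;> rw [zero_smul]
  exacts [key _ (fun _ => rfl) w, key _ (fun _ => rfl) w]

end IntermediateSeries

namespace HVir

section

variable {E X Q : Type*} [AddCommGroup E] [Module ℂ E] [LieRingModule HVir E] [LieModule ℂ HVir E]
  [AddCommGroup X] [Module ℂ X] [LieRingModule HVir X] [LieModule ℂ HVir X]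
  [AddCommGroup Q] [Module ℂ Q] [LieRingModule HVir Q] [LieModule ℂ HVir Q]
  {cL c h hI : ℂ} {x : X} {α β F : ℂ} {b : Module.Basis ℤ ℂ E}

theorem HasLevel.lieSubmodule (hX : HasLevel X cL c) (N : LieSubmodule ℂ HVir X) :
    HasLevel N cL c :=
  ⟨fun w => Subtype.ext (hX.CL w), fun w => Subtype.ext (hX.CLI w),
    fun w => Subtype.ext (hX.CI w)⟩

theorem HasLevel.tensor {cL' c' : ℂ} (hE : HasLevel E cL' c') (hX : HasLevel X cL c) :
    HasLevel (E ⊗[ℂ] X) (cL' + cL) (c' + c) := by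
  refine ⟨fun w => ?_, fun w => ?_, fun w => ?_⟩
  all_goals
    induction w using TensorProduct.induction_on with
    | zero => simp
    | add s t hs ht => simp only [lie_add, smul_add, hs, ht, add_zero]
    | tmul y w => ?_
  · rw [TensorProduct.LieModule.lie_tmul_right, hE.CL, hX.CL, TensorProduct.tmul_smul,
      ← TensorProduct.smul_tmul', add_smul]
  · rw [TensorProduct.LieModule.lie_tmul_right, hE.CLI, hX.CLI, TensorProduct.tmul_smul,
      ← TensorProduct.smul_tmul', add_smul]
  · rw [TensorProduct.LieModule.lie_tmul_right, hE.CI, hX.CI, TensorProduct.tmul_zero,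
      TensorProduct.zero_tmul, add_zero]

/-- Submodules of an intermediate series module are graded. -/
theorem basis_mem_of_repr_ne_zero (hb : IsIntermediateBasis α β F b) (N : LieSubmodule ℂ HVir E)
    {w : E} (hw : w ∈ N) {m : ℤ} (hm : b.repr w m ≠ 0) : b m ∈ N := by
  -- The operator -L(0) - (α + β + a) multiplies b_n by n - a; taking a over all other indices of
  -- the support isolates b_m.
  have h1 : ∀ T : Finset ℤ,
      ∑ n ∈ (b.repr w).support, ((∏ a ∈ T, ((n : ℂ) - a)) * b.repr w n) • b n ∈ N := by
    intro T
    induction T using Finset.induction_on with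
    | empty =>
      have : ∑ n ∈ (b.repr w).support, b.repr w n • b n = w := b.linearCombination_repr w
      simpa [this] using hw
    | insert a T ha ih =>
      have h2 := N.lie_mem (x := e (.L 0)) ih
      have h3 := N.sub_mem (N.neg_mem h2) (N.smul_mem (α + β + a) ih)
      refine (congrArg (· ∈ N) ?_).mp h3
      rw [lie_sum, Finset.smul_sum, ← Finset.sum_neg_distrib, ← Finset.sum_sub_distrib]
      refine Finset.sum_congr rfl fun n _ => ?_
      rw [lie_smul, hb.L, add_zero, Finset.prod_insert ha]
      push_cast
      module
  have h2 := h1 ((b.repr w).support.erase m)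
  rw [Finset.sum_eq_single_of_mem m (Finsupp.mem_support_iff.mpr hm)] at h2
  · have h3 : (∏ a ∈ (b.repr w).support.erase m, ((m : ℂ) - a)) * b.repr w m ≠ 0 := by
      refine mul_ne_zero (Finset.prod_ne_zero_iff.mpr fun a ha => ?_) hm
      rw [sub_ne_zero]
      exact_mod_cast (Finset.ne_of_mem_erase ha).symm
    have := N.smul_mem ((∏ a ∈ (b.repr w).support.erase m, ((m : ℂ) - a)) * b.repr w m)⁻¹ h2
    rwa [smul_smul, inv_mul_cancel₀ h3, one_smul] at this
  · intro n hn hnm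
    rw [Finset.prod_eq_zero (Finset.mem_erase.mpr ⟨hnm, hn⟩) (sub_self (n : ℂ)), zero_mul,
      zero_smul]

theorem lieSubmodule_induction (hb : IsIntermediateBasis α β F b) (N : LieSubmodule ℂ HVir E)
    {P : N → Prop} (h0 : P 0) (hadd : ∀ y z, P y → P z → P (y + z))
    (hbasis : ∀ (a : ℂ) (n : ℤ) (hn : b n ∈ N), P (a • ⟨b n, hn⟩)) (y : N) : P y := by
  have key : ∀ S ⊆ (b.repr (y : E)).support, ∃ z : N, P z ∧
      (z : E) = ∑ n ∈ S, b.repr (y : E) n • b n := by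
    intro S
    induction S using Finset.induction_on with
    | empty => exact fun _ => ⟨0, h0, by simp⟩
    | insert a S ha ih =>
      intro hS
      obtain ⟨z, hz, hz'⟩ := ih fun i hi => hS (Finset.mem_insert_of_mem hi)
      have hmem := basis_mem_of_repr_ne_zero hb N y.2
        (Finsupp.mem_support_iff.mp (hS (Finset.mem_insert_self a S)))
      refine ⟨_, hadd _ _ (hbasis (b.repr (y : E) a) a hmem) hz, ?_⟩
      rw [Finset.sum_insert ha, ← hz']
      rfl
  obtain ⟨z, hz, hz'⟩ := key _ subset_rfl
  have : ∑ n ∈ (b.repr (y : E)).support, b.repr (y : E) n • b n = y := b.linearCombination_repr _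
  rw [this] at hz'
  rwa [← Subtype.ext hz']

/-- Submodules are graded, and for F ≠ 0 the modes I(k) carry any b_m to any b_n. -/
theorem eq_top_of_ne_bot (hb : IsIntermediateBasis α β F b) (hF : F ≠ 0)
    {N : LieSubmodule ℂ HVir E} (hN : N ≠ ⊥) : N = ⊤ := by
  obtain ⟨t, htN, ht0⟩ : ∃ t ∈ N, t ≠ 0 := by
    by_contra! h
    exact hN ((LieSubmodule.eq_bot_iff N).mpr h)
  obtain ⟨m, hm⟩ : ∃ m, b.repr t m ≠ 0 := by
    by_contra! h
    exact ht0 (b.ext_elem fun i => by rw [h i, map_zero, Finsupp.zero_apply])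
  have hm' := basis_mem_of_repr_ne_zero hb N htN hm
  refine eq_top_iff.mpr fun y _ => ?_
  have : (⊤ : Submodule ℂ E) ≤ N := by
    rw [← b.span_eq, Submodule.span_le]
    rintro _ ⟨n, rfl⟩
    have h1 := N.smul_mem F⁻¹ (N.lie_mem (x := e (.I (n - m))) hm')
    rwa [hb.I, smul_smul, inv_mul_cancel₀ hF, one_smul, add_sub_cancel] at h1
  exact this trivial

/-- For `F ≠ 0` the only nonzero subquotient of an intermediate series module is itself. -/
theorem exists_basis_of_surjective (hb : IsIntermediateBasis α β F b) (hF : F ≠ 0)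
    {N : LieSubmodule ℂ HVir E} (π : N →ₗ⁅ℂ,HVir⁆ Q) (hπ : Function.Surjective π) [Nontrivial Q] :
    ∃ b' : Module.Basis ℤ ℂ Q, IsIntermediateBasis α β F b' := by
  obtain ⟨q, hq⟩ := exists_ne (0 : Q)
  obtain ⟨y, rfl⟩ := hπ q
  have hN : N = ⊤ := by
    refine eq_top_of_ne_bot hb hF fun h => hq ?_
    have : y = 0 := Subtype.ext ((LieSubmodule.eq_bot_iff N).mp h y y.2)
    rw [this, map_zero]
  subst hN
  have hker : ∀ z : (⊤ : LieSubmodule ℂ HVir E), π z = 0 → z = 0 := by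
    intro z hz
    by_contra hz0
    have htop : π.ker.map (⊤ : LieSubmodule ℂ HVir E).incl = ⊤ := by
      refine eq_top_of_ne_bot hb hF fun h => hz0 (Subtype.ext ?_)
      exact (LieSubmodule.eq_bot_iff _).mp h z
        (LieSubmodule.mem_map_of_mem (LieModuleHom.mem_ker.mpr hz))
    have : (y : E) ∈ π.ker.map (⊤ : LieSubmodule ℂ HVir E).incl := by
      rw [htop]
      exact LieSubmodule.mem_top _
    obtain ⟨y', hy', hyy⟩ := (LieSubmodule.mem_map _).mp this
    rw [show y' = y from Subtype.ext hyy] at hy'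
    exact hq (LieModuleHom.mem_ker.mp hy')
  let φ : E →ₗ[ℂ] Q :=
    (π : (⊤ : LieSubmodule ℂ HVir E) →ₗ[ℂ] Q).comp
      (LinearMap.codRestrict ((⊤ : LieSubmodule ℂ HVir E) : Submodule ℂ E) LinearMap.id
        fun _ => trivial)
  have hφ : ∀ y, φ y = π ⟨y, trivial⟩ := fun _ => rfl
  have hφlie : ∀ (x : HVir) y, φ ⁅x, y⁆ = ⁅x, φ y⁆ := fun x y => by
    rw [hφ, hφ, ← LieModuleHom.map_lie]
    rfl
  have hbij : Function.Bijective φ := by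
    refine ⟨(injective_iff_map_eq_zero φ).mpr fun y hy => ?_, fun q => ?_⟩
    · exact congrArg Subtype.val (hker _ hy)
    · obtain ⟨y, rfl⟩ := hπ q
      exact ⟨y, rfl⟩
  refine ⟨b.map (LinearEquiv.ofBijective φ hbij), fun k n => ?_, fun k n => ?_⟩
  · simp only [Module.Basis.map_apply, LinearEquiv.ofBijective_apply]
    rw [← hφlie, hb.L, map_smul]
  · simp only [Module.Basis.map_apply, LinearEquiv.ofBijective_apply]
    rw [← hφlie, hb.I, map_smul]

/-- At level zero, L(0) and I(0) are multiples of [L(1),L(-1)] and [L(1),I(-1)]. -/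
theorem isTrivial_of_basis (hQ : HasLevel Q 0 0)
    (h : ∀ k : ℤ, k ≠ 0 → ∀ q : Q, ⁅e (.L k), q⁆ = 0 ∧ ⁅e (.I k), q⁆ = 0) :
    LieModule.IsTrivial HVir Q := by
  refine ⟨fun x q => ?_⟩
  have hL0 : ⁅e (.L 0), q⁆ = 0 := by
    have h1 := hQ.L_L 1 (-1) q
    rw [(h (-1) (by omega) _).1, (h (-1) (by omega) _).1, (h 1 (by omega) _).1, add_neg_cancel] at h1
    simp only [mul_zero, zero_smul, add_zero, zero_add] at h1
    refine (smul_eq_zero.mp h1.symm).resolve_left ?_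
    norm_num
  have hI0 : ⁅e (.I 0), q⁆ = 0 := by
    have h1 := hQ.L_I 1 (-1) q
    rw [(h (-1) (by omega) _).2, (h (-1) (by omega) _).2, (h 1 (by omega) _).1, add_neg_cancel] at h1
    simp only [mul_zero, zero_smul, sub_zero, zero_sub] at h1
    refine (smul_eq_zero.mp (neg_eq_zero.mp h1.symm)).resolve_left ?_
    norm_num
  induction x using induct with
  | h0 => rw [zero_lie]
  | hadd x y hx hy => rw [add_lie, hx, hy, add_zero]
  | hsmul a i =>
    rw [smul_lie]
    suffices ⁅e i, q⁆ = 0 by rw [this, smul_zero]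
    cases i with
    | L n =>
      rcases eq_or_ne n 0 with rfl | hn
      exacts [hL0, (h n hn q).1]
    | I n =>
      rcases eq_or_ne n 0 with rfl | hn
      exacts [hI0, (h n hn q).2]
    | CL => rw [hQ.CL, zero_smul]
    | CLI => rw [hQ.CLI, zero_smul]
    | CI => rw [hQ.CI]

/-- A nontrivial subquotient of an intermediate series module has two nonzero graded parts. -/
theorem exists_lt_of_not_isTrivial (hb : IsIntermediateBasis α β F b) (hE : HasLevel E 0 0)
    {N : LieSubmodule ℂ HVir E} (π : N →ₗ⁅ℂ,HVir⁆ Q) (hπ : Function.Surjective π)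
    (htriv : ¬ LieModule.IsTrivial HVir Q) :
    ∃ (m n : ℤ) (hm : b m ∈ N) (hn : b n ∈ N), m < n ∧ π ⟨b m, hm⟩ ≠ 0 ∧ π ⟨b n, hn⟩ ≠ 0 := by
  by_contra! hcon
  have hcon' : ∀ (m n : ℤ) (hm : b m ∈ N) (hn : b n ∈ N), m ≠ n → π ⟨b m, hm⟩ ≠ 0 →
      π ⟨b n, hn⟩ = 0 := by
    intro m n hm hn hmn hm0
    rcases lt_or_gt_of_ne hmn with hlt | hlt
    · exact hcon m n hm hn hlt hm0
    · by_contra hn0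
      exact hm0 (hcon n m hn hm hlt hn0)
  -- If at most one graded piece survives in Q, a mode of nonzero index maps it to a piece that
  -- vanishes.
  have key : ∀ (x : HVir) (s : ℤ → ℂ) (k : ℤ), k ≠ 0 → (∀ n, ⁅x, b n⁆ = s n • b (n + k)) →
      ∀ q : Q, ⁅x, q⁆ = 0 := by
    intro x s k hk hx q
    obtain ⟨y, rfl⟩ := hπ q
    rw [← LieModuleHom.map_lie]
    induction y using lieSubmodule_induction hb with
    | h0 => rw [lie_zero, map_zero]
    | hadd y z hy hz => rw [lie_add, map_add, hy, hz, add_zero]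
    | hbasis a n hn =>
      rw [lie_smul, map_smul]
      rcases eq_or_ne (π ⟨b n, hn⟩) 0 with h0 | h0
      · rw [LieModuleHom.map_lie, h0, lie_zero, smul_zero]
      · have hmem : s n • b (n + k) ∈ N := by
          rw [← hx]
          exact N.lie_mem hn
        have heq : ⁅x, (⟨b n, hn⟩ : N)⁆ = ⟨s n • b (n + k), hmem⟩ := Subtype.ext (hx n)
        rw [heq]
        rcases eq_or_ne (s n) 0 with hs | hs
        · rw [show (⟨s n • b (n + k), hmem⟩ : N) = 0 from Subtype.ext (by simp [hs]), map_zero,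
            smul_zero]
        · have hmem' : b (n + k) ∈ N := by
            have := N.smul_mem (s n)⁻¹ hmem
            rwa [smul_smul, inv_mul_cancel₀ hs, one_smul] at this
          rw [show (⟨s n • b (n + k), hmem⟩ : N) = s n • ⟨b (n + k), hmem'⟩ from rfl, map_smul,
            hcon' n (n + k) hn hmem' (by omega) h0, smul_zero, smul_zero]
  exact htriv (isTrivial_of_basis ((hE.lieSubmodule N).of_surjective π hπ) fun k hk q =>
    ⟨key _ _ k hk (hb.L k) q, key _ _ k hk (hb.I k) q⟩)

end

end HVir
end

/-! ### Word filtrations, Euler operators and triangular systems -/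

noncomputable section

section Filtration

variable {X : Type*} [AddCommGroup X] [Module ℂ X]

/-- Words in the letters `A i`, `i ∈ S`, and the operators in `B`, applied to a vector, with fewer
than a given number of letters `A i`. -/
inductive FiltWord (A : ℕ → Module.End ℂ X) (S : Set ℕ) (B : Set (Module.End ℂ X)) (x : X) :
    ℕ → X → Prop
  | base (s : ℕ) : FiltWord A S B x (s + 1) x
  | up {i s : ℕ} {w : X} : i ∈ S → FiltWord A S B x s w → FiltWord A S B x (s + 1) (A i w)
  | same {b : Module.End ℂ X} {s : ℕ} {w : X} : b ∈ B → FiltWord A S B x s w →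
      FiltWord A S B x s (b w)

/-- The span of the words with fewer than `s` letters. -/
def wordFilt (A : ℕ → Module.End ℂ X) (S : Set ℕ) (B : Set (Module.End ℂ X)) (x : X) (s : ℕ) :
    Submodule ℂ X := Submodule.span ℂ {w | FiltWord A S B x s w}

variable {A : ℕ → Module.End ℂ X} {S : Set ℕ} {B : Set (Module.End ℂ X)} {x : X}

theorem FiltWord.mono {s t : ℕ} (hst : s ≤ t) {w : X} (hw : FiltWord A S B x s w) :
    FiltWord A S B x t w := by
  induction hw generalizing t with
  | base s =>
    obtain ⟨t, rfl⟩ : ∃ t', t = t' + 1 := ⟨t - 1, by omega⟩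
    exact FiltWord.base t
  | up hi _ ih =>
    obtain ⟨t, rfl⟩ : ∃ t', t = t' + 1 := ⟨t - 1, by omega⟩
    exact FiltWord.up hi (ih (by omega))
  | same hb _ ih => exact FiltWord.same hb (ih hst)

theorem FiltWord.mono_set {S' : Set ℕ} (hS : S ⊆ S') {s : ℕ} {w : X}
    (hw : FiltWord A S B x s w) : FiltWord A S' B x s w := by
  induction hw with
  | base s => exact FiltWord.base s
  | up hi _ ih => exact FiltWord.up (hS hi) ih
  | same hb _ ih => exact FiltWord.same hb ih

theorem FiltWord.pos {s : ℕ} {w : X} (hw : FiltWord A S B x s w) : 0 < s := by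
  induction hw with
  | base s => omega
  | up => omega
  | same _ _ ih => exact ih

theorem wordFilt_mono {s t : ℕ} (hst : s ≤ t) : wordFilt A S B x s ≤ wordFilt A S B x t :=
  Submodule.span_mono fun _ hw => FiltWord.mono hst hw

theorem base_mem_wordFilt (s : ℕ) : x ∈ wordFilt A S B x (s + 1) :=
  Submodule.subset_span (FiltWord.base s)

theorem map_mem_of_mem_span {T : Module.End ℂ X} {Y : Submodule ℂ X} {s : Set X}
    (h : ∀ w ∈ s, T w ∈ Y) {w : X} (hw : w ∈ Submodule.span ℂ s) : T w ∈ Y := by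
  have : Submodule.span ℂ s ≤ Y.comap T := Submodule.span_le.mpr h
  exact this hw

theorem up_mem_wordFilt {i s : ℕ} (hi : i ∈ S) {w : X} (hw : w ∈ wordFilt A S B x s) :
    A i w ∈ wordFilt A S B x (s + 1) :=
  map_mem_of_mem_span (fun _ h => Submodule.subset_span (FiltWord.up hi h)) hw

theorem same_mem_wordFilt {b : Module.End ℂ X} {s : ℕ} (hb : b ∈ B) {w : X}
    (hw : w ∈ wordFilt A S B x s) : b w ∈ wordFilt A S B x s :=
  map_mem_of_mem_span (fun _ h => Submodule.subset_span (FiltWord.same hb h)) hw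

/-- A word uses finitely many letters, so the Euler operator can be taken as a finite sum. -/
theorem FiltWord.exists_finset {s : ℕ} {w : X} (hw : FiltWord A S B x s w) :
    ∃ T : Finset ℕ, ↑T ⊆ S ∧ FiltWord A T B x s w := by
  classical
  induction hw with
  | base s => exact ⟨∅, by simp, FiltWord.base s⟩
  | @up i s w hi _ ih =>
    obtain ⟨T, hT, h⟩ := ih
    refine ⟨insert i T, ?_, FiltWord.up (by simp) (h.mono_set (by simp))⟩
    rw [Finset.coe_insert]
    exact Set.insert_subset hi hT
  | same hb _ ih =>
    obtain ⟨T, hT, h⟩ := ih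
    exact ⟨T, hT, FiltWord.same hb h⟩

theorem exists_finset_mem_wordFilt {s : ℕ} {w : X} (hw : w ∈ wordFilt A S B x s) :
    ∃ T : Finset ℕ, ↑T ⊆ S ∧ w ∈ wordFilt A T B x s := by
  classical
  refine Submodule.span_induction
    (p := fun w _ => ∃ T : Finset ℕ, ↑T ⊆ S ∧ w ∈ wordFilt A T B x s) ?_ ?_ ?_ ?_ hw
  · intro w hw
    obtain ⟨T, hT, h⟩ := FiltWord.exists_finset hw
    exact ⟨T, hT, Submodule.subset_span h⟩
  · exact ⟨∅, by simp, Submodule.zero_mem _⟩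
  · rintro a b _ _ ⟨T, hT, ha⟩ ⟨T', hT', hb⟩
    have hmono : ∀ {T₁ T₂ : Finset ℕ}, T₁ ⊆ T₂ →
        wordFilt A (T₁ : Set ℕ) B x s ≤ wordFilt A (T₂ : Set ℕ) B x s := fun h =>
      Submodule.span_mono fun _ hw => FiltWord.mono_set (Finset.coe_subset.mpr h) hw
    refine ⟨T ∪ T', ?_, Submodule.add_mem _ (hmono Finset.subset_union_left ha)
      (hmono Finset.subset_union_right hb)⟩
    rw [Finset.coe_union]
    exact Set.union_subset hT hT'
  · rintro a b _ ⟨T, hT, hb⟩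
    exact ⟨T, hT, Submodule.smul_mem _ a hb⟩

/-- The Euler operator of a system of approximate partial derivatives multiplies a word by its
length, up to shorter words. -/
theorem FiltWord.euler_sub_mem {T : Finset ℕ} (hT : ↑T ⊆ S) {D : ℕ → Module.End ℂ X}
    (h0 : ∀ k ∈ T, D k x = 0) (hb : ∀ k ∈ T, ∀ b ∈ B, ∀ w, D k (b w) = b (D k w))
    (hA : ∀ k ∈ T, ∀ i ∈ T, ∀ s, ∀ w ∈ wordFilt A S B x (s + 1),
      D k (A i w) - A i (D k w) - (if i = k then w else 0) ∈ wordFilt A S B x s)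
    (hAA : ∀ k ∈ T, ∀ i ∈ T, ∀ s, ∀ w ∈ wordFilt A S B x (s + 1),
      A k (A i (D k w)) - A i (A k (D k w)) ∈ wordFilt A S B x (s + 1))
    (hAb : ∀ k ∈ T, ∀ b ∈ B, ∀ s, ∀ w ∈ wordFilt A S B x (s + 1),
      A k (b (D k w)) - b (A k (D k w)) ∈ wordFilt A S B x s)
    {s : ℕ} {w : X} (hw : FiltWord A T B x (s + 1) w) :
    ∑ k ∈ T, A k (D k w) - (s : ℂ) • w ∈ wordFilt A S B x s := by
  obtain ⟨r, hr⟩ : ∃ r, r = s + 1 := ⟨_, rfl⟩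
  rw [← hr] at hw
  induction hw generalizing s with
  | base r =>
    obtain rfl : r = s := by omega
    rw [Finset.sum_eq_zero fun k hk => by rw [h0 k hk, map_zero], zero_sub]
    refine Submodule.neg_mem _ ?_
    cases r with
    | zero => simp
    | succ r => exact Submodule.smul_mem _ _ (base_mem_wordFilt r)
  | @up i r w hi hw ih =>
    obtain rfl : r = s := by omega
    obtain ⟨s, rfl⟩ : ∃ s, r = s + 1 := ⟨r - 1, by have := hw.pos; omega⟩
    have hw' : w ∈ wordFilt A S B x (s + 1) := Submodule.subset_span (hw.mono_set hT)
    -- The new letter raises the count by one through the term k = i; the other two sums collect the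
    -- failure of the A's to commute and of D to be an exact derivative.
    have h1 : ∑ k ∈ T, A k (D k (A i w)) - ((s + 1 : ℕ) : ℂ) • A i w =
        A i (∑ k ∈ T, A k (D k w) - (s : ℂ) • w) +
        ∑ k ∈ T, (A k (A i (D k w)) - A i (A k (D k w))) +
        ∑ k ∈ T, A k (D k (A i w) - A i (D k w) - (if i = k then w else 0)) := by
      have h2 : A i w = ∑ k ∈ T, A k (if i = k then w else 0) := by
        rw [Finset.sum_eq_single_of_mem i hi]
        · rw [if_pos rfl]
        · intro k _ hk
          rw [if_neg hk.symm, map_zero]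
      rw [map_sub, map_sum, map_smul]
      simp only [map_sub, Finset.sum_sub_distrib]
      rw [← h2]
      push_cast
      module
    rw [h1]
    refine Submodule.add_mem _ (Submodule.add_mem _ (up_mem_wordFilt (hT hi) (ih rfl))
      (Submodule.sum_mem _ fun k hk => hAA k hk i hi s w hw'))
      (Submodule.sum_mem _ fun k hk => up_mem_wordFilt (hT hk) (hA k hk i hi s w hw'))
  | @same b r w hbB hw ih =>
    subst hr
    have hw' : w ∈ wordFilt A S B x (s + 1) := Submodule.subset_span (hw.mono_set hT)
    have h1 : ∑ k ∈ T, A k (D k (b w)) - (s : ℂ) • b w =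
        b (∑ k ∈ T, A k (D k w) - (s : ℂ) • w) +
        ∑ k ∈ T, (A k (b (D k w)) - b (A k (D k w))) := by
      rw [map_sub, map_sum, map_smul, Finset.sum_sub_distrib,
        Finset.sum_congr rfl fun k hk => by rw [hb k hk b hbB w]]
      module
    rw [h1]
    exact Submodule.add_mem _ (same_mem_wordFilt hbB (ih rfl))
      (Submodule.sum_mem _ fun k hk => hAb k hk b hbB s w hw')

/-- A vector killed by Euler operators lies in the lowest part of the filtration. -/
theorem mem_wordFilt_one_of_euler {w₀ : X}
    (h : ∀ T : Finset ℕ, ↑T ⊆ S → ∃ E : Module.End ℂ X, E w₀ = 0 ∧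
      ∀ s w, FiltWord A T B x (s + 1) w → E w - (s : ℂ) • w ∈ wordFilt A S B x s)
    {s : ℕ} (hw₀ : w₀ ∈ wordFilt A S B x s) : w₀ ∈ wordFilt A S B x 1 := by
  induction s with
  | zero => exact wordFilt_mono (Nat.zero_le 1) hw₀
  | succ s ih =>
    rcases s.eq_zero_or_pos with rfl | hs
    · exact hw₀
    refine ih ?_
    obtain ⟨T, hT, hwT⟩ := exists_finset_mem_wordFilt hw₀
    obtain ⟨E, hE0, hE⟩ := h T hT
    have h1 : (E - (s : ℂ) • LinearMap.id : Module.End ℂ X) w₀ ∈ wordFilt A S B x s :=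
      map_mem_of_mem_span (fun w hw => hE s w hw) hwT
    rw [LinearMap.sub_apply, hE0, zero_sub, LinearMap.smul_apply, LinearMap.id_apply,
      Submodule.neg_mem_iff] at h1
    exact (Submodule.smul_mem_iff _ (Nat.cast_ne_zero.mpr hs.ne')).mp h1

/-- The solution of an upper triangular system of operators. -/
def triSolve (a : ℕ → ℂ) (E : ℕ → Module.End ℂ X) (C : ℕ → ℕ → Module.End ℂ X) (K k : ℕ) :
    Module.End ℂ X :=
  (a k)⁻¹ • (E k - ∑ t : Fin (K - k), C k (k + 1 + t) * triSolve a E C K (k + 1 + t))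
termination_by K - k
decreasing_by
  have := t.2
  omega

theorem triSolve_eq (a : ℕ → ℂ) (E : ℕ → Module.End ℂ X) (C : ℕ → ℕ → Module.End ℂ X) (K k : ℕ) :
    triSolve a E C K k =
      (a k)⁻¹ • (E k - ∑ i ∈ Finset.Ico (k + 1) (K + 1), C k i * triSolve a E C K i) := by
  rw [triSolve, Finset.sum_Ico_eq_sum_range, ← Finset.sum_range fun t =>
    C k (k + 1 + t) * triSolve a E C K (k + 1 + t), show K + 1 - (k + 1) = K - k by omega]

theorem downward_induction {K : ℕ} {P : ℕ → Prop}
    (h : ∀ k, (∀ i ∈ Finset.Ico (k + 1) (K + 1), P i) → P k) (k : ℕ) : P k := by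
  induction hd : K - k using Nat.strong_induction_on generalizing k with
  | _ d ih =>
    refine h k fun i hi => ?_
    rw [Finset.mem_Ico] at hi
    exact ih (K - i) (by omega) i rfl

end Filtration
end

/-! ### Positive modes I(k) as derivatives in the L(-k) -/

noncomputable section

set_option linter.unusedSectionVars false

namespace HVir

variable {X : Type*} [AddCommGroup X] [Module ℂ X] [LieRingModule HVir X] [LieModule ℂ HVir X]
  {cL c h : ℂ} {x : X} {p : ℕ}

theorem HasLevel.I_L (hX : HasLevel X cL c) (m n : ℤ) (w : X) :
    ⁅e (.I m), ⁅e (.L n), w⁆⁆ = ⁅e (.L n), ⁅e (.I m), w⁆⁆ + (m : ℂ) • ⁅e (.I (n + m)), w⁆ +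
      ((if n = -m then (n : ℂ) ^ 2 + n else 0) * c) • w := by
  rw [hX.L_I]
  module

/-- The negative modes `I(-i)`. -/
def negI (X : Type*) [AddCommGroup X] [Module ℂ X] [LieRingModule HVir X] [LieModule ℂ HVir X] :
    Set (Module.End ℂ X) := {b | ∃ i : ℕ, 0 < i ∧ b = act (e (.I (-i)))}

/-- The span of the vectors obtained with fewer than `s` negative modes `L(-i)` and any number of
negative modes `I(-i)`. -/
def viraFilt (x : X) (s : ℕ) : Submodule ℂ X :=
  wordFilt (fun i : ℕ => act (e (.L (-i)))) {i | 0 < i} (negI X) x s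

theorem L_mem_viraFilt {i s : ℕ} (hi : 0 < i) {w : X} (hw : w ∈ viraFilt x s) :
    ⁅e (.L (-i)), w⁆ ∈ viraFilt x (s + 1) := up_mem_wordFilt (i := i) hi hw

theorem viraFilt_mono {s t : ℕ} (hst : s ≤ t) : viraFilt x s ≤ viraFilt x t := wordFilt_mono hst

/-- A bracket of I(n) with L(-i) contains no L, so I(n) never lengthens a word. For n > 0 it kills x
and commutes with the I's, so in every surviving term it has absorbed a letter L. -/
theorem I_mem_viraFilt_aux (hX : HasLevel X cL c) {hI : ℂ} (hx : IsHighestWeight cL 0 c h hI x)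
    {s : ℕ} {w : X} (hw : w ∈ viraFilt x s) (n : ℤ) :
    ⁅e (.I n), w⁆ ∈ viraFilt x s ∧ (0 < n → ⁅e (.I n), w⁆ ∈ viraFilt x (s - 1)) := by
  have neg : ∀ {s : ℕ} {w : X} {k : ℤ}, k < 0 → w ∈ viraFilt x s → ⁅e (.I k), w⁆ ∈ viraFilt x s := by
    intro s w k hk hw
    obtain ⟨i, rfl⟩ : ∃ i : ℕ, k = -i := ⟨k.natAbs, by omega⟩
    exact same_mem_wordFilt (B := negI X) (b := act (e (.I (-i)))) ⟨i, by omega, rfl⟩ hw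
  have key : ∀ w, FiltWord (fun i : ℕ => (act (e (.L (-i))) : X →ₗ[ℂ] X)) {i | 0 < i} (negI X) x s w → ∀ n : ℤ,
      ⁅e (.I n), w⁆ ∈ viraFilt x s ∧ (0 < n → ⁅e (.I n), w⁆ ∈ viraFilt x (s - 1)) := by
    clear hw
    intro w hw
    induction hw with
    | base s =>
      intro n
      rcases lt_trichotomy n 0 with hn | rfl | hn
      · exact ⟨neg hn (base_mem_wordFilt s), fun h => by omega⟩
      · rw [hx.I_zero]
        exact ⟨Submodule.smul_mem _ _ (base_mem_wordFilt s), fun h => by omega⟩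
      · rw [hx.I_pos n hn]
        exact ⟨Submodule.zero_mem _, fun _ => Submodule.zero_mem _⟩
    | @up i s w hi hw ih =>
      intro n
      have hw' : w ∈ viraFilt x s := Submodule.subset_span hw
      have hrest : (n : ℂ) • ⁅e (.I (-(i : ℤ) + n)), w⁆ +
          ((if -(i : ℤ) = -n then ((-(i : ℤ) : ℤ) : ℂ) ^ 2 + (-(i : ℤ) : ℤ) else 0) * c) • w ∈
          viraFilt x s :=
        Submodule.add_mem _ (Submodule.smul_mem _ _ (ih _).1) (Submodule.smul_mem _ _ hw')
      rw [act_apply, hX.I_L, add_assoc, Nat.add_sub_cancel]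
      refine ⟨Submodule.add_mem _ (L_mem_viraFilt hi (ih n).1) (viraFilt_mono (Nat.le_succ s) hrest),
        fun hn => Submodule.add_mem _ ?_ hrest⟩
      have := L_mem_viraFilt hi ((ih n).2 hn)
      rwa [Nat.sub_add_cancel hw.pos] at this
    | @same b s w hb hw ih =>
      obtain ⟨i, hi, rfl⟩ := hb
      intro n
      rw [act_apply, hX.I_I]
      exact ⟨neg (by omega) (ih n).1, fun hn => neg (by omega) ((ih n).2 hn)⟩
  refine Submodule.span_induction (p := fun w _ => ⁅e (.I n), w⁆ ∈ viraFilt x s ∧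
    (0 < n → ⁅e (.I n), w⁆ ∈ viraFilt x (s - 1))) (fun w hw => key w hw n) ?_ ?_ ?_ hw
  · rw [lie_zero]
    exact ⟨Submodule.zero_mem _, fun _ => Submodule.zero_mem _⟩
  · intro a b _ _ ha hb
    rw [lie_add]
    exact ⟨Submodule.add_mem _ ha.1 hb.1, fun hn => Submodule.add_mem _ (ha.2 hn) (hb.2 hn)⟩
  · intro a b _ hb
    rw [lie_smul]
    exact ⟨Submodule.smul_mem _ _ hb.1, fun hn => Submodule.smul_mem _ _ (hb.2 hn)⟩

theorem I_mem_viraFilt (hX : HasLevel X cL c) {hI : ℂ} (hx : IsHighestWeight cL 0 c h hI x)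
    {s : ℕ} {w : X} (hw : w ∈ viraFilt x s) (n : ℤ) : ⁅e (.I n), w⁆ ∈ viraFilt x s :=
  (I_mem_viraFilt_aux hX hx hw n).1

theorem I_pos_mem_viraFilt (hX : HasLevel X cL c) {hI : ℂ} (hx : IsHighestWeight cL 0 c h hI x)
    {s : ℕ} {w : X} (hw : w ∈ viraFilt x (s + 1)) {n : ℤ} (hn : 0 < n) :
    ⁅e (.I n), w⁆ ∈ viraFilt x s :=
  (I_mem_viraFilt_aux hX hx hw n).2 hn

/-- The approximate partial derivatives with respect to the modes `L(-k)`. -/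
def viraDer (X : Type*) [AddCommGroup X] [Module ℂ X] [LieRingModule HVir X] [LieModule ℂ HVir X]
    (c : ℂ) (p K : ℕ) (k : ℕ) : Module.End ℂ X :=
  triSolve (fun k => k * c * (p + k)) (fun k => act (e (.I k)))
    (fun k i => (k : ℂ) • (act (e (.I (k - i))) : Module.End ℂ X)) K k

/-- This pivot is the scalar by which [I(k), L(-k)] acts: k · c(p+1) from I(0) plus (k²-k)c from the
centre. -/
theorem mul_mul_add_ne_zero (hc : c ≠ 0) {k : ℕ} (hk : 0 < k) : (k : ℂ) * c * (p + k) ≠ 0 := by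
  have h1 : (k : ℂ) ≠ 0 := Nat.cast_ne_zero.mpr hk.ne'
  have h2 : (p : ℂ) + k ≠ 0 := by
    rw [← Nat.cast_add]
    exact Nat.cast_ne_zero.mpr (by omega)
  exact mul_ne_zero (mul_ne_zero h1 hc) h2

theorem smul_viraDer (hc : c ≠ 0) (K : ℕ) {k : ℕ} (hk : 0 < k) (w : X) :
    ((k : ℂ) * c * (p + k)) • viraDer X c p K k w = ⁅e (.I k), w⁆ -
      ∑ i ∈ Finset.Ico (k + 1) (K + 1), (k : ℂ) • ⁅e (.I (k - i)), viraDer X c p K i w⁆ := by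
  rw [viraDer, triSolve_eq, LinearMap.smul_apply, smul_smul, mul_inv_cancel₀ (mul_mul_add_ne_zero hc hk), one_smul,
    LinearMap.sub_apply, LinearMap.sum_apply]
  rfl

theorem viraDer_eq_zero (hc : c ≠ 0) (K : ℕ) {w : X} (hw : ∀ k : ℤ, 0 < k → ⁅e (.I k), w⁆ = 0)
    (k : ℕ) : 0 < k → viraDer X c p K k w = 0 := by
  induction k using downward_induction (K := K) with
  | h k ih =>
    intro hk
    refine (smul_eq_zero.mp ?_).resolve_left (mul_mul_add_ne_zero (p := p) hc hk)
    rw [smul_viraDer hc K hk, hw k (by omega), Finset.sum_eq_zero, sub_zero]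
    intro i hi
    rw [ih i hi (by rw [Finset.mem_Ico] at hi; omega), lie_zero, smul_zero]

theorem viraDer_I (hc : c ≠ 0) (hX : HasLevel X cL c) (K : ℕ) (w : X) (n : ℤ) (k : ℕ) :
    0 < k → viraDer X c p K k ⁅e (.I n), w⁆ = ⁅e (.I n), viraDer X c p K k w⁆ := by
  induction k using downward_induction (K := K) with
  | h k ih =>
    intro hk
    refine smul_right_injective X (mul_mul_add_ne_zero (p := p) hc hk) ?_
    change _ • _ = _ • _
    rw [← lie_smul, smul_viraDer hc K hk, smul_viraDer hc K hk, lie_sub, lie_sum, hX.I_I]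
    congr 1
    refine Finset.sum_congr rfl fun i hi => ?_
    rw [ih i hi (by rw [Finset.mem_Ico] at hi; omega), lie_smul, hX.I_I]

theorem viraDer_mem (hc : c ≠ 0) (hX : HasLevel X cL c) {hI : ℂ}
    (hx : IsHighestWeight cL 0 c h hI x) (K : ℕ) {s : ℕ} {w : X} (hw : w ∈ viraFilt x (s + 1))
    (k : ℕ) : 0 < k → viraDer X c p K k w ∈ viraFilt x s := by
  induction k using downward_induction (K := K) with
  | h k ih =>
    intro hk
    refine (Submodule.smul_mem_iff _ (mul_mul_add_ne_zero (p := p) hc hk)).mp ?_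
    rw [smul_viraDer hc K hk]
    refine Submodule.sub_mem _ (I_pos_mem_viraFilt hX hx hw (by omega))
      (Submodule.sum_mem _ fun i hi => Submodule.smul_mem _ _ (I_mem_viraFilt hX hx (ih i hi ?_) _))
    rw [Finset.mem_Ico] at hi
    omega

/-- To leading order I(k) acts as Σ_i [I(k), L(-i)] ∂/∂L(-i). For i < k the bracket is a positive
I-mode and drops the filtration, i = k gives the pivot, and the terms i > k are removed by back
substitution. The bound `i ≤ K` ensures that the truncated system sees the letter. -/
theorem viraDer_L (hc : c ≠ 0) (hX : HasLevel X cL c)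
    (hx : IsHighestWeight cL 0 c h (c * (p + 1)) x)
    (hI0 : ∀ w : X, ⁅e (.I 0), w⁆ = (c * (p + 1)) • w) {K i : ℕ} (hi : 0 < i) (hiK : i ≤ K) {s : ℕ}
    {w : X} (hw : w ∈ viraFilt x (s + 1)) (k : ℕ) :
    0 < k → viraDer X c p K k ⁅e (.L (-i)), w⁆ - ⁅e (.L (-i)), viraDer X c p K k w⁆ -
      (if i = k then w else 0) ∈ viraFilt x s := by
  induction k using downward_induction (K := K) with
  | h k ih =>
    intro hk
    set y : ℕ → X := fun j => viraDer X c p K j ⁅e (.L (-i)), w⁆ -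
      ⁅e (.L (-i)), viraDer X c p K j w⁆ - (if i = j then w else 0) with hy
    refine (Submodule.smul_mem_iff _ (mul_mul_add_ne_zero (p := p) hc hk)).mp ?_
    have hsum : ∑ j ∈ Finset.Ico (k + 1) (K + 1),
        (k : ℂ) • ⁅e (.I (k - j)), viraDer X c p K j ⁅e (.L (-i)), w⁆⁆ =
        ⁅e (.L (-i)), ∑ j ∈ Finset.Ico (k + 1) (K + 1),
          (k : ℂ) • ⁅e (.I (k - j)), viraDer X c p K j w⁆⁆ +
        (if k < i then (k : ℂ) • ⁅e (.I (k - i)), w⁆ else 0) +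
        ∑ j ∈ Finset.Ico (k + 1) (K + 1), (k : ℂ) • (⁅e (.I (k - j)), y j⁆ +
          ((k : ℂ) - j) • ⁅e (.I (-i + (k - j))), viraDer X c p K j w⁆) := by
      have h1 : (if k < i then (k : ℂ) • ⁅e (.I (k - i)), w⁆ else 0) =
          ∑ j ∈ Finset.Ico (k + 1) (K + 1), (k : ℂ) • ⁅e (.I (k - j)), if i = j then w else 0⁆ := by
        split_ifs with hki
        · rw [Finset.sum_eq_single_of_mem i (Finset.mem_Ico.mpr ⟨hki, by omega⟩), if_pos rfl]
          intro j _ hj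
          rw [if_neg hj.symm, lie_zero, smul_zero]
        · refine (Finset.sum_eq_zero fun j hj => ?_).symm
          rw [Finset.mem_Ico] at hj
          rw [if_neg (by omega), lie_zero, smul_zero]
      rw [h1, lie_sum, ← Finset.sum_add_distrib, ← Finset.sum_add_distrib]
      refine Finset.sum_congr rfl fun j hj => ?_
      rw [Finset.mem_Ico] at hj
      have h2 := hX.I_L (k - j) (-i) (viraDer X c p K j w)
      rw [if_neg (by omega), zero_mul, zero_smul, add_zero] at h2
      have h3 : viraDer X c p K j ⁅e (.L (-i)), w⁆ =
          y j + ⁅e (.L (-i)), viraDer X c p K j w⁆ + (if i = j then w else 0) := by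
        simp only [hy]
        abel
      rw [h3, lie_add, lie_add, h2, lie_smul]
      push_cast
      module
    have hmain : ((k : ℂ) * c * (p + k)) • (viraDer X c p K k ⁅e (.L (-i)), w⁆ -
        ⁅e (.L (-i)), viraDer X c p K k w⁆ - (if i = k then w else 0)) =
        ((k : ℂ) • ⁅e (.I (-i + k)), w⁆ +
          ((if (-i : ℤ) = -k then ((-i : ℤ) : ℂ) ^ 2 + (-i : ℤ) else 0) * c) • w -
          (if k < i then (k : ℂ) • ⁅e (.I (k - i)), w⁆ else 0) -
          ((k : ℂ) * c * (p + k)) • (if i = k then w else 0)) -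
        ∑ j ∈ Finset.Ico (k + 1) (K + 1), (k : ℂ) • (⁅e (.I (k - j)), y j⁆ +
          ((k : ℂ) - j) • ⁅e (.I (-i + (k - j))), viraDer X c p K j w⁆) := by
      rw [smul_sub, smul_sub, smul_viraDer hc K hk, ← lie_smul, smul_viraDer hc K hk, hsum, hX.I_L,
        lie_sub, Int.cast_natCast]
      abel
    rw [hmain]
    refine Submodule.sub_mem _ ?_ (Submodule.sum_mem _ fun j hj => Submodule.smul_mem _ _
      (Submodule.add_mem _ (I_mem_viraFilt hX hx (ih j hj ?_) _) (Submodule.smul_mem _ _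
        (I_mem_viraFilt hX hx (viraDer_mem hc hX hx K hw j ?_) _))))
    · rcases lt_trichotomy i k with hik | rfl | hik
      · rw [if_neg (by omega), if_neg (by omega), if_neg (by omega), zero_mul, zero_smul, smul_zero,
          sub_zero, sub_zero, add_zero]
        exact Submodule.smul_mem _ _ (I_pos_mem_viraFilt hX hx hw (by omega))
      · rw [if_pos rfl, if_neg (by omega), if_pos rfl, neg_add_cancel, hI0]
        refine (congrArg (· ∈ viraFilt x s) ?_).mp (Submodule.zero_mem _)
        push_cast
        module
      · rw [if_neg (by omega), if_pos hik, if_neg (by omega), zero_mul, zero_smul, smul_zero,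
          sub_zero, add_zero, show -(i : ℤ) + k = k - i by ring, sub_self]
        exact Submodule.zero_mem _
    all_goals
      rw [Finset.mem_Ico] at hj
      omega

/-- A vector killed by the positive modes `I(k)` is generated by negative modes `I(-k)`. -/
theorem mem_viraFilt_one (hc : c ≠ 0) (hX : HasLevel X cL c)
    (hx : IsHighestWeight cL 0 c h (c * (p + 1)) x)
    (hI0 : ∀ w : X, ⁅e (.I 0), w⁆ = (c * (p + 1)) • w) {s : ℕ} {w : X} (hw : w ∈ viraFilt x s)
    (hI : ∀ k : ℤ, 0 < k → ⁅e (.I k), w⁆ = 0) : w ∈ viraFilt x 1 := by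
  refine mem_wordFilt_one_of_euler (fun T hT => ?_) hw
  have hpos : ∀ k ∈ T, 0 < k := fun k hk => hT hk
  have hK : ∀ k ∈ T, k ≤ T.sup id := fun k hk => Finset.le_sup (f := id) hk
  refine ⟨∑ k ∈ T, act (e (.L (-k))) * viraDer X c p (T.sup id) k, ?_, fun s w hw => ?_⟩
  · rw [LinearMap.sum_apply]
    refine Finset.sum_eq_zero fun k hk => ?_
    rw [Module.End.mul_apply, viraDer_eq_zero hc _ hI k (hpos k hk), map_zero]
  · rw [LinearMap.sum_apply]
    refine FiltWord.euler_sub_mem hT (D := viraDer X c p (T.sup id)) ?_ ?_ ?_ ?_ ?_ hw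
    · exact fun k hk => viraDer_eq_zero hc _ hx.I_pos k (hpos k hk)
    · rintro k hk _ ⟨i, hi, rfl⟩ w
      exact viraDer_I hc hX _ w _ k (hpos k hk)
    · exact fun k hk i hi s w hw => viraDer_L hc hX hx hI0 (hpos i hi) (hK i hi) hw k (hpos k hk)
    · intro k hk i hi s w hw
      have h1 := viraDer_mem hc hX hx (p := p) (T.sup id) hw k (hpos k hk)
      have h2 := hX.L_L (-k) (-i) (viraDer X c p (T.sup id) k w)
      have hki : 0 < k + i := by have := hpos k hk; omega
      rw [if_neg (by have := hpos k hk; omega), zero_mul, zero_smul, add_zero] at h2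
      simp only [act_apply]
      rw [h2, add_sub_cancel_left, show -(k : ℤ) + -i = -((k + i : ℕ) : ℤ) by push_cast; ring]
      exact Submodule.smul_mem _ _ (L_mem_viraFilt hki h1)
    · rintro k hk _ ⟨i, hi, rfl⟩ s w hw
      have h1 := viraDer_mem hc hX hx (p := p) (T.sup id) hw k (hpos k hk)
      have h2 := hX.L_I (-k) (-i) (viraDer X c p (T.sup id) k w)
      rw [if_neg (by have := hpos k hk; omega), zero_mul, zero_smul, sub_zero] at h2
      simp only [act_apply]
      rw [h2, sub_sub_cancel_left]
      exact Submodule.neg_mem _ (Submodule.smul_mem _ _ (I_mem_viraFilt hX hx h1 _))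

end HVir
end

/-! ### Positive modes L(k) as derivatives in the I(-k) -/

noncomputable section

set_option linter.unusedSectionVars false

namespace HVir

variable {X : Type*} [AddCommGroup X] [Module ℂ X] [LieRingModule HVir X] [LieModule ℂ HVir X]
  {cL c h : ℂ} {x : X} {p : ℕ}

/-- The span of the vectors obtained with fewer than `s` negative modes `I(-i)`, `i ≠ p`. -/
def heisFilt (p : ℕ) (x : X) (s : ℕ) : Submodule ℂ X :=
  wordFilt (fun i : ℕ => act (e (.I (-i)))) {i | 0 < i ∧ i ≠ p} ∅ x s

theorem heisFilt_mono {s t : ℕ} (hst : s ≤ t) : heisFilt p x s ≤ heisFilt p x t :=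
  wordFilt_mono hst

theorem mem_iSup_heisFilt {w : X} : w ∈ ⨆ s, heisFilt p x s ↔ ∃ s, w ∈ heisFilt p x s :=
  Submodule.mem_iSup_of_directed _ (Monotone.directed_le fun _ _ h => heisFilt_mono h)

theorem I_mem_iSup_heisFilt {i : ℕ} (hi : 0 < i) (hip : i ≠ p) {w : X}
    (hw : w ∈ ⨆ s, heisFilt p x s) : ⁅e (.I (-i)), w⁆ ∈ ⨆ s, heisFilt p x s := by
  rw [mem_iSup_heisFilt] at hw ⊢
  obtain ⟨s, hs⟩ := hw
  exact ⟨s + 1, up_mem_wordFilt (A := fun i : ℕ => act (e (.I (-i))))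
    (S := {i | 0 < i ∧ i ≠ p}) ⟨hi, hip⟩ hs⟩

theorem self_mem_iSup_heisFilt : x ∈ ⨆ s, heisFilt p x s :=
  mem_iSup_heisFilt.mpr ⟨1, base_mem_wordFilt 0⟩

theorem heisFilt_induction {P : X → Prop} (h0 : P 0) (hadd : ∀ a b, P a → P b → P (a + b))
    (hsmul : ∀ (a : ℂ) b, P b → P (a • b)) (hx : P x)
    (hI : ∀ i : ℕ, 0 < i → i ≠ p → ∀ w ∈ ⨆ s, heisFilt p x s, P w → P ⁅e (.I (-i)), w⁆) {w : X}
    (hw : w ∈ ⨆ s, heisFilt p x s) : P w := by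
  obtain ⟨s, hs⟩ := mem_iSup_heisFilt.mp hw
  refine Submodule.span_induction (p := fun w _ => P w) ?_ h0 (fun a b _ _ => hadd a b)
    (fun a b _ => hsmul a b) hs
  clear hs hw w
  intro w hw
  induction hw with
  | base s => exact hx
  | up hi hw ih =>
    exact hI _ hi.1 hi.2 _ (mem_iSup_heisFilt.mpr ⟨_, Submodule.subset_span hw⟩) ih
  | same hb => exact absurd hb (Set.notMem_empty _)

/-- The relation `schurVec c x p = 0` eliminates the mode `I(-p)`. -/
theorem I_mem_iSup_heisFilt_of_schurVec (hc : c ≠ 0) (hX : HasLevel X cL c) (hp : 0 < p)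
    (hxp : schurVec c x p = 0) {i : ℕ} (hi : 0 < i) {w : X} (hw : w ∈ ⨆ s, heisFilt p x s) :
    ⁅e (.I (-i)), w⁆ ∈ ⨆ s, heisFilt p x s := by
  rcases eq_or_ne i p with rfl | hip
  swap
  · exact I_mem_iSup_heisFilt hi hip hw
  -- For n < p the vector S_n involves only the modes I(-1), …, I(-n).
  have hu : ∀ n < i, schurVec c x n ∈ ⨆ s, heisFilt i x s := by
    intro n
    induction n using Nat.strong_induction_on with
    | _ n ih =>
      intro hn
      rcases n.eq_zero_or_pos with rfl | hn0
      · rw [schurVec_zero]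
        exact self_mem_iSup_heisFilt
      · have hn' : -(c * n) ≠ 0 := neg_ne_zero.mpr (mul_ne_zero hc (by exact_mod_cast hn0.ne'))
        refine (Submodule.smul_mem_iff _ hn').mp ?_
        rw [← sum_schurVec hc]
        refine Submodule.sum_mem _ fun j hj => ?_
        rw [Finset.mem_range] at hj
        rw [show (j : ℤ) - n = -((n - j : ℕ) : ℤ) by omega]
        exact I_mem_iSup_heisFilt (by omega) (by omega) (ih j hj (by omega))
  refine heisFilt_induction (P := fun w => ⁅e (.I (-i)), w⁆ ∈ ⨆ s, heisFilt i x s)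
    ?_ ?_ ?_ ?_ ?_ hw
  · rw [lie_zero]
    exact Submodule.zero_mem _
  · intro a b ha hb
    rw [lie_add]
    exact Submodule.add_mem _ ha hb
  · intro a b hb
    rw [lie_smul]
    exact Submodule.smul_mem _ a hb
  -- In Newton's recursion for S_p = 0 the mode I(-p) occurs only in the term of index 0, applied to
  -- x, so it can be solved for.
  · have h1 := sum_schurVec hc x i
    obtain ⟨q, rfl⟩ : ∃ q, i = q + 1 := ⟨i - 1, by omega⟩
    rw [hxp, smul_zero, Finset.sum_range_succ', schurVec_zero, Nat.cast_zero, zero_sub] at h1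
    rw [eq_neg_of_add_eq_zero_right h1]
    refine Submodule.neg_mem _ (Submodule.sum_mem _ fun j hj => ?_)
    rw [Finset.mem_range] at hj
    rw [show ((j + 1 : ℕ) : ℤ) - (q + 1 : ℕ) = -((q - j : ℕ) : ℤ) by omega]
    exact I_mem_iSup_heisFilt (by omega) (by omega) (hu _ (by omega))
  · intro j hj hji w hw ih
    rw [hX.I_I]
    exact I_mem_iSup_heisFilt hj hji ih

theorem viraFilt_one_le (hc : c ≠ 0) (hX : HasLevel X cL c) (hp : 0 < p)
    (hxp : schurVec c x p = 0) : viraFilt x 1 ≤ ⨆ s, heisFilt p x s := by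
  refine Submodule.span_le.mpr fun w hw => ?_
  have key : ∀ s w, FiltWord (fun i : ℕ => (act (e (.L (-i))) : X →ₗ[ℂ] X)) {i | 0 < i} (negI X) x
      s w → s ≤ 1 → w ∈ ⨆ s, heisFilt p x s := by
    intro s w hw
    induction hw with
    | base s => exact fun _ => self_mem_iSup_heisFilt
    | up _ hw _ => exact fun hs => absurd hw.pos (by omega)
    | same hb _ ih =>
      obtain ⟨i, hi, rfl⟩ := hb
      exact fun hs => I_mem_iSup_heisFilt_of_schurVec hc hX hp hxp hi (ih hs)
  exact key 1 w hw le_rfl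

theorem I_pos_heisFilt (hX : HasLevel X cL c) {hI : ℂ} (hx : IsHighestWeight cL 0 c h hI x) {n : ℤ}
    (hn : 0 < n) {w : X} (hw : w ∈ ⨆ s, heisFilt p x s) : ⁅e (.I n), w⁆ = 0 := by
  refine heisFilt_induction (P := fun w => ⁅e (.I n), w⁆ = 0) ?_ ?_ ?_ ?_ ?_ hw
  · rw [lie_zero]
  · intro a b ha hb
    rw [lie_add, ha, hb, add_zero]
  · intro a b hb
    rw [lie_smul, hb, smul_zero]
  · exact hx.I_pos n hn
  · intro i _ _ w _ hw
    rw [hX.I_I, hw, lie_zero]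

/-- The partial derivatives with respect to the modes `I(-k)`. -/
def heisDer (X : Type*) [AddCommGroup X] [Module ℂ X] [LieRingModule HVir X] [LieModule ℂ HVir X]
    (c : ℂ) (p K : ℕ) (k : ℕ) : Module.End ℂ X :=
  triSolve (fun k => k * c * (p - k)) (fun k => act (e (.L k)))
    (fun k i => (i : ℂ) • (act (e (.I (k - i))) : Module.End ℂ X)) K k

/-- The scalar of [L(k), I(-k)] is k · c(p+1) - (k²+k)c = kc(p-k); among k > 0 it fails to be
invertible only for the eliminated mode k = p. -/
theorem mul_mul_sub_ne_zero (hc : c ≠ 0) {k : ℕ} (hk : 0 < k) (hkp : k ≠ p) :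
    (k : ℂ) * c * (p - k) ≠ 0 :=
  mul_ne_zero (mul_ne_zero (Nat.cast_ne_zero.mpr hk.ne') hc)
    (sub_ne_zero.mpr (Nat.cast_injective.ne hkp.symm))

/-- At k = p the pivot is 0 and the convention `0⁻¹ = 0` turns the derivative off, as is wanted for
a letter that does not occur. -/
theorem heisDer_self (K : ℕ) (w : X) : heisDer X c p K p w = 0 := by
  rw [heisDer, triSolve_eq, sub_self, mul_zero, inv_zero, zero_smul, LinearMap.zero_apply]

theorem smul_heisDer (hc : c ≠ 0) (K : ℕ) {k : ℕ} (hk : 0 < k) (hkp : k ≠ p) (w : X) :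
    ((k : ℂ) * c * (p - k)) • heisDer X c p K k w = ⁅e (.L k), w⁆ -
      ∑ i ∈ Finset.Ico (k + 1) (K + 1), (i : ℂ) • ⁅e (.I (k - i)), heisDer X c p K i w⁆ := by
  rw [heisDer, triSolve_eq, LinearMap.smul_apply, smul_smul,
    mul_inv_cancel₀ (mul_mul_sub_ne_zero hc hk hkp), one_smul, LinearMap.sub_apply,
    LinearMap.sum_apply]
  rfl

theorem heisDer_eq_zero (hc : c ≠ 0) (K : ℕ) {w : X} (hw : ∀ k : ℤ, 0 < k → ⁅e (.L k), w⁆ = 0)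
    (k : ℕ) : 0 < k → heisDer X c p K k w = 0 := by
  induction k using downward_induction (K := K) with
  | h k ih =>
    intro hk
    rcases eq_or_ne k p with rfl | hkp
    · exact heisDer_self K w
    refine (smul_eq_zero.mp ?_).resolve_left (mul_mul_sub_ne_zero hc hk hkp)
    rw [smul_heisDer hc K hk hkp, hw k (by omega), Finset.sum_eq_zero, sub_zero]
    intro i hi
    rw [ih i hi (by rw [Finset.mem_Ico] at hi; omega), lie_zero, smul_zero]

/-- Unlike `viraDer_L` this is exact: the I's commute, and positive I-modes kill words in the I's,
so there is no lower order error. -/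
theorem heisDer_I (hc : c ≠ 0) (hX : HasLevel X cL c)
    (hx : IsHighestWeight cL 0 c h (c * (p + 1)) x)
    (hI0 : ∀ w : X, ⁅e (.I 0), w⁆ = (c * (p + 1)) • w) {K i : ℕ} (hip : i ≠ p)
    (hiK : i ≤ K) {w : X} (hw : w ∈ ⨆ s, heisFilt p x s) (k : ℕ) :
    0 < k → heisDer X c p K k ⁅e (.I (-i)), w⁆ =
      ⁅e (.I (-i)), heisDer X c p K k w⁆ + (if i = k then w else 0) := by
  induction k using downward_induction (K := K) with
  | h k ih =>
    intro hk
    rcases eq_or_ne k p with rfl | hkp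
    · rw [heisDer_self, heisDer_self, lie_zero, if_neg hip, add_zero]
    refine smul_right_injective X (mul_mul_sub_ne_zero hc hk hkp) ?_
    change _ • _ = _ • _
    have hsum : ∑ j ∈ Finset.Ico (k + 1) (K + 1),
        (j : ℂ) • ⁅e (.I (k - j)), heisDer X c p K j ⁅e (.I (-i)), w⁆⁆ =
        ⁅e (.I (-i)), ∑ j ∈ Finset.Ico (k + 1) (K + 1),
          (j : ℂ) • ⁅e (.I (k - j)), heisDer X c p K j w⁆⁆ +
        (if k < i then (i : ℂ) • ⁅e (.I (k - i)), w⁆ else 0) := by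
      have h1 : (if k < i then (i : ℂ) • ⁅e (.I (k - i)), w⁆ else 0) =
          ∑ j ∈ Finset.Ico (k + 1) (K + 1), (j : ℂ) • ⁅e (.I (k - j)), if i = j then w else 0⁆ := by
        split_ifs with hki
        · rw [Finset.sum_eq_single_of_mem i (Finset.mem_Ico.mpr ⟨hki, by omega⟩), if_pos rfl]
          intro j _ hj
          rw [if_neg hj.symm, lie_zero, smul_zero]
        · refine (Finset.sum_eq_zero fun j hj => ?_).symm
          rw [Finset.mem_Ico] at hj
          rw [if_neg (by omega), lie_zero, smul_zero]
      rw [h1, lie_sum, ← Finset.sum_add_distrib]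
      refine Finset.sum_congr rfl fun j hj => ?_
      rw [ih j hj (by rw [Finset.mem_Ico] at hj; omega), lie_add, hX.I_I, lie_smul, smul_add]
    rw [smul_add, smul_heisDer hc K hk hkp, ← lie_smul, smul_heisDer hc K hk hkp, hsum, hX.L_I,
      lie_sub]
    rcases lt_trichotomy i k with hik | rfl | hik
    · rw [if_neg (by omega), if_neg (by omega), if_neg (by omega), I_pos_heisFilt hX hx (by omega) hw]
      simp
    · rw [if_pos (by omega), if_neg (by omega), if_pos rfl, add_neg_cancel, hI0]
      push_cast
      module
    · rw [if_neg (by omega), if_pos hik, if_neg (by omega), show (k : ℤ) + -i = k - i by ring]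
      push_cast
      module

/-- A vector generated by negative modes `I(-k)` and killed by the positive modes `L(k)` is a
multiple of the highest weight vector. -/
theorem mem_span_singleton_of_L_eq_zero (hc : c ≠ 0) (hX : HasLevel X cL c)
    (hx : IsHighestWeight cL 0 c h (c * (p + 1)) x)
    (hI0 : ∀ w : X, ⁅e (.I 0), w⁆ = (c * (p + 1)) • w) {w : X} (hw : w ∈ ⨆ s, heisFilt p x s)
    (hL : ∀ k : ℤ, 0 < k → ⁅e (.L k), w⁆ = 0) : w ∈ Submodule.span ℂ {x} := by
  obtain ⟨s, hs⟩ := mem_iSup_heisFilt.mp hw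
  have h1 : w ∈ heisFilt p x 1 := by
    refine mem_wordFilt_one_of_euler (fun T hT => ?_) hs
    have hpos : ∀ k ∈ T, 0 < k := fun k hk => (hT hk).1
    have hK : ∀ k ∈ T, k ≤ T.sup id := fun k hk => Finset.le_sup (f := id) hk
    refine ⟨∑ k ∈ T, act (e (.I (-k))) * heisDer X c p (T.sup id) k, ?_, fun s w hw => ?_⟩
    · rw [LinearMap.sum_apply]
      refine Finset.sum_eq_zero fun k hk => ?_
      rw [Module.End.mul_apply, heisDer_eq_zero hc _ hL k (hpos k hk), map_zero]
    · rw [LinearMap.sum_apply]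
      refine FiltWord.euler_sub_mem hT (D := heisDer X c p (T.sup id)) ?_ ?_ ?_ ?_ ?_ hw
      · exact fun k hk => heisDer_eq_zero hc _ hx.L_pos k (hpos k hk)
      · exact fun k hk b hb => absurd hb (Set.notMem_empty b)
      · intro k hk i hi s w hw
        have h2 := heisDer_I hc hX hx hI0 (hT hi).2 (hK i hi)
          (mem_iSup_heisFilt.mpr ⟨_, hw⟩) k (hpos k hk)
        simp only [act_apply]
        rw [h2, add_sub_cancel_left, sub_self]
        exact Submodule.zero_mem _
      · intro k hk i hi s w hw
        simp only [act_apply]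
        rw [hX.I_I, sub_self]
        exact Submodule.zero_mem _
      · exact fun k hk b hb => absurd hb (Set.notMem_empty b)
  refine Submodule.span_le.mpr (fun w hw => ?_) h1
  have key : ∀ s w, FiltWord (fun i : ℕ => (act (e (.I (-i))) : X →ₗ[ℂ] X))
      {i | 0 < i ∧ i ≠ p} ∅ x s w → s ≤ 1 → w ∈ Submodule.span ℂ {x} := by
    intro s w hw
    cases hw with
    | base s => exact fun _ => Submodule.mem_span_singleton_self x
    | up _ hw => exact fun hs => absurd hw.pos (by omega)
    | same hb => exact absurd hb (Set.notMem_empty _)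
  exact key 1 w hw le_rfl

theorem exists_mem_viraFilt (hX : HasLevel X cL c) {hI : ℂ} (hx : IsHighestWeight cL 0 c h hI x)
    {w : X} (hw : w ∈ hwSubmodule hX hx) : ∃ s, w ∈ viraFilt x s := by
  rw [hwSubmodule, mem_negSubmodule] at hw
  have hle : ⨆ j, negSpan (lineFamily x) j ≤ ⨆ s, viraFilt x s := by
    refine iSup_le fun j => Submodule.span_le.mpr fun w hw => ?_
    have hdir : ∀ w, w ∈ ⨆ s, viraFilt x s ↔ ∃ s, w ∈ viraFilt x s := fun w =>
      Submodule.mem_iSup_of_directed _ (Monotone.directed_le fun _ _ h => viraFilt_mono h)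
    rw [SetLike.mem_coe, hdir]
    induction hw with
    | @base j w hb =>
      rw [lineFamily] at hb
      split_ifs at hb with hj
      · obtain ⟨a, rfl⟩ := Submodule.mem_span_singleton.mp hb
        exact ⟨1, Submodule.smul_mem _ a (base_mem_wordFilt 0)⟩
      · rw [(Submodule.mem_bot ℂ).mp hb]
        exact ⟨0, Submodule.zero_mem _⟩
    | L k hk _ ih =>
      obtain ⟨s, hs⟩ := ih
      exact ⟨s + 1, L_mem_viraFilt hk hs⟩
    | I k hk _ ih =>
      obtain ⟨s, hs⟩ := ih
      exact ⟨s, I_mem_viraFilt hX hx hs _⟩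
  exact (Submodule.mem_iSup_of_directed _
    (Monotone.directed_le fun _ _ h => viraFilt_mono h)).mp (hle hw)

/-- A nonzero submodule of a highest weight module contains a nonzero singular vector. -/
theorem exists_singular (hX : HasLevel X cL c) {hI : ℂ} (hx : IsHighestWeight cL 0 c h hI x)
    (htop : hwSubmodule hX hx = ⊤) {N : LieSubmodule ℂ HVir X} (hN : N ≠ ⊥) :
    ∃ w ∈ N, w ≠ 0 ∧ ∀ k : ℤ, 0 < k → ⁅e (.L k), w⁆ = 0 ∧ ⁅e (.I k), w⁆ = 0 := by
  classical
  -- Positive modes lower the degree bound D, so a nonzero vector of N with D minimal is singular.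
  set G : ℕ → Submodule ℂ X := fun D => ⨆ j : {j : ℤ // j < D}, negSpan (lineFamily x) j with hG
  have hGmono : Monotone G := fun D D' hD => iSup_le fun j =>
    le_iSup (fun j : {j : ℤ // j < D'} => negSpan (lineFamily x) (j : ℤ)) ⟨j, by have := j.2; omega⟩
  have hG0 : G 0 = ⊥ := by
    rw [eq_bot_iff]
    refine iSup_le fun j => ?_
    rw [negSpan_lineFamily_of_neg (by have := j.2; omega)]
  have hGlie : ∀ (D : ℕ) (k : ℤ), 0 < k → ∀ w ∈ G (D + 1),
      ⁅e (.L k), w⁆ ∈ G D ∧ ⁅e (.I k), w⁆ ∈ G D := by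
    intro D k hk w hw
    have h1 : ∀ j : {j : ℤ // j < (D + 1 : ℕ)}, negSpan (lineFamily x) (j - k : ℤ) ≤ G D :=
      fun j => le_iSup (fun j : {j : ℤ // j < D} => negSpan (lineFamily x) (j : ℤ))
        ⟨j - k, by have := j.2; push_cast at this; omega⟩
    have hL : G (D + 1) ≤ (G D).comap (act (e (.L k))) := iSup_le fun j w hw =>
      h1 j (lie_mem_negSpan hX hx.L_mem hx.I_mem k hw).1
    have hI : G (D + 1) ≤ (G D).comap (act (e (.I k))) := iSup_le fun j w hw =>
      h1 j (lie_mem_negSpan hX hx.L_mem hx.I_mem k hw).2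
    exact ⟨hL hw, hI hw⟩
  have hGtop : ∀ w : X, ∃ D, w ∈ G D := by
    intro w
    have hw : w ∈ ⨆ j, negSpan (lineFamily x) j := by
      have : w ∈ hwSubmodule hX hx := htop ▸ LieSubmodule.mem_top w
      rwa [hwSubmodule, mem_negSubmodule] at this
    have hle : ⨆ j, negSpan (lineFamily x) j ≤ ⨆ D, G D := iSup_le fun j =>
      (le_iSup (fun i : {i : ℤ // i < (j.toNat + 1 : ℕ)} => negSpan (lineFamily x) (i : ℤ))
        ⟨j, by push_cast; omega⟩).trans (le_iSup G (j.toNat + 1))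
    exact (Submodule.mem_iSup_of_directed _ hGmono.directed_le).mp (hle hw)
  have hex : ∃ D, ∃ w ∈ N, w ≠ 0 ∧ w ∈ G D := by
    by_contra! hcon
    refine hN ((LieSubmodule.eq_bot_iff N).mpr fun w hw => ?_)
    by_contra hw0
    obtain ⟨D, hD⟩ := hGtop w
    exact hcon D w hw hw0 hD
  obtain ⟨w, hwN, hw0, hwG⟩ := Nat.find_spec hex
  refine ⟨w, hwN, hw0, fun k hk => ?_⟩
  obtain ⟨D, hD⟩ : ∃ D, Nat.find hex = D + 1 := by
    refine Nat.exists_eq_succ_of_ne_zero fun h0 => hw0 ?_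
    rwa [h0, hG0, Submodule.mem_bot] at hwG
  rw [hD] at hwG
  have hmin : ∀ y ∈ N, y ∈ G D → y = 0 := by
    intro y hy hyG
    by_contra hy0
    exact Nat.find_min hex (m := D) (by omega) ⟨y, hy, hy0, hyG⟩
  exact ⟨hmin _ (N.lie_mem hwN) (hGlie D k hk w hwG).1, hmin _ (N.lie_mem hwN) (hGlie D k hk w hwG).2⟩

/-- A highest weight module in which `schurVec c x p` vanishes is irreducible. -/
theorem mem_of_ne_bot (hc : c ≠ 0) (hX : HasLevel X cL c)
    (hx : IsHighestWeight cL 0 c h (c * (p + 1)) x) (htop : hwSubmodule hX hx = ⊤) (hp : 0 < p)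
    (hxp : schurVec c x p = 0) {N : LieSubmodule ℂ HVir X} (hN : N ≠ ⊥) : x ∈ N := by
  obtain ⟨w, hwN, hw0, hw⟩ := exists_singular hX hx htop hN
  have hmem : ∀ w : X, w ∈ hwSubmodule hX hx := fun w => htop ▸ LieSubmodule.mem_top w
  have hI0 : ∀ w : X, ⁅e (.I 0), w⁆ = (c * (p + 1)) • w := fun w => I_zero_apply hX hx (hmem w)
  obtain ⟨s, hs⟩ := exists_mem_viraFilt hX hx (hmem w)
  have h1 := mem_viraFilt_one hc hX hx hI0 hs fun k hk => (hw k hk).2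
  have h2 := mem_span_singleton_of_L_eq_zero hc hX hx hI0 (viraFilt_one_le hc hX hp hxp h1)
    fun k hk => (hw k hk).1
  obtain ⟨a, rfl⟩ := Submodule.mem_span_singleton.mp h2
  have ha : a ≠ 0 := fun h0 => hw0 (by rw [h0, zero_smul])
  have := N.smul_mem a⁻¹ hwN
  rwa [smul_smul, inv_mul_cancel₀ ha, one_smul] at this

end HVir

/-! ### S_p generates the maximal submodule -/

namespace Verma
open HVir

variable {cL c h : ℂ}

/-- The vector `schurVec c hwv p` generates the maximal submodule. -/
theorem maxSubmodule_le_hwSubmodule (hc : c ≠ 0) {p : ℕ} (hp : 0 < p) :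
    maxSubmodule cL 0 c h (c * (p + 1)) ≤ hwSubmodule hasLevel
      (isHighestWeight_schurVec hc hasLevel (isHighestWeight_hwv (cL := cL) (h := h))) := by
  set R := hwSubmodule hasLevel
    (isHighestWeight_schurVec hc hasLevel (isHighestWeight_hwv (cL := cL) (h := h))
      (p := p)) with hR
  refine sSup_le fun N hN => ?_
  by_contra hle
  set π := LieSubmodule.Quotient.mk' R with hπ
  have hπs : Function.Surjective π := LieSubmodule.Quotient.surjective_mk' R
  have hne : N.map π ≠ ⊥ := fun h0 => hle fun w hw => by
    have := (LieSubmodule.eq_bot_iff _).mp h0 _ (LieSubmodule.mem_map_of_mem (f := π) hw)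
    exact (LieSubmodule.Quotient.mk_eq_zero _).mp this
  have htop : hwSubmodule (hasLevel.of_surjective π hπs)
      ((isHighestWeight_hwv (cL := cL) (cI := 0) (c := c) (h := h) (hI := c * (p + 1))).map π) =
      ⊤ := by
    refine eq_top_iff.mpr fun w _ => ?_
    obtain ⟨m, rfl⟩ := hπs w
    have : m ∈ (hwSubmodule (hasLevel.of_surjective π hπs)
      ((isHighestWeight_hwv (cL := cL) (cI := 0) (c := c) (h := h)
        (hI := c * (p + 1))).map π)).comap π := by
      rw [eq_top_of_hwv_mem (LieSubmodule.mem_comap.mpr (self_mem_hwSubmodule _ _))]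
      exact LieSubmodule.mem_top m
    exact LieSubmodule.mem_comap.mp this
  have hzero : schurVec c (π (hwv cL 0 c h (c * (p + 1)))) p = 0 := by
    rw [← map_schurVec]
    exact (LieSubmodule.Quotient.mk_eq_zero _).mpr (self_mem_hwSubmodule _ _)
  -- The nonzero image of N modulo R contains the highest weight vector, so N contains that vector
  -- plus an element of R. As R lies in positive degrees, N is everything.
  obtain ⟨w, hwN, hw⟩ := (LieSubmodule.mem_map _).mp (mem_of_ne_bot hc _ _ htop hp hzero hne)
  have hwR : w - hwv cL 0 c h (c * (p + 1)) ∈ R := by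
    rw [← LieSubmodule.Quotient.mk_eq_zero, map_sub, sub_eq_zero]
    exact hw
  have hpos := hwSubmodule_le_posPart _ hp (by
    have := schurVec_mem hc (le_negSpan 0
      (mem_lineFamily_zero (hwv cL 0 c h (c * (p + 1))))) p
    rwa [zero_add] at this) hwR
  refine hN (eq_top_of_hwv_mem (mem_of_add_mem hasLevel isHighestWeight_hwv N one_ne_zero hpos ?_))
  rwa [one_smul, add_sub_cancel]

end Verma
end

/-! ### Reducibility from functionals killed by negative modes -/

noncomputable section

set_option linter.unusedSectionVars false

namespace HVir
open Polynomial

section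

variable {M : Type*} [AddCommGroup M] [Module ℂ M] [LieRingModule HVir M] [LieModule ℂ HVir M]
  {cL c h hI : ℂ} {x : M} {α β F : ℂ}

/-- The functional turns Newton's recursion for S_n into that of `sum_schurCoeff`. -/
theorem functional_schurVec (hc : c ≠ 0) {f : M →ₗ[ℂ] ℂ[X]} (hf1 : f x = 1)
    (hfI : ∀ k : ℕ, 0 < k → ∀ w, f ⁅e (.I (-k)), w⁆ = C (-F) * X ^ k * f w) (n : ℕ) :
    f (schurVec c x n) = C (schurCoeff c F n) * X ^ n := by
  induction n using Nat.strong_induction_on with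
  | _ n ih =>
    rcases n.eq_zero_or_pos with rfl | hn
    · rw [schurVec_zero, hf1, schurCoeff_zero, map_one, pow_zero, mul_one]
    · have hn' : -(c * n) ≠ 0 := neg_ne_zero.mpr (mul_ne_zero hc (by exact_mod_cast hn.ne'))
      have h1 : (-(c * n)) • f (schurVec c x n) =
          (-(c * n)) • (C (schurCoeff c F n) * X ^ n) := by
        rw [← map_smul, ← sum_schurVec hc, map_sum, smul_eq_C_mul, ← mul_assoc, ← C_mul,
          show -(c * n) * schurCoeff c F n = -(c * n * schurCoeff c F n) by ring,
          ← sum_schurCoeff hc, ← neg_mul, C_mul, map_sum, Finset.mul_sum, Finset.sum_mul]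
        refine Finset.sum_congr rfl fun i hi => ?_
        rw [Finset.mem_range] at hi
        obtain ⟨k, rfl⟩ := Nat.exists_eq_add_of_lt hi
        rw [show ((i : ℤ) - (i + k + 1 : ℕ)) = -((k + 1 : ℕ) : ℤ) by push_cast; ring,
          hfI _ (by omega), ih i hi]
        ring
      exact smul_right_injective _ hn' h1

/-- The value of f after a negative mode is determined linearly by the value before it, so vanishing
propagates along words. -/
theorem functional_eq_zero {y : M} {A B : ℂ} {f : M →ₗ[ℂ] ℂ[X]} (hy : f y = 0)
    (hfI : ∀ k : ℕ, 0 < k → ∀ w, f ⁅e (.I (-k)), w⁆ = C (-F) * X ^ k * f w)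
    (hfL : ∀ k : ℕ, 0 < k → ∀ w, f ⁅e (.L (-k)), w⁆ =
      X ^ k * (X * derivative (f w) + C (A + k * B) * f w))
    (hX : HasLevel M cL c) (hx : IsHighestWeight cL 0 c h hI y) {w : M}
    (hw : w ∈ hwSubmodule hX hx) : f w = 0 := by
  rw [hwSubmodule, mem_negSubmodule] at hw
  have : ⨆ j, negSpan (lineFamily y) j ≤ LinearMap.ker f := by
    refine iSup_le fun j => Submodule.span_le.mpr fun w hw => ?_
    change f w = 0
    induction hw with
    | @base j w hb =>
      rw [lineFamily] at hb
      split_ifs at hb with hj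
      · obtain ⟨a, rfl⟩ := Submodule.mem_span_singleton.mp hb
        rw [map_smul, hy, smul_zero]
      · rw [(Submodule.mem_bot ℂ).mp hb, map_zero]
    | L k hk _ ih => rw [hfL k hk, ih, derivative_zero, mul_zero, mul_zero, add_zero, mul_zero]
    | I k hk _ ih => rw [hfI k hk, ih, mul_zero]
  exact this hw

end

section

variable {E M Q : Type*} [AddCommGroup E] [Module ℂ E] [LieRingModule HVir E] [LieModule ℂ HVir E]
  [AddCommGroup M] [Module ℂ M] [LieRingModule HVir M] [LieModule ℂ HVir M]
  [AddCommGroup Q] [Module ℂ Q] [LieRingModule HVir Q] [LieModule ℂ HVir Q]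
  {cL c h hI : ℂ} {x : M} {α β F : ℂ} {b : Module.Basis ℤ ℂ E}

/-- A tensor product with a highest weight module is reducible as soon as it has a functional
killed by the negative modes which vanishes on a subspace stable under nonnegative modes. -/
theorem not_isIrreducible_of_functional (hQ : HasLevel Q 0 0) (hX : HasLevel M cL c)
    (hx : IsHighestWeight cL 0 c h hI x) (ξ : Q →ₗ[ℂ] M →ₗ[ℂ] ℂ)
    (hξL : ∀ (k : ℕ), 0 < k → ∀ q w, ξ ⁅e (.L (-k)), q⁆ w + ξ q ⁅e (.L (-k)), w⁆ = 0)
    (hξI : ∀ (k : ℕ), 0 < k → ∀ q w, ξ ⁅e (.I (-k)), q⁆ w + ξ q ⁅e (.I (-k)), w⁆ = 0)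
    {q₀ : Q} (hq₀ : ξ q₀ x ≠ 0) (Y : Submodule ℂ Q) (hY : Y ≠ ⊥) (hξY : ∀ y ∈ Y, ξ y x = 0)
    (hYL : ∀ n : ℤ, 0 ≤ n → ∀ y ∈ Y, ⁅e (.L n), y⁆ ∈ Y)
    (hYI : ∀ n : ℤ, 0 ≤ n → ∀ y ∈ Y, ⁅e (.I n), y⁆ ∈ Y) :
    ¬ LieModule.IsIrreducible ℂ HVir (Q ⊗[ℂ] M) := by
  intro hirr
  have hx0 : x ≠ 0 := by
    rintro rfl
    exact hq₀ (map_zero _)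
  set Ξ : Q ⊗[ℂ] M →ₗ[ℂ] ℂ := TensorProduct.lift ξ with hΞ
  have hΞL : ∀ (k : ℕ), 0 < k → ∀ t, Ξ ⁅e (.L (-k)), t⁆ = 0 := by
    intro k hk t
    induction t using TensorProduct.induction_on with
    | zero => rw [lie_zero, map_zero]
    | add s t hs ht => rw [lie_add, map_add, hs, ht, add_zero]
    | tmul q w =>
      rw [TensorProduct.LieModule.lie_tmul_right, map_add]
      exact hξL k hk q w
  have hΞI : ∀ (k : ℕ), 0 < k → ∀ t, Ξ ⁅e (.I (-k)), t⁆ = 0 := by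
    intro k hk t
    induction t using TensorProduct.induction_on with
    | zero => rw [lie_zero, map_zero]
    | add s t hs ht => rw [lie_add, map_add, hs, ht, add_zero]
    | tmul q w =>
      rw [TensorProduct.LieModule.lie_tmul_right, map_add]
      exact hξI k hk q w
  have hT : HasLevel (Q ⊗[ℂ] M) cL c := by simpa using hQ.tensor hX
  set B : ℤ → Submodule ℂ (Q ⊗[ℂ] M) := fun _ => Y.map ((TensorProduct.mk ℂ Q M).flip x) with hB
  have key : ∀ (z : HVir) (a : ℂ) (j j' : ℤ), (∀ y ∈ Y, ⁅z, y⁆ ∈ Y) → ⁅z, x⁆ = a • x →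
      ∀ t ∈ B j, ⁅z, t⁆ ∈ B j' := by
    rintro z a j j' hz hzx _ ⟨y, hy, rfl⟩
    refine ⟨⁅z, y⁆ + a • y, Y.add_mem (hz y hy) (Y.smul_mem a hy), ?_⟩
    simp only [LinearMap.flip_apply, TensorProduct.mk_apply]
    rw [TensorProduct.LieModule.lie_tmul_right, hzx, TensorProduct.add_tmul,
      TensorProduct.tmul_smul, TensorProduct.smul_tmul']
  have hBL : ∀ n j : ℤ, 0 ≤ n → ∀ t ∈ B j, ⁅e (.L n), t⁆ ∈ B (j - n) := by
    intro n j hn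
    rcases hn.eq_or_lt with rfl | hn'
    · exact key _ h j (j - 0) (hYL 0 le_rfl) hx.L_zero
    · exact key _ 0 j (j - n) (hYL n hn) (by rw [hx.L_pos n hn', zero_smul])
  have hBI : ∀ n j : ℤ, 0 ≤ n → ∀ t ∈ B j, ⁅e (.I n), t⁆ ∈ B (j - n) := by
    intro n j hn
    rcases hn.eq_or_lt with rfl | hn'
    · exact key _ hI j (j - 0) (hYI 0 le_rfl) hx.I_zero
    · exact key _ 0 j (j - n) (hYI n hn) (by rw [hx.I_pos n hn', zero_smul])
  -- The submodule generated by Y ⊗ x is spanned by Y ⊗ x itself and by vectors with a leading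
  -- negative mode; Ξ kills both kinds but not q₀ ⊗ x.
  have hle : ⨆ j, negSpan B j ≤ LinearMap.ker Ξ := by
    refine iSup_le fun j => Submodule.span_le.mpr fun t ht => ?_
    change Ξ t = 0
    cases ht with
    | base hb =>
      obtain ⟨y, hy, rfl⟩ := hb
      exact hξY y hy
    | L k hk _ => exact hΞL k hk _
    | I k hk _ => exact hΞI k hk _
  rcases hirr.eq_bot_or_eq_top (negSubmodule hT hBL hBI) with hbot | htop
  · obtain ⟨y, hy, hy0⟩ := Submodule.exists_mem_ne_zero_of_ne_bot hY
    have hmem : y ⊗ₜ[ℂ] x ∈ negSubmodule hT hBL hBI :=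
      Submodule.mem_iSup_of_mem 0 (le_negSpan 0 ⟨y, hy, rfl⟩)
    have h0 := (LieSubmodule.eq_bot_iff _).mp hbot _ hmem
    obtain ⟨φ, hφ⟩ : ∃ φ : Module.Dual ℂ Q, φ y ≠ 0 := by
      by_contra! hφ
      exact hy0 ((Module.forall_dual_apply_eq_zero_iff ℂ y).mp hφ)
    have h1 := congrArg ((TensorProduct.lid ℂ M).toLinearMap ∘ₗ φ.rTensor M) h0
    rw [LinearMap.comp_apply, LinearMap.rTensor_tmul, map_zero] at h1
    exact (smul_ne_zero hφ hx0) h1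
  · have hmem : q₀ ⊗ₜ[ℂ] x ∈ negSubmodule hT hBL hBI := htop ▸ LieSubmodule.mem_top _
    exact hq₀ (hle hmem)

theorem repr_lie {z : HVir} {s : ℤ → ℂ} {k : ℤ} (hz : ∀ n, ⁅z, b n⁆ = s n • b (n + k)) (y : E)
    (i : ℤ) : b.repr ⁅z, y⁆ i = s (i - k) * b.repr y (i - k) := by
  have : (b.coord i).comp (act z) = s (i - k) • b.coord (i - k) := by
    refine b.ext fun n => ?_
    rw [LinearMap.comp_apply, act_apply, hz, map_smul, LinearMap.smul_apply, b.coord_apply,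
      b.coord_apply, b.repr_self, b.repr_self, Finsupp.single_apply, Finsupp.single_apply]
    by_cases h : n + k = i
    · rw [if_pos h, if_pos (by omega), ← h, add_sub_cancel_right]
    · rw [if_neg h, if_neg (by omega), smul_zero, smul_zero]
  exact DFunLike.congr_fun this y

/-- The coefficients of a polynomial, extended by zero to negative indices. -/
def intCoeff (d : ℤ) : ℂ[X] →ₗ[ℂ] ℂ := if 0 ≤ d then lcoeff ℂ d.toNat else 0

theorem intCoeff_X_pow_mul (d : ℤ) (k : ℕ) (q : ℂ[X]) :
    intCoeff d (X ^ k * q) = intCoeff (d - k) q := by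
  rw [intCoeff, intCoeff]
  by_cases hd : 0 ≤ d
  · rw [if_pos hd, lcoeff_apply, coeff_X_pow_mul']
    by_cases hk : (k : ℤ) ≤ d
    · rw [if_pos (by omega), if_pos (by omega), lcoeff_apply, show d.toNat - k = (d - k).toNat by omega]
    · rw [if_neg (by omega), if_neg (by omega), LinearMap.zero_apply]
  · rw [if_neg hd, if_neg (by omega)]
    rfl

theorem intCoeff_X_mul_derivative (d : ℤ) (q : ℂ[X]) :
    intCoeff d (X * derivative q) = d * intCoeff d q := by
  rw [intCoeff]
  split_ifs with hd
  · obtain ⟨n, rfl⟩ := Int.eq_ofNat_of_zero_le hd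
    rw [lcoeff_apply, lcoeff_apply, Int.toNat_natCast]
    cases n with
    | zero => simp
    | succ n =>
      rw [coeff_X_mul, coeff_derivative]
      push_cast
      ring
  · simp

theorem intCoeff_one (d : ℤ) : intCoeff d 1 = if d = 0 then 1 else 0 := by
  rw [intCoeff]
  by_cases hd : 0 ≤ d
  · rw [if_pos hd, lcoeff_apply, coeff_one]
    by_cases h : d = 0
    · rw [if_pos h, if_pos (by omega)]
    · rw [if_neg h, if_neg (by omega)]
  · rw [if_neg hd, if_neg (by omega), LinearMap.zero_apply]

/-- Pair b_i with w by the coefficient of X^(i-m) in f(w). The constants m + α + β and 1 - β are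
those for which L(-k) acting on the two factors cancels. The subspace Y of
`not_isIrreducible_of_functional` is the image of the part of N in degrees above m; it is nonzero
because of b_n. -/
theorem not_isIrreducible_of_polynomial_functional (hb : IsIntermediateBasis α β F b)
    (hE : HasLevel E 0 0) {N : LieSubmodule ℂ HVir E} (π : N →ₗ⁅ℂ,HVir⁆ Q)
    (hπ : Function.Surjective π) (hX : HasLevel M cL c) (hx : IsHighestWeight cL 0 c h hI x)
    (htop : hwSubmodule hX hx = ⊤) {m n : ℤ} (hm : b m ∈ N) (hn : b n ∈ N) (hmn : m < n)
    (hm0 : π ⟨b m, hm⟩ ≠ 0) (hn0 : π ⟨b n, hn⟩ ≠ 0) {f : M →ₗ[ℂ] ℂ[X]} (hf1 : f x = 1)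
    (hfI : ∀ k : ℕ, 0 < k → ∀ w, f ⁅e (.I (-k)), w⁆ = C (-F) * X ^ k * f w)
    (hfL : ∀ k : ℕ, 0 < k → ∀ w, f ⁅e (.L (-k)), w⁆ =
      X ^ k * (X * derivative (f w) + C (m + α + β + k * (1 - β)) * f w)) :
    ¬ LieModule.IsIrreducible ℂ HVir (Q ⊗[ℂ] M) := by
  obtain ⟨ξE, hξE⟩ : ∃ ξE : E →ₗ[ℂ] M →ₗ[ℂ] ℂ, ∀ i w, ξE (b i) w = intCoeff (i - m) (f w) :=
    ⟨b.constr ℂ fun i => (intCoeff (i - m)).comp f, fun i w => by rw [b.constr_basis]; rfl⟩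
  have hξEL : ∀ (k : ℕ), 0 < k → ∀ y w, ξE ⁅e (.L (-k)), y⁆ w + ξE y ⁅e (.L (-k)), w⁆ = 0 := by
    intro k hk y w
    have : (ξE.flip w).comp (act (e (.L (-k)))) + ξE.flip ⁅e (.L (-k)), w⁆ = 0 := by
      refine b.ext fun i => ?_
      simp only [LinearMap.add_apply, LinearMap.comp_apply, act_apply, hb.L, map_smul,
        LinearMap.flip_apply, hξE, LinearMap.zero_apply, hfL k hk]
      rw [intCoeff_X_pow_mul, map_add, intCoeff_X_mul_derivative, ← smul_eq_C_mul, map_smul,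
        show i + -(k : ℤ) - m = i - m - k by ring]
      simp only [smul_eq_mul]
      push_cast
      ring
    exact DFunLike.congr_fun this y
  have hξEI : ∀ (k : ℕ), 0 < k → ∀ y w, ξE ⁅e (.I (-k)), y⁆ w + ξE y ⁅e (.I (-k)), w⁆ = 0 := by
    intro k hk y w
    have : (ξE.flip w).comp (act (e (.I (-k)))) + ξE.flip ⁅e (.I (-k)), w⁆ = 0 := by
      refine b.ext fun i => ?_
      simp only [LinearMap.add_apply, LinearMap.comp_apply, act_apply, hb.I, map_smul,
        LinearMap.flip_apply, hξE, LinearMap.zero_apply, hfI k hk]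
      rw [mul_assoc, ← smul_eq_C_mul, map_smul, intCoeff_X_pow_mul,
        show i + -(k : ℤ) - m = i - m - k by ring]
      simp only [smul_eq_mul]
      ring
    exact DFunLike.congr_fun this y
  have hξEx : ∀ y, ξE y x = b.repr y m := by
    intro y
    have : ξE.flip x = b.coord m := by
      refine b.ext fun i => ?_
      rw [LinearMap.flip_apply, hξE, hf1, intCoeff_one, b.coord_apply, b.repr_self,
        Finsupp.single_apply]
      simp only [sub_eq_zero]
    exact DFunLike.congr_fun this y
  -- The pairing descends to Q: invariance moves the negative modes from w to y, which stays in the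
  -- kernel, and leaves the b_m-coefficient of y; were it nonzero, gradedness would put b_m itself
  -- in the kernel.
  have hker : ∀ (w : M) (y : N), π y = 0 → ξE y w = 0 := by
    intro w y hy
    have hw : w ∈ ⨆ j, negSpan (lineFamily x) j := by
      rw [← mem_negSubmodule hX hx.L_mem hx.I_mem]
      change w ∈ hwSubmodule hX hx
      rw [htop]
      exact LieSubmodule.mem_top w
    have hle : ⨆ j, negSpan (lineFamily x) j ≤
        ⨅ y : LinearMap.ker (π : N →ₗ[ℂ] Q), LinearMap.ker (ξE (y : N)) := by
      refine iSup_le fun j => Submodule.span_le.mpr fun w hw => ?_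
      rw [SetLike.mem_coe, Submodule.mem_iInf]
      induction hw with
      | @base j w hb' =>
        rintro ⟨y, hy⟩
        rw [lineFamily] at hb'
        split_ifs at hb' with hj
        · obtain ⟨a, rfl⟩ := Submodule.mem_span_singleton.mp hb'
          rw [LinearMap.mem_ker, map_smul, hξEx]
          by_cases h0 : b.repr (y : E) m = 0
          · rw [h0, smul_zero]
          · exfalso
            have h1 : (y : E) ∈ π.ker.map N.incl :=
              LieSubmodule.mem_map_of_mem (LieModuleHom.mem_ker.mpr hy)
            obtain ⟨y', hy', hyy⟩ :=
              (LieSubmodule.mem_map _).mp (basis_mem_of_repr_ne_zero hb _ h1 h0)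
            rw [show y' = ⟨b m, hm⟩ from Subtype.ext hyy] at hy'
            exact hm0 (LieModuleHom.mem_ker.mp hy')
        · rw [(Submodule.mem_bot ℂ).mp hb']
          exact Submodule.zero_mem _
      | @L k j w hk _ ih =>
        rintro ⟨y, hy⟩
        have h1 := ih ⟨⁅e (.L (-k)), y⁆, by
          rw [LinearMap.mem_ker]
          exact (LieModuleHom.map_lie π _ _).trans (by rw [show π y = 0 from hy, lie_zero])⟩
        have h2 := hξEL k hk y w
        rw [LinearMap.mem_ker] at h1 ⊢
        rw [← h2]
        exact right_eq_add.mpr h1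
      | @I k j w hk _ ih =>
        rintro ⟨y, hy⟩
        have h1 := ih ⟨⁅e (.I (-k)), y⁆, by
          rw [LinearMap.mem_ker]
          exact (LieModuleHom.map_lie π _ _).trans (by rw [show π y = 0 from hy, lie_zero])⟩
        have h2 := hξEI k hk y w
        rw [LinearMap.mem_ker] at h1 ⊢
        rw [← h2]
        exact right_eq_add.mpr h1
    exact (Submodule.mem_iInf _).mp (hle hw) ⟨y, hy⟩
  obtain ⟨ξ, hξ⟩ : ∃ ξ : Q →ₗ[ℂ] M →ₗ[ℂ] ℂ, ∀ y, ξ (π y) = ξE y := by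
    refine ⟨((LinearMap.ker (π : N →ₗ[ℂ] Q)).liftQ (ξE.comp (N : Submodule ℂ E).subtype)
      fun y hy => LinearMap.ext fun w => hker w y hy).comp
      ((π : N →ₗ[ℂ] Q).quotKerEquivOfSurjective hπ).symm.toLinearMap, fun y => ?_⟩
    have : ((π : N →ₗ[ℂ] Q).quotKerEquivOfSurjective hπ).symm (π y) = Submodule.Quotient.mk y := by
      rw [LinearEquiv.symm_apply_eq]
      rfl
    rw [LinearMap.comp_apply, LinearEquiv.coe_coe, this]
    rfl
  set Y₀ : Submodule ℂ N :=
    { carrier := {y | ∀ i ≤ m, b.repr (y : E) i = 0}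
      add_mem' := fun {y z} hy hz i hi => by
        rw [LieSubmodule.coe_add, map_add, Finsupp.add_apply, hy i hi, hz i hi, add_zero]
      zero_mem' := fun i _ => by rw [LieSubmodule.coe_zero, map_zero, Finsupp.zero_apply]
      smul_mem' := fun a y hy i hi => by
        rw [LieSubmodule.coe_smul, map_smul, Finsupp.smul_apply, hy i hi, smul_zero] } with hY₀
  refine not_isIrreducible_of_functional ((hE.lieSubmodule N).of_surjective π hπ) hX hx ξ ?_ ?_
    (q₀ := π ⟨b m, hm⟩) ?_ (Y₀.map (π : N →ₗ[ℂ] Q)) ?_ ?_ ?_ ?_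
  · intro k hk q w
    obtain ⟨y, rfl⟩ := hπ q
    rw [← LieModuleHom.map_lie, hξ, hξ]
    exact hξEL k hk y w
  · intro k hk q w
    obtain ⟨y, rfl⟩ := hπ q
    rw [← LieModuleHom.map_lie, hξ, hξ]
    exact hξEI k hk y w
  · rw [hξ, hξEx, b.repr_self, Finsupp.single_eq_same]
    exact one_ne_zero
  · intro hbot
    have : π ⟨b n, hn⟩ ∈ Y₀.map (π : N →ₗ[ℂ] Q) := by
      refine ⟨⟨b n, hn⟩, fun i hi => ?_, rfl⟩
      rw [b.repr_self, Finsupp.single_eq_of_ne (by omega)]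
    rw [hbot, Submodule.mem_bot] at this
    exact hn0 this
  · rintro _ ⟨y, hy, rfl⟩
    rw [LieModuleHom.coe_toLinearMap, hξ, hξEx, hy m le_rfl]
  · rintro k hk _ ⟨y, hy, rfl⟩
    refine ⟨⁅e (.L k), y⁆, fun i hi => ?_, LieModuleHom.map_lie π _ _⟩
    rw [LieSubmodule.coe_bracket, repr_lie (hb.L k), hy _ (by omega), mul_zero]
  · rintro k hk _ ⟨y, hy, rfl⟩
    refine ⟨⁅e (.I k), y⁆, fun i hi => ?_, LieModuleHom.map_lie π _ _⟩
    rw [LieSubmodule.coe_bracket, repr_lie (s := fun _ => F) (hb.I k), hy _ (by omega), mul_zero]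

end

end HVir
end

/-! ### Descent to the irreducible module and the criterion -/

noncomputable section

theorem LieSubmodule.exists_linearMap_quotient {M P : Type*} [AddCommGroup M] [Module ℂ M]
    [LieRingModule HVir M] [LieModule ℂ HVir M] [AddCommGroup P] [Module ℂ P]
    (N : LieSubmodule ℂ HVir M) (f : M →ₗ[ℂ] P) (hf : ∀ m ∈ N, f m = 0) :
    ∃ g : M ⧸ N →ₗ[ℂ] P, ∀ m, g (LieSubmodule.Quotient.mk' N m) = f m :=
  ⟨(N : Submodule ℂ M).liftQ f hf, fun _ => rfl⟩

namespace IrreducibleHW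
open HVir Polynomial

theorem isSmooth {cL c : ℂ} (h : ℂ) {hI : ℂ} : IsSmooth (IrreducibleHW cL 0 c h hI) := by
  intro w
  obtain ⟨m, rfl⟩ := LieSubmodule.Quotient.surjective_mk' _ w
  obtain ⟨K, hK⟩ := exists_forall_lie_eq_zero Verma.hasLevel Verma.isHighestWeight_hwv
    (w := m) (Verma.hwSubmodule_eq_top.symm ▸ LieSubmodule.mem_top m)
  refine ⟨K, fun n hn => ?_⟩
  rw [← LieModuleHom.map_lie, ← LieModuleHom.map_lie, (hK n hn).1, (hK n hn).2, map_zero]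
  exact ⟨rfl, rfl⟩

variable (cL : ℂ) {c : ℂ} (h : ℂ)

/-- Since g_p = 0, the functional on the Verma module kills S_p, hence the maximal submodule that
S_p generates. -/
theorem exists_functional (hc : c ≠ 0) {p : ℕ} (hp : 0 < p) {F : ℂ} (hF : schurCoeff c F p = 0)
    (A B : ℂ) : ∃ f : IrreducibleHW cL 0 c h (c * (p + 1)) →ₗ[ℂ] ℂ[X],
      f (hwv cL c h (c * (p + 1))) = 1 ∧
      (∀ k : ℕ, 0 < k → ∀ w, f ⁅e (.I (-k)), w⁆ = C (-F) * X ^ k * f w) ∧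
      (∀ k : ℕ, 0 < k → ∀ w, f ⁅e (.L (-k)), w⁆ =
        X ^ k * (X * derivative (f w) + C (A + k * B) * f w)) := by
  obtain ⟨f, hf1, hfI, hfL⟩ := Verma.exists_functional cL h hc (mul_add_one_ne hc hp) F A B
  have hfu : f (schurVec c (Verma.hwv cL 0 c h (c * (p + 1))) p) = 0 := by
    rw [functional_schurVec hc hf1 hfI, hF, map_zero, zero_mul]
  have hker : ∀ w ∈ Verma.maxSubmodule cL 0 c h (c * (p + 1)), f w = 0 := fun w hw =>
    functional_eq_zero hfu hfI hfL _ _ (Verma.maxSubmodule_le_hwSubmodule hc hp hw)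
  obtain ⟨g, hg⟩ := LieSubmodule.exists_linearMap_quotient _ f hker
  refine ⟨g, (hg _).trans hf1, fun k hk w => ?_, fun k hk w => ?_⟩ <;>
    obtain ⟨m, rfl⟩ := LieSubmodule.Quotient.surjective_mk' _ w
  · rw [← LieModuleHom.map_lie, hg, hg, hfI k hk m]
  · rw [← LieModuleHom.map_lie, hg, hg, hfL k hk m]

theorem hwSubmodule_eq_top {hI : ℂ} (hc : c ≠ 0) (hne : hI ≠ c) :
    hwSubmodule (hasLevel cL h) (isHighestWeight_hwv cL (c := c) (hI := hI) h) = ⊤ := by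
  have := isIrreducible cL h hc hne
  exact (IsSimpleOrder.eq_bot_or_eq_top _).resolve_left fun h0 => hwv_ne_zero cL h hc hne
    ((LieSubmodule.eq_bot_iff _).mp h0 _ (self_mem_hwSubmodule _ _))

end IrreducibleHW

namespace HVir

theorem schurCoeff_eq_zero_iff {c : ℂ} (hc : c ≠ 0) (F : ℂ) (p : ℕ) :
    schurCoeff c F p = 0 ↔ ∃ i ∈ Finset.Icc 1 p, F = ((i : ℂ) - (p : ℂ)) * c := by
  rw [schurCoeff, Finset.prod_eq_zero_iff]
  constructor
  · rintro ⟨j, hj, h0⟩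
    rw [Finset.mem_range] at hj
    rw [div_eq_zero_iff, or_iff_left (mul_ne_zero hc (Nat.cast_add_one_ne_zero j))] at h0
    refine ⟨p - j, Finset.mem_Icc.mpr ⟨by omega, by omega⟩, ?_⟩
    rw [Nat.cast_sub hj.le]
    linear_combination h0
  · rintro ⟨i, hi, rfl⟩
    rw [Finset.mem_Icc] at hi
    refine ⟨p - i, Finset.mem_range.mpr (by omega), ?_⟩
    rw [Nat.cast_sub hi.2]
    ring_nf

variable {E Q : Type*} [AddCommGroup E] [Module ℂ E] [LieRingModule HVir E] [LieModule ℂ HVir E]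
  [AddCommGroup Q] [Module ℂ Q] [LieRingModule HVir Q] [LieModule ℂ HVir Q]
  {α β F : ℂ} {b : Module.Basis ℤ ℂ E}

theorem isIrreducible_subquotient_tensor_iff (hb : IsIntermediateBasis α β F b)
    (hE : HasLevel E 0 0) {N : LieSubmodule ℂ HVir E} (π : N →ₗ⁅ℂ,HVir⁆ Q)
    (hπ : Function.Surjective π) (hQ : ∃ (m n : ℤ) (hm : b m ∈ N) (hn : b n ∈ N),
      m < n ∧ π ⟨b m, hm⟩ ≠ 0 ∧ π ⟨b n, hn⟩ ≠ 0) (cL : ℂ) {c : ℂ} (hc : c ≠ 0) (h : ℂ) {p : ℕ}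
    (hp : 0 < p) :
    LieModule.IsIrreducible ℂ HVir (Q ⊗[ℂ] IrreducibleHW cL 0 c h (c * (p + 1))) ↔
      ∀ i ∈ Finset.Icc 1 p, F ≠ ((i : ℂ) - (p : ℂ)) * c := by
  obtain ⟨m, n, hm, hn, hmn, hm0, hn0⟩ := hQ
  have hne := mul_add_one_ne hc hp
  constructor
  · intro hirr
    by_contra! hF
    obtain ⟨f, hf1, hfI, hfL⟩ := IrreducibleHW.exists_functional cL h hc hp
      ((schurCoeff_eq_zero_iff hc F p).mpr hF) (m + α + β) (1 - β)
    exact not_isIrreducible_of_polynomial_functional hb hE π hπ (IrreducibleHW.hasLevel cL h)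
      (IrreducibleHW.isHighestWeight_hwv cL h) (IrreducibleHW.hwSubmodule_eq_top cL h hc hne)
      hm hn hmn hm0 hn0 hf1 hfI hfL hirr
  · intro hF
    have : Nontrivial Q := ⟨_, _, hm0⟩
    -- The case i = p of the condition.
    have hF0 : F ≠ 0 := by
      have := hF p (Finset.mem_Icc.mpr ⟨hp, le_rfl⟩)
      rwa [sub_self, zero_mul] at this
    obtain ⟨b', hb'⟩ := exists_basis_of_surjective hb hF0 π hπ
    have := IrreducibleHW.isIrreducible cL h hc hne
    refine isIrreducible_tensor hc hb' hF0 (IrreducibleHW.isSmooth h)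
      (IrreducibleHW.hwv_ne_zero cL h hc hne) (IrreducibleHW.schurVec_hwv cL h hc hp) ?_
    intro j hj h0
    refine hF (p - j) (Finset.mem_Icc.mpr ⟨by omega, by omega⟩) ?_
    rw [Nat.cast_sub hj.le]
    linear_combination h0

end HVir

end

theorem mainTheorem2 (cL cLI h hI : ℂ) (hc : cLI ≠ 0) (p : ℕ) (hp : 0 < p)
    (hpI : hI / cLI - 1 = (p : ℂ)) (α β F : ℂ) :
    (LieModule.IsIrreducible ℂ HVir
        (IntermediateSeries α β F ⊗[ℂ] IrreducibleHW cL 0 cLI h hI) ↔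
      ∀ i ∈ Finset.Icc 1 p, F ≠ ((i : ℂ) - (p : ℂ)) * cLI) ∧
    ∀ (N : LieSubmodule ℂ HVir (IntermediateSeries α β F)) (N' : LieSubmodule ℂ HVir N),
      LieModule.IsIrreducible ℂ HVir (N ⧸ N') → ¬ LieModule.IsTrivial HVir (N ⧸ N') →
      (LieModule.IsIrreducible ℂ HVir ((N ⧸ N') ⊗[ℂ] IrreducibleHW cL 0 cLI h hI) ↔
        ∀ i ∈ Finset.Icc 1 p, F ≠ ((i : ℂ) - (p : ℂ)) * cLI) := by
  obtain rfl : hI = cLI * (p + 1) := by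
    field_simp at hpI
    linear_combination hpI
  have hb := IntermediateSeries.isIntermediateBasis α β F
  have hE := IntermediateSeries.hasLevel α β F
  constructor
  -- The whole module is the subquotient with N = ⊤ and π the inclusion; v_0 and v_1 serve as the
  -- two surviving degrees.
  · refine HVir.isIrreducible_subquotient_tensor_iff hb hE
      (⊤ : LieSubmodule ℂ HVir (IntermediateSeries α β F)).incl
      (fun y => ⟨⟨y, LieSubmodule.mem_top y⟩, rfl⟩) ⟨0, 1, LieSubmodule.mem_top _,
        LieSubmodule.mem_top _, by omega, ?_, ?_⟩ cL hc h hp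
    · exact (IntermediateSeries.basis α β F).ne_zero 0
    · exact (IntermediateSeries.basis α β F).ne_zero 1
  · intro N N' _ htriv
    exact HVir.isIrreducible_subquotient_tensor_iff hb hE (LieSubmodule.Quotient.mk' N')
      (LieSubmodule.Quotient.surjective_mk' N')
      (HVir.exists_lt_of_not_isTrivial hb hE _ (LieSubmodule.Quotient.surjective_mk' N') htriv)
      cL hc h hp
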